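/- Let $\mathcal H$ be a real separable Hilbert space with orthonormal basis $(\phi_j)_{j\ge1}$, and let $C:\mathcal H\to\mathcal H$ be a bounded linear operator with $C\phi_j=\lambda_j^2\phi_j$, where for some $\kappa>\tfrac12$ and $M_-,M_+\in(0,\infty)$ one has $M_-\le j^{\kappa}\lambda_j\le M_+$ for all $j\ge1$. For $r\in\mathbb R$ put $\langle x,y\rangle_r=\sum_j j^{2r}x_jy_j$ and $\|x\|_r^2=\sum_j j^{2r}x_j^2$ with $x_j=\langle x,\phi_j\rangle$, and let $\mathcal H^r$ be the corresponding space of expansions $\sum_j x_j\phi_j$ with $\|x\|_r<\infty$. Fix $s\in[0,\kappa-\tfrac12)$ and let $\Psi:\mathcal H^s\to\mathbb R$ be twice Fréchet differentiable, with gradient $\nabla\Psi(x)\in\mathcal H^{-s}$ (taken with respect to the pairing $\langle\cdot,\cdot\rangle$ of $\mathcal H$) and second derivative $\partial^2\Psi(x):\mathcal H^s\to\mathcal H^{-s}$, such that for some constants $M_1,\dots,M_4\in\mathbb R$ and all $x\in\mathcal H^s$ $$M_1\le\Psi(x)\le M_2(1+\|x\|_s^2),\qquad \|\nabla\Psi(x)\|_{-s}\le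 M_3(1+\|x\|_s),\qquad \|\partial^2\Psi(x)\|_{\mathcal L(\mathcal H^s,\mathcal H^{-s})}\le M_4 .$$ For $N\in\mathbb N$ let $P^N$ be the projection onto $X^N=\mathrm{span}\{\phi_1,\dots,\phi_N\}$, let $C^N=P^NCP^N$ and $\Psi^N=\Psi\circ P^N$. Let $\pi_0=\mathrm N(0,C)$ be the centred Gaussian measure on $\mathcal H$ with covariance operator $C$, and let $\pi^N$ be the probability measure with $d\pi^N/d\pi_0\propto\exp(-\Psi^N)$. Fix $\ell>0$ and let $\beta=2\Phi(-\ell/\sqrt2)$, where $\Phi$ is the standard normal distribution function. For each $N$ let $(x^k)_{k\ge0}$ be the random walk Metropolis (RWM) chain with $x^0=x\sim\pi^N$, $$x^{k+1}=\gamma^{k+1}y^{k+1}+(1-\gamma^{k+1})x^k,\qquad y^{k+1}=x^k+\sqrt{\tfrac{2\ell^2}{N}}\,C^{1/2}\xi^{k+1},\qquad \xi^{k+1}=\sum_{i=1}^N\xi_i^{k+1}\phi_i ,$$ where the $\xi_i^{k+1}$ are i.i.d. $\mathrm N(0,1)$, $\xi^{k+1}$ is independent of $\mathcal F_k=\sigma(x^n,\xi^n,\gamma^n:n\le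 k)$ (with $\xi^0=0$, $\gamma^0=0$), and, given $\mathcal F_k$ and $\xi^{k+1}$, $\gamma^{k+1}\in\{0,1\}$ is Bernoulli with parameter $\alpha(x^k,\xi^{k+1})=1\wedge e^{Q(x^k,\xi^{k+1})}$; here, with $y=x+\sqrt{2\ell^2/N}\,C^{1/2}\xi$, $$Q(x,\xi)=\tfrac12\|C^{-1/2}P^Nx\|^2-\tfrac12\|C^{-1/2}P^Ny\|^2+\Psi^N(x)-\Psi^N(y).$$ Write $\mathbb E_0=\mathbb E(\cdot\mid\mathcal F_0)$ and $(u\otimes v)z=\langle v,z\rangle u$. Then $x^1-x$ and $(x^1-x)\otimes(x^1-x)$ are integrable, and $$N\,\mathbb E_0(x^1-x)=-\ell^2\beta\big(P^Nx+C^N\nabla\Psi^N(x)\big)+r^N,$$ $$N\,\mathbb E_0\big[(x^1-x)\otimes(x^1-x)\big]=2\ell^2\beta\,C^N+E^N$$ almost surely, where the error terms satisfy, as $N\to\infty$, $$\mathbb E^{\pi^N}\|r^N\|_s^2\to0,\qquad \mathbb E^{\pi^N}\sum_{i=1}^N\big|\langle\phi_i,E^N\phi_i\rangle_s\big|\to0,\qquad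 \mathbb E^{\pi^N}\big|\langle\phi_i,E^N\phi_j\rangle_s\big|\to0\ \text{ for every fixed pair } i,j .$$ -/

import Mathlib

open MeasureTheory ProbabilityTheory Filter Topology

namespace RWM

noncomputable section

/-! ### Sobolev-like spaces

Basis indices start at `0` here, so the basis vector usually numbered `j + 1` is `φ j`, and
the weight of its coordinate in the norm of order `r` is `(j + 1) ^ (2 r)`. -/

/-- The weight `(j + 1) ^ (2 r)`. -/
def weight (r : ℝ) (j : ℕ) : ℝ := ((j : ℝ) + 1) ^ (2 * r)

lemma weight_pos (r : ℝ) (j : ℕ) : 0 < weight r j := Real.rpow_pos_of_pos (by positivity) _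

lemma summable_weight_mul {r : ℝ} {x y : ℕ → ℝ} (hx : Summable fun j => weight r j * x j ^ 2)
    (hy : Summable fun j => weight r j * y j ^ 2) :
    Summable fun j => weight r j * (x j * y j) := by
  refine Summable.of_norm_bounded (hx.add hy) fun j => ?_
  have h := (weight_pos r j).le
  rw [Real.norm_eq_abs, abs_mul, abs_of_nonneg h, ← mul_add]
  refine mul_le_mul_of_nonneg_left ?_ h
  rw [abs_le]
  constructor <;> nlinarith [sq_nonneg (x j + y j), sq_nonneg (x j - y j), sq_nonneg (x j),
    sq_nonneg (y j)]

/-- Coordinate sequences with finite norm of order `r`. -/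
def sobolevSubmodule (r : ℝ) : Submodule ℝ (ℕ → ℝ) where
  carrier := {x | Summable fun j => weight r j * x j ^ 2}
  zero_mem' := by simp [summable_zero]
  add_mem' := by
    intro x y hx hy
    have h := (hx.add hy).add ((summable_weight_mul hx hy).mul_left 2)
    refine h.congr fun j => ?_
    simp only [Pi.add_apply]
    ring
  smul_mem' := by
    intro c x hx
    refine (Summable.mul_left (c ^ 2) hx).congr fun j => ?_
    simp only [Pi.smul_apply, smul_eq_mul]
    ring

/-- The space `H^r`, `r` any real number: expansions `∑ j, x_j φ_j` in the eigenbasis with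
`∑ j, (j + 1) ^ (2 r) x_j ^ 2 < ∞`, an element being given by its coordinates `x_j`. -/
def SobolevSpace (r : ℝ) : Type := sobolevSubmodule r

namespace SobolevSpace

variable {r : ℝ}

/-- The element with given coordinates. -/
def mk (x : ℕ → ℝ) (hx : Summable fun j => weight r j * x j ^ 2) : SobolevSpace r := ⟨x, hx⟩

/-- The `j`-th coordinate `x_j = ⟨x, φ_j⟩`. -/
def coord (x : SobolevSpace r) (j : ℕ) : ℝ := x.1 j

lemma summable (x : SobolevSpace r) : Summable fun j => weight r j * x.coord j ^ 2 := x.2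

@[simp] lemma coord_mk (x : ℕ → ℝ) (hx : Summable fun j => weight r j * x j ^ 2) (j : ℕ) :
    (mk x hx).coord j = x j := rfl

@[ext] lemma ext {x y : SobolevSpace r} (h : ∀ j, x.coord j = y.coord j) : x = y :=
  Subtype.ext (funext h)

section Core

/-- Coordinatewise addition. -/
@[reducible] def addCommGroup (r : ℝ) : AddCommGroup (SobolevSpace r) :=
  inferInstanceAs (AddCommGroup (sobolevSubmodule r))

attribute [local instance] addCommGroup

/-- Coordinatewise multiplication by scalars. -/
@[reducible] def module (r : ℝ) : Module ℝ (SobolevSpace r) :=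
  inferInstanceAs (Module ℝ (sobolevSubmodule r))

attribute [local instance] module

/-- The inner product `⟨x, y⟩_r = ∑ j, (j + 1) ^ (2 r) x_j y_j`. -/
@[reducible] def innerCore (r : ℝ) : InnerProductSpace.Core ℝ (SobolevSpace r) where
  inner x y := ∑' j, weight r j * (x.coord j * y.coord j)
  conj_inner_symm x y := by
    simp only [conj_trivial]
    exact tsum_congr fun j => by ring
  re_inner_nonneg x := by
    simp only [RCLike.re_to_real]
    exact tsum_nonneg fun j => mul_nonneg (weight_pos r j).le (mul_self_nonneg _)
  add_left x y z := by
    rw [← (summable_weight_mul x.summable z.summable).tsum_add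
      (summable_weight_mul y.summable z.summable)]
    exact tsum_congr fun j => by
      rw [show (x + y).coord j = x.coord j + y.coord j from rfl]; ring
  smul_left x y c := by
    simp only [conj_trivial]
    rw [← tsum_mul_left]
    exact tsum_congr fun j => by
      rw [show (c • x).coord j = c * x.coord j from rfl]; ring
  definite x hx := by
    have hs := summable_weight_mul x.summable x.summable
    have h0 : ∀ j, 0 ≤ weight r j * (x.coord j * x.coord j) := fun j =>
      mul_nonneg (weight_pos r j).le (mul_self_nonneg _)
    have h := (hasSum_zero_iff_of_nonneg h0).1 (hx ▸ hs.hasSum)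
    refine ext fun j => ?_
    change x.coord j = 0
    have hj := congrFun h j
    simpa [(weight_pos r j).ne'] using hj

instance : NormedAddCommGroup (SobolevSpace r) := (innerCore r).toNormedAddCommGroup

instance : InnerProductSpace ℝ (SobolevSpace r) := InnerProductSpace.ofCore (innerCore r).toCore

end Core

@[simp] lemma coord_add (x y : SobolevSpace r) (j : ℕ) :
    (x + y).coord j = x.coord j + y.coord j := rfl

@[simp] lemma coord_smul (c : ℝ) (x : SobolevSpace r) (j : ℕ) :
    (c • x).coord j = c * x.coord j := rfl

@[simp] lemma coord_zero (j : ℕ) : (0 : SobolevSpace r).coord j = 0 := rfl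

lemma inner_def (x y : SobolevSpace r) :
    inner ℝ x y = ∑' j, weight r j * (x.coord j * y.coord j) := rfl

lemma norm_sq_eq (x : SobolevSpace r) : ‖x‖ ^ 2 = ∑' j, weight r j * x.coord j ^ 2 := by
  rw [← real_inner_self_eq_norm_sq, inner_def]
  exact tsum_congr fun j => by ring

/-- The element of `X^N = span {φ_0, …, φ_{N-1}}` with coordinates `x_j`, `j < N`. -/
def ofFinite (r : ℝ) (N : ℕ) (x : ℕ → ℝ) : SobolevSpace r :=
  mk (fun j => if j < N then x j else 0) <|
    summable_of_ne_finset_zero (s := Finset.range N) fun j hj => by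
      simp [Finset.mem_range.not.1 hj]

/-- The projection `P^N` of `H^r` onto `X^N`. -/
def proj (N : ℕ) (x : SobolevSpace r) : SobolevSpace r := ofFinite r N x.coord

/-- The basis vector `φ_j` as an element of `H^r`. -/
def basisVec (r : ℝ) (j : ℕ) : SobolevSpace r :=
  mk (Pi.single j 1) <|
    summable_of_ne_finset_zero (s := {j}) fun k hk => by
      simp [Pi.single_eq_of_ne (Finset.mem_singleton.not.1 hk)]

lemma coord_sum {ι : Type*} (F : Finset ι) (v : ι → SobolevSpace r) (j : ℕ) :
    (∑ i ∈ F, v i).coord j = ∑ i ∈ F, (v i).coord j := by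
  classical
  induction F using Finset.induction_on with
  | empty => simp
  | insert a F ha ih => rw [Finset.sum_insert ha, Finset.sum_insert ha, coord_add, ih]

lemma weight_neg (r : ℝ) (j : ℕ) : weight (-r) j = (weight r j)⁻¹ := by
  unfold weight
  rw [mul_neg, Real.rpow_neg (by positivity)]

/-- A bounded functional `L` on `H^r` has coordinates `L φ_j` in `H^{-r}`. -/
lemma summable_functional (L : SobolevSpace r →L[ℝ] ℝ) :
    Summable fun j => weight (-r) j * (L (basisVec r j)) ^ 2 := by
  refine summable_of_sum_le (c := ‖L‖ ^ 2)
    (fun j => mul_nonneg (weight_pos _ j).le (sq_nonneg _)) fun F => ?_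
  set S := ∑ j ∈ F, weight (-r) j * (L (basisVec r j)) ^ 2 with hS
  set v : SobolevSpace r := ∑ j ∈ F, (weight (-r) j * L (basisVec r j)) • basisVec r j with hv
  have hS0 : 0 ≤ S := Finset.sum_nonneg fun j _ => mul_nonneg (weight_pos _ j).le (sq_nonneg _)
  have hLv : L v = S := by
    rw [hv, map_sum, hS]
    refine Finset.sum_congr rfl fun j _ => ?_
    rw [map_smul, smul_eq_mul]
    ring
  have hvj : ∀ j, v.coord j = if j ∈ F then weight (-r) j * L (basisVec r j) else 0 := by
    intro j
    rw [hv, coord_sum]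
    simp [basisVec, Pi.single_apply]
  have hvn : ‖v‖ ^ 2 = S := by
    rw [norm_sq_eq, tsum_eq_sum (s := F) fun j hj => by rw [hvj, if_neg hj]; simp, hS]
    refine Finset.sum_congr rfl fun j hj => ?_
    rw [hvj, if_pos hj, weight_neg]
    have := (weight_pos r j).ne'
    field_simp
  have h1 : S ≤ ‖L‖ * ‖v‖ := by
    rw [← hLv]
    exact (le_abs_self _).trans (L.le_opNorm v)
  have h2 : S * S ≤ ‖L‖ ^ 2 * S := by
    calc S * S ≤ (‖L‖ * ‖v‖) * (‖L‖ * ‖v‖) := mul_self_le_mul_self hS0 h1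
      _ = ‖L‖ ^ 2 * S := by rw [← hvn]; ring
  rcases hS0.eq_or_lt with h | h
  · rw [← h]; positivity
  · exact le_of_mul_le_mul_right h2 h

/-- The gradient `∇f(x) ∈ H^{-r}` of `f : H^r → ℝ`, that is, the Fréchet derivative of `f` at `x`
read through the pairing `⟨·, ·⟩` of `H`: its coordinates are `∂f/∂φ_j (x)`. -/
def grad (f : SobolevSpace r → ℝ) (x : SobolevSpace r) : SobolevSpace (-r) :=
  mk (fun j => fderiv ℝ f x (basisVec r j)) (summable_functional _)

/-- The second derivative `∂²f(x) : H^r → H^{-r}`. -/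
def hess (f : SobolevSpace r → ℝ) (x : SobolevSpace r) : SobolevSpace r →L[ℝ] SobolevSpace (-r) :=
  fderiv ℝ (grad f) x

end SobolevSpace

open SobolevSpace

/-! ### Assumptions on the covariance and on the potential -/

/-- `M₋ ≤ i ^ κ λ_i ≤ M₊` for all `i ≥ 1`. -/
def EigenvalueDecay (lam : ℕ → ℝ) (κ : ℝ) : Prop :=
  ∃ Mm Mp : ℝ, 0 < Mm ∧ 0 < Mp ∧
    ∀ j : ℕ, Mm ≤ ((j : ℝ) + 1) ^ κ * lam j ∧ ((j : ℝ) + 1) ^ κ * lam j ≤ Mp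

/-- `Ψ : H^s → ℝ` is twice differentiable, bounded below, quadratically bounded above, its gradient
is linearly bounded in `H^{-s}` and its second derivative is bounded from `H^s` to `H^{-s}`. -/
structure PotentialBounds {s : ℝ} (Ψ : SobolevSpace s → ℝ) : Prop where
  differentiable : Differentiable ℝ Ψ
  differentiable_grad : Differentiable ℝ (grad Ψ)
  bounds : ∃ M₁ M₂ M₃ M₄ : ℝ, ∀ x : SobolevSpace s,
    M₁ ≤ Ψ x ∧ Ψ x ≤ M₂ * (1 + ‖x‖ ^ 2) ∧
    ‖grad Ψ x‖ ≤ M₃ * (1 + ‖x‖) ∧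
    ‖hess Ψ x‖ ≤ M₄

/-- `Ψ^N = Ψ ∘ P^N`. -/
def psiN {s : ℝ} (Ψ : SobolevSpace s → ℝ) (N : ℕ) (x : SobolevSpace s) : ℝ := Ψ (proj N x)

/-! ### Operators on `H` -/

variable {H : Type*} [NormedAddCommGroup H] [InnerProductSpace ℝ H]

/-- The operator on `H` which sends `φ_j` to `d_j φ_j` for `j < N` and to `0` for `j ≥ N`. -/
def diagN (φ : HilbertBasis ℕ ℝ H) (d : ℕ → ℝ) (N : ℕ) : H →L[ℝ] H :=
  ∑ j ∈ Finset.range N, d j • InnerProductSpace.rankOne ℝ (φ j) (φ j)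

/-- The projection `P^N` of `H` onto `X^N = span {φ_0, …, φ_{N-1}}`. -/
def PN (φ : HilbertBasis ℕ ℝ H) (N : ℕ) : H →L[ℝ] H := diagN φ (fun _ => 1) N

/-- `C^N = P^N C P^N`. -/
def CN (φ : HilbertBasis ℕ ℝ H) (C : H →L[ℝ] H) (N : ℕ) : H →L[ℝ] H :=
  PN φ N ∘L C ∘L PN φ N

/-- `P^N x`, for `x` in `H`, as an element of `H^s`. -/
def toSobolev (φ : HilbertBasis ℕ ℝ H) (s : ℝ) (N : ℕ) (x : H) : SobolevSpace s :=
  ofFinite s N fun j => inner ℝ (φ j) x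

/-- `∇Ψ^N(x)`, which lies in `X^N`, as an element of `H`. -/
def gradPsiN (φ : HilbertBasis ℕ ℝ H) {s : ℝ} (Ψ : SobolevSpace s → ℝ) (N : ℕ) (x : H) : H :=
  ∑ j ∈ Finset.range N, (grad (psiN Ψ N) (toSobolev φ s N x)).coord j • φ j

/-- `⟨u, v⟩_s` for `u, v` in `H`. -/
def sobInner (φ : HilbertBasis ℕ ℝ H) (s : ℝ) (u v : H) : ℝ :=
  ∑' j, weight s j * (inner ℝ (φ j) u * inner ℝ (φ j) v)

/-- `‖v‖_s ^ 2 ∈ [0, ∞]` for `v` in `H`. -/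
def sobNormSq (φ : HilbertBasis ℕ ℝ H) (s : ℝ) (v : H) : ENNReal :=
  ∑' j, ENNReal.ofReal (weight s j * inner ℝ (φ j) v ^ 2)

/-! ### The target measures and the chain -/

/-- `π₀ = N(0, C)`, the centred Gaussian measure on `H` with covariance operator `C`. -/
structure IsCenteredGaussian [MeasurableSpace H] [BorelSpace H] (π₀ : Measure H)
    (C : H →L[ℝ] H) : Prop where
  gaussian : IsGaussian π₀
  mean_zero : ∫ x, x ∂π₀ = 0
  covariance : ∀ u v : H, covarianceBilin π₀ u v = inner ℝ (C u) v

/-- `π^N`, with `dπ^N/dπ₀` proportional to `exp (-Ψ^N)` and total mass one. -/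
def targetN [MeasurableSpace H] (φ : HilbertBasis ℕ ℝ H) {s : ℝ} (Ψ : SobolevSpace s → ℝ)
    (π₀ : Measure H) (N : ℕ) : Measure H :=
  π₀.tilted fun x => -psiN Ψ N (toSobolev φ s N x)

/-- The law of `∑_{i < N} ξ_i φ_i` with `ξ_i` i.i.d. standard normal. -/
def noiseLaw [MeasurableSpace H] (φ : HilbertBasis ℕ ℝ H) (N : ℕ) : Measure H :=
  (Measure.pi fun _ : Fin N => gaussianReal 0 1).map fun z => ∑ i : Fin N, z i • φ i

/-- The proposal `y = x + √(2 ℓ² / N) C^{1/2} ξ`, for `ξ` in `X^N`. -/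
def proposal (φ : HilbertBasis ℕ ℝ H) (lam : ℕ → ℝ) (ℓ : ℝ) (N : ℕ) (x ξ : H) : H :=
  x + √(2 * ℓ ^ 2 / N) • diagN φ lam N ξ

/-- `Q(x, ξ) = ½‖C^{-1/2} P^N x‖² - ½‖C^{-1/2} P^N y‖² + Ψ^N(x) - Ψ^N(y)`,
`y` being the proposal. -/
def logRatio (φ : HilbertBasis ℕ ℝ H) (lam : ℕ → ℝ) {s : ℝ} (Ψ : SobolevSpace s → ℝ) (ℓ : ℝ)
    (N : ℕ) (x ξ : H) : ℝ :=
  let y := proposal φ lam ℓ N x ξ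
  1 / 2 * ‖diagN φ (fun j => (lam j)⁻¹) N x‖ ^ 2
    - 1 / 2 * ‖diagN φ (fun j => (lam j)⁻¹) N y‖ ^ 2
    + psiN Ψ N (toSobolev φ s N x) - psiN Ψ N (toSobolev φ s N y)

/-- The acceptance probability `α(x, ξ) = 1 ∧ exp Q(x, ξ)`. -/
def acceptProb (φ : HilbertBasis ℕ ℝ H) (lam : ℕ → ℝ) {s : ℝ} (Ψ : SobolevSpace s → ℝ) (ℓ : ℝ)
    (N : ℕ) (x ξ : H) : ℝ :=
  min 1 (Real.exp (logRatio φ lam Ψ ℓ N x ξ))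

/-- `F_k`, the σ-algebra generated by `x^n, ξ^n, γ^n`, `n ≤ k`. -/
@[reducible] def history {Ω : Type*} [MeasurableSpace H] (x ξ : ℕ → Ω → H) (γ : ℕ → Ω → ℝ) (k : ℕ) :
    MeasurableSpace Ω :=
  ⨆ n ∈ Finset.range (k + 1),
    (MeasurableSpace.comap (x n) inferInstance ⊔ MeasurableSpace.comap (ξ n) inferInstance ⊔
      MeasurableSpace.comap (γ n) inferInstance)

/-- `x^k` is the random walk Metropolis chain in dimension `N` started from `π^N`, driven by the
noises `ξ^k` and the acceptance variables `γ^k`, on the probability space `(Ω, P)`. -/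
structure IsRWMChain {Ω : Type*} [MeasurableSpace Ω] (P : Measure Ω) [MeasurableSpace H]
    (φ : HilbertBasis ℕ ℝ H) (lam : ℕ → ℝ) {s : ℝ} (Ψ : SobolevSpace s → ℝ) (π₀ : Measure H)
    (ℓ : ℝ) (N : ℕ) (x ξ : ℕ → Ω → H) (γ : ℕ → Ω → ℝ) : Prop where
  measurable_x : ∀ k, Measurable (x k)
  measurable_noise : ∀ k, Measurable (ξ k)
  measurable_accept : ∀ k, Measurable (γ k)
  /-- The chain starts in stationarity. -/
  law_init : P.map (x 0) = targetN φ Ψ π₀ N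
  noise_zero : ξ 0 = 0
  accept_zero : γ 0 = 0
  law_noise : ∀ k, P.map (ξ (k + 1)) = noiseLaw φ N
  /-- `ξ^{k+1}` is independent of the past. -/
  indep_noise : ∀ k,
    Indep (MeasurableSpace.comap (ξ (k + 1)) inferInstance) (history x ξ γ k) P
  accept_values : ∀ k ω, γ (k + 1) ω = 0 ∨ γ (k + 1) ω = 1
  /-- Given the past and `ξ^{k+1}`, the variable `γ^{k+1}` is Bernoulli with parameter
  `α(x^k, ξ^{k+1})`. -/
  accept_prob : ∀ k,
    P[γ (k + 1) | history x ξ γ k ⊔ MeasurableSpace.comap (ξ (k + 1)) inferInstance]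
      =ᵐ[P] fun ω => acceptProb φ lam Ψ ℓ N (x k ω) (ξ (k + 1) ω)
  step : ∀ k ω, x (k + 1) ω =
    γ (k + 1) ω • proposal φ lam ℓ N (x k ω) (ξ (k + 1) ω) + (1 - γ (k + 1) ω) • x k ω

/-- `β = 2 Φ(-ℓ/√2)`, `Φ` being the standard normal distribution function. -/
def beta (ℓ : ℝ) : ℝ := 2 * cdf (gaussianReal 0 1) (-ℓ / √2)

end

end RWM

/-!
In the coordinates `⟨x, φ_j⟩ / λ_j` the measure `π₀` is a standard Gaussian measure, and `π^N` is
dominated by `K π₀` with `K` independent of `N`, so the error bounds only have to be integrated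
against the Gaussian measure. There the logarithm `Q` of the acceptance ratio is, up to an error of
order `N^{-1/2}` in mean square, a Gaussian variable with mean `-ℓ²` and variance `2ℓ²`.

Write `acc q = 1 ∧ exp q`. Gaussian integration by parts turns `E[ξ_i acc Q]` into
`E[acc' Q · ∂Q/∂ξ_i]`, and `∂Q/∂ξ_i` is nearly `-√(2ℓ²/N)` times the `i`-th normalised coordinate
of `P^N x + C^N ∇Ψ^N(x)`. For the limiting Gaussian law `E[acc' Q] = β/2` and `E[acc Q] = β`, which
gives the drift and the covariance.
-/

namespace RWM

noncomputable section

/-! ### The acceptance function -/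

/-- The Metropolis acceptance function `q ↦ 1 ∧ exp q`. -/
def acc (q : ℝ) : ℝ := min 1 (Real.exp q)

lemma acc_nonneg (q : ℝ) : 0 ≤ acc q := le_min zero_le_one (Real.exp_pos q).le

lemma acc_le_one (q : ℝ) : acc q ≤ 1 := min_le_left _ _

lemma abs_acc_le_one (q : ℝ) : |acc q| ≤ 1 := (abs_of_nonneg (acc_nonneg q)).trans_le (acc_le_one q)

lemma continuous_acc : Continuous acc := by unfold acc; fun_prop

lemma acc_of_nonneg {q : ℝ} (h : 0 ≤ q) : acc q = 1 := min_eq_left (Real.one_le_exp h)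

lemma acc_of_nonpos {q : ℝ} (h : q ≤ 0) : acc q = Real.exp q :=
  min_eq_right (Real.exp_le_one_iff.2 h)

lemma acc_sub_acc_le {p q : ℝ} (h : p ≤ q) : acc q - acc p ≤ q - p := by
  rcases le_total 0 p with hp | hp
  · rw [acc_of_nonneg hp, acc_of_nonneg (hp.trans h), sub_self]
    exact sub_nonneg.2 h
  have key : 1 - acc q * (q - p) ≤ 1 - (acc q - acc p) := by
    rw [acc_of_nonpos hp]
    rcases le_total q 0 with hq | hq
    · rw [acc_of_nonpos hq]
      have hexp : Real.exp q * Real.exp (p - q) = Real.exp p := by rw [← Real.exp_add]; ring_nf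
      nlinarith [Real.add_one_le_exp (p - q), Real.exp_pos q]
    · rw [acc_of_nonneg hq]
      linarith [Real.add_one_le_exp p]
  nlinarith [acc_le_one q]

lemma acc_mono : Monotone acc := fun _ _ h => min_le_min le_rfl (Real.exp_le_exp.2 h)

lemma abs_acc_sub_acc_le (p q : ℝ) : |acc p - acc q| ≤ |p - q| := by
  wlog h : q ≤ p generalizing p q
  · rw [abs_sub_comm, abs_sub_comm p]
    exact this q p (le_of_not_ge h)
  rw [abs_of_nonneg (sub_nonneg.2 (acc_mono h)), abs_of_nonneg (sub_nonneg.2 h)]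
  exact acc_sub_acc_le h

/-- The derivative of the acceptance function away from its kink at `0`, where the value is set
to `0`. -/
def accDeriv (q : ℝ) : ℝ := if q < 0 then Real.exp q else 0

lemma accDeriv_of_neg {q : ℝ} (h : q < 0) : accDeriv q = Real.exp q := if_pos h

lemma accDeriv_of_nonneg {q : ℝ} (h : 0 ≤ q) : accDeriv q = 0 := if_neg h.not_gt

lemma accDeriv_nonneg (q : ℝ) : 0 ≤ accDeriv q := by
  unfold accDeriv
  split_ifs <;> positivity

lemma accDeriv_le_one (q : ℝ) : accDeriv q ≤ 1 := by
  unfold accDeriv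
  split_ifs with h
  exacts [Real.exp_le_one_iff.2 h.le, zero_le_one]

lemma abs_accDeriv_le_one (q : ℝ) : |accDeriv q| ≤ 1 :=
  (abs_of_nonneg (accDeriv_nonneg q)).trans_le (accDeriv_le_one q)

lemma measurable_accDeriv : Measurable accDeriv :=
  Measurable.ite measurableSet_Iio Real.measurable_exp measurable_const

lemma hasDerivAt_acc {q : ℝ} (hq : q ≠ 0) : HasDerivAt acc (accDeriv q) q := by
  rcases hq.lt_or_gt with h | h
  · rw [accDeriv_of_neg h]
    exact (Real.hasDerivAt_exp q).congr_of_eventuallyEq <|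
      (eventually_lt_nhds h).mono fun p hp => acc_of_nonpos hp.le
  · rw [accDeriv_of_nonneg h.le]
    exact (hasDerivAt_const q 1).congr_of_eventuallyEq <|
      (eventually_gt_nhds h).mono fun p hp => acc_of_nonneg hp.le

lemma abs_accDeriv_sub_accDeriv_le_one (p q : ℝ) : |accDeriv p - accDeriv q| ≤ 1 :=
  abs_sub_le_of_nonneg_of_le (accDeriv_nonneg p) (accDeriv_le_one p) (accDeriv_nonneg q)
    (accDeriv_le_one q)

/-- If `p` and `q` lie on different sides of the kink, then `|q| ≤ |p - q|`, and so
`1 ≤ |p - q| / δ` or `|q| ≤ δ`. -/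
lemma abs_accDeriv_sub_accDeriv_le {δ : ℝ} (hδ : 0 < δ) (p q : ℝ) :
    |accDeriv p - accDeriv q| ≤
      |p - q| * (1 + 1 / δ) + (Set.Icc (-δ) δ).indicator (fun _ => (1 : ℝ)) q := by
  have hind : 0 ≤ (Set.Icc (-δ) δ).indicator (fun _ => (1 : ℝ)) q :=
    Set.indicator_nonneg (fun _ _ => zero_le_one) q
  have hmul : |p - q| * (1 + 1 / δ) = |p - q| + |p - q| / δ := by ring
  have hquot : 0 ≤ |p - q| / δ := by positivity
  have opposite (hq : |q| ≤ |p - q|) : |accDeriv p - accDeriv q| ≤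
      |p - q| * (1 + 1 / δ) + (Set.Icc (-δ) δ).indicator (fun _ => (1 : ℝ)) q := by
    refine (abs_accDeriv_sub_accDeriv_le_one p q).trans ?_
    by_cases hqδ : |q| ≤ δ
    · rw [Set.indicator_of_mem (Set.mem_Icc.2 (abs_le.1 hqδ))]
      linarith [abs_nonneg (p - q)]
    · have : 1 ≤ |p - q| / δ := (one_le_div hδ).2 ((not_le.1 hqδ).le.trans hq)
      linarith [abs_nonneg (p - q)]
  rcases lt_or_ge p 0 with hp | hp <;> rcases lt_or_ge q 0 with hq | hq
  · rw [accDeriv_of_neg hp, accDeriv_of_neg hq, ← acc_of_nonpos hp.le, ← acc_of_nonpos hq.le]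
    linarith [abs_acc_sub_acc_le p q]
  · exact opposite (by rw [abs_of_nonneg hq, abs_of_neg] <;> linarith)
  · exact opposite (by rw [abs_of_neg hq, abs_of_pos] <;> linarith)
  · rw [accDeriv_of_nonneg hp, accDeriv_of_nonneg hq, sub_zero, abs_zero]
    positivity

/-! ### Averages of the acceptance function under the limiting law -/

/-- The limiting law `N(-ℓ², 2ℓ²)` of the log acceptance ratio. -/
def limitLaw (ℓ : ℝ) : Measure ℝ := gaussianReal (-ℓ ^ 2) (2 * ℓ ^ 2).toNNReal

instance (ℓ : ℝ) : IsProbabilityMeasure (limitLaw ℓ) := by unfold limitLaw; infer_instance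

lemma two_mul_sq_toNNReal_ne_zero {ℓ : ℝ} (hℓ : 0 < ℓ) : (2 * ℓ ^ 2).toNNReal ≠ 0 :=
  (Real.toNNReal_pos.2 (by positivity)).ne'

lemma gaussianReal_real_apply {v : NNReal} (hv : v ≠ 0) (m : ℝ) (s : Set ℝ) :
    (gaussianReal m v).real s = ∫ z in s, gaussianPDFReal m v z := by
  rw [measureReal_def, gaussianReal_apply_eq_integral _ hv]
  exact ENNReal.toReal_ofReal (integral_nonneg fun _ => gaussianPDFReal_nonneg _ _ _)

lemma map_affine_stdGaussian (m c : ℝ) :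
    (gaussianReal 0 1).map (fun z => m + c * z) = gaussianReal m (c ^ 2).toNNReal := by
  have hcomp : (fun z : ℝ => m + c * z) = (fun z => m + z) ∘ (fun z => c * z) := rfl
  rw [hcomp, ← Measure.map_map (by fun_prop) (by fun_prop), gaussianReal_map_const_mul,
    gaussianReal_map_const_add]
  congr 1
  · ring
  · ext
    simp [Real.coe_toNNReal _ (sq_nonneg c)]

lemma gaussianReal_real_Iic_zero {ℓ : ℝ} (hℓ : 0 < ℓ) :
    (gaussianReal (ℓ ^ 2) (2 * ℓ ^ 2).toNNReal).real (Set.Iic 0) = beta ℓ / 2 := by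
  have hpos : (0 : ℝ) < √2 := by positivity
  have hsq : √2 * √2 = 2 := Real.mul_self_sqrt zero_le_two
  have hpre : (fun z => ℓ ^ 2 + √2 * ℓ * z) ⁻¹' Set.Iic 0 = Set.Iic (-ℓ / √2) := by
    ext z
    simp only [Set.mem_preimage, Set.mem_Iic, le_div_iff₀ hpos]
    constructor <;> intro h <;> nlinarith
  rw [show 2 * ℓ ^ 2 = (√2 * ℓ) ^ 2 by rw [mul_pow, sq √2, hsq], ← map_affine_stdGaussian,
    map_measureReal_apply (by fun_prop) measurableSet_Iic, hpre, beta, cdf_eq_real,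
    mul_div_cancel_left₀ _ two_ne_zero]

/-- Multiplying the density of `N(-ℓ², 2ℓ²)` by `exp` gives that of `N(ℓ², 2ℓ²)`. -/
lemma integral_accDeriv {ℓ : ℝ} (hℓ : 0 < ℓ) : ∫ z, accDeriv z ∂limitLaw ℓ = beta ℓ / 2 := by
  have hv := two_mul_sq_toNNReal_ne_zero hℓ
  rw [limitLaw, integral_gaussianReal_eq_integral_smul hv, ← gaussianReal_real_Iic_zero hℓ,
    gaussianReal_real_apply hv, integral_Iic_eq_integral_Iio,
    ← integral_indicator measurableSet_Iio]
  congr 1 with z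
  simp only [accDeriv, Set.indicator_apply, Set.mem_Iio, smul_eq_mul]
  split_ifs
  · simp only [gaussianPDFReal, mul_assoc, ← Real.exp_add]
    congr 2
    rw [Real.coe_toNNReal _ (by positivity)]
    field_simp
    ring
  · simp

lemma integrable_of_abs_le {α : Type*} [MeasurableSpace α] {μ : Measure α}
    [IsFiniteMeasure μ] {f : α → ℝ} {c : ℝ} (hf : AEMeasurable f μ) (h : ∀ a, |f a| ≤ c) :
    Integrable f μ :=
  Integrable.of_bound hf.aestronglyMeasurable c (ae_of_all _ h)

lemma limitLaw_real_Ici_zero {ℓ : ℝ} (hℓ : 0 < ℓ) :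
    (limitLaw ℓ).real (Set.Ici 0) = beta ℓ / 2 := by
  rw [← gaussianReal_real_Iic_zero hℓ, limitLaw, ← gaussianReal_map_neg,
    map_measureReal_apply (by fun_prop) measurableSet_Ici]
  congr 1 with z
  simp

lemma integral_acc {ℓ : ℝ} (hℓ : 0 < ℓ) : ∫ z, acc z ∂limitLaw ℓ = beta ℓ := by
  have hsplit : acc = fun z => accDeriv z + (Set.Ici (0 : ℝ)).indicator (fun _ => (1 : ℝ)) z := by
    ext z
    rcases lt_or_ge z 0 with h | h
    · simp [accDeriv_of_neg h, h.not_ge, acc_of_nonpos h.le]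
    · simp [accDeriv_of_nonneg h, h, acc_of_nonneg h]
  rw [hsplit, integral_add
    (integrable_of_abs_le measurable_accDeriv.aemeasurable abs_accDeriv_le_one)
    ((integrable_const 1).indicator measurableSet_Ici), integral_accDeriv hℓ,
    integral_indicator_const _ measurableSet_Ici, limitLaw_real_Ici_zero hℓ, smul_eq_mul, mul_one,
    add_halves]

lemma gaussianReal_real_Icc_le {v : NNReal} (hv : v ≠ 0) (m : ℝ) {a b : ℝ} (hab : a ≤ b) :
    (gaussianReal m v).real (Set.Icc a b) ≤ (b - a) / √(2 * Real.pi * v) := by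
  have hpdf (z : ℝ) : gaussianPDFReal m v z ≤ (√(2 * Real.pi * v))⁻¹ := by
    refine mul_le_of_le_one_right (by positivity) (Real.exp_le_one_iff.2 ?_)
    exact div_nonpos_of_nonpos_of_nonneg (neg_nonpos.2 (sq_nonneg _)) (by positivity)
  rw [gaussianReal_real_apply hv]
  calc ∫ z in Set.Icc a b, gaussianPDFReal m v z
      ≤ ∫ _ in Set.Icc a b, (√(2 * Real.pi * v))⁻¹ :=
        setIntegral_mono (integrable_gaussianPDFReal _ _).integrableOn
          (integrableOn_const (by simp)) hpdf
    _ = (b - a) / √(2 * Real.pi * v) := by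
        rw [setIntegral_const, Real.volume_real_Icc_of_le hab, smul_eq_mul, div_eq_mul_inv]

section Comparison

variable {Ω : Type*} [MeasurableSpace Ω] {μ : Measure Ω} [IsProbabilityMeasure μ] {U Z : Ω → ℝ}
  {ℓ : ℝ}

lemma abs_integral_acc_sub_beta_le (hℓ : 0 < ℓ) (hU : AEMeasurable U μ)
    (hZ : HasLaw Z (limitLaw ℓ) μ) (hUZ : Integrable (fun ω => U ω - Z ω) μ) :
    |∫ ω, acc (U ω) ∂μ - beta ℓ| ≤ ∫ ω, |U ω - Z ω| ∂μ := by
  have hint {W : Ω → ℝ} (hW : AEMeasurable W μ) : Integrable (fun ω => acc (W ω)) μ :=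
    integrable_of_abs_le (continuous_acc.measurable.comp_aemeasurable hW)
      fun _ => abs_acc_le_one _
  rw [← integral_acc hℓ, ← hZ.integral_comp continuous_acc.aestronglyMeasurable]
  simp only [Function.comp_apply]
  rw [← integral_sub (hint hU) (hint hZ.aemeasurable)]
  exact abs_integral_le_integral_abs.trans <|
    integral_mono ((hint hU).sub (hint hZ.aemeasurable)).abs hUZ.abs fun _ =>
      abs_acc_sub_acc_le _ _

lemma integral_indicator_Icc_limitLaw_le (hℓ : 0 < ℓ) {δ : ℝ} (hδ : 0 < δ) :
    ∫ z, (Set.Icc (-δ) δ).indicator (fun _ => (1 : ℝ)) z ∂limitLaw ℓ ≤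
      δ * (1 / (√Real.pi * ℓ)) := by
  rw [integral_indicator_const _ measurableSet_Icc, smul_eq_mul, mul_one]
  refine (gaussianReal_real_Icc_le (two_mul_sq_toNNReal_ne_zero hℓ) _ (by linarith)).trans_eq ?_
  rw [Real.coe_toNNReal _ (by positivity), show 2 * Real.pi * (2 * ℓ ^ 2) =
    Real.pi * (2 * ℓ) ^ 2 by ring, Real.sqrt_mul Real.pi_pos.le, Real.sqrt_sq (by positivity)]
  field_simp
  ring

lemma integrable_accDeriv_comp (hU : AEMeasurable U μ) :
    Integrable (fun ω => accDeriv (U ω)) μ :=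
  integrable_of_abs_le (measurable_accDeriv.comp_aemeasurable hU) fun _ => abs_accDeriv_le_one _

lemma abs_integral_accDeriv_sub_half_beta_le (hℓ : 0 < ℓ) (hU : AEMeasurable U μ)
    (hZ : HasLaw Z (limitLaw ℓ) μ) (hUZ : Integrable (fun ω => U ω - Z ω) μ) {δ : ℝ} (hδ : 0 < δ) :
    |∫ ω, accDeriv (U ω) ∂μ - beta ℓ / 2| ≤
      (∫ ω, |U ω - Z ω| ∂μ) * (1 + 1 / δ) + δ * (1 / (√Real.pi * ℓ)) := by
  have hind : Measurable ((Set.Icc (-δ) δ).indicator fun _ => (1 : ℝ)) :=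
    measurable_const.indicator measurableSet_Icc
  have hindZ : Integrable (fun ω => (Set.Icc (-δ) δ).indicator (fun _ => (1 : ℝ)) (Z ω)) μ :=
    integrable_of_abs_le (c := 1) (hind.comp_aemeasurable hZ.aemeasurable) fun _ => by
      rw [Set.indicator_apply]
      split_ifs <;> simp
  have hsub := (integrable_accDeriv_comp hU).sub (integrable_accDeriv_comp hZ.aemeasurable)
  rw [← integral_accDeriv hℓ, ← hZ.integral_comp measurable_accDeriv.aestronglyMeasurable]
  simp only [Function.comp_apply]
  rw [← integral_sub (integrable_accDeriv_comp hU) (integrable_accDeriv_comp hZ.aemeasurable)]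
  calc _ ≤ ∫ ω, |accDeriv (U ω) - accDeriv (Z ω)| ∂μ := abs_integral_le_integral_abs
    _ ≤ ∫ ω, (|U ω - Z ω| * (1 + 1 / δ) +
          (Set.Icc (-δ) δ).indicator (fun _ => (1 : ℝ)) (Z ω)) ∂μ :=
        integral_mono hsub.abs ((hUZ.abs.mul_const _).add hindZ) fun _ =>
          abs_accDeriv_sub_accDeriv_le hδ _ _
    _ ≤ _ := by
        rw [integral_add (hUZ.abs.mul_const _) hindZ, integral_mul_const]
        gcongr
        exact (hZ.integral_comp hind.aestronglyMeasurable).trans_le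
          (integral_indicator_Icc_limitLaw_le hℓ hδ)

lemma integral_accDeriv_comp_le_one (hU : AEMeasurable U μ) : ∫ ω, accDeriv (U ω) ∂μ ≤ 1 := by
  simpa using integral_mono (integrable_accDeriv_comp hU) (integrable_const 1)
    fun ω => accDeriv_le_one (U ω)

lemma abs_integral_accDeriv_sub_half_beta_le_one (hℓ : 0 < ℓ) (hU : AEMeasurable U μ) :
    |∫ ω, accDeriv (U ω) ∂μ - beta ℓ / 2| ≤ 1 := by
  rw [← integral_accDeriv hℓ]
  exact abs_sub_le_of_nonneg_of_le (integral_nonneg fun _ => accDeriv_nonneg _)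
    (integral_accDeriv_comp_le_one hU) (integral_nonneg accDeriv_nonneg)
    (integral_accDeriv_comp_le_one (U := fun z => z) aemeasurable_id')

lemma sq_integral_accDeriv_sub_half_beta_le (hℓ : 0 < ℓ) (hU : AEMeasurable U μ)
    (hZ : HasLaw Z (limitLaw ℓ) μ) (hUZ : Integrable (fun ω => U ω - Z ω) μ) {M : ℝ} (hM : 0 < M)
    (hle : ∫ ω, |U ω - Z ω| ∂μ ≤ M) :
    (∫ ω, accDeriv (U ω) ∂μ - beta ℓ / 2) ^ 2 ≤ (2 + 1 / (√Real.pi * ℓ)) ^ 2 * M := by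
  have hsq : √M ^ 2 = M := Real.sq_sqrt hM.le
  have hpos : 0 < √M := Real.sqrt_pos.2 hM
  have hc : 0 ≤ 1 / (√Real.pi * ℓ) := by positivity
  suffices h : |∫ ω, accDeriv (U ω) ∂μ - beta ℓ / 2| ≤ (2 + 1 / (√Real.pi * ℓ)) * √M by
    calc _ ≤ ((2 + 1 / (√Real.pi * ℓ)) * √M) ^ 2 := sq_le_sq' (neg_le_of_abs_le h) (le_of_abs_le h)
      _ = _ := by rw [mul_pow, hsq]
  rcases le_total 1 (√M) with h1 | h1
  · refine (abs_integral_accDeriv_sub_half_beta_le_one hℓ hU).trans ?_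
    nlinarith
  · refine (abs_integral_accDeriv_sub_half_beta_le hℓ hU hZ hUZ hpos).trans ?_
    calc _ ≤ M * (1 + 1 / √M) + √M * (1 / (√Real.pi * ℓ)) := by gcongr
      _ = √M ^ 2 + √M + √M * (1 / (√Real.pi * ℓ)) := by
          rw [hsq, mul_add, mul_one, mul_one_div, Real.div_sqrt]
      _ ≤ _ := by nlinarith

end Comparison

/-! ### Standard Gaussian vectors -/

section GaussianVectors

/-- The standard Gaussian measure on `ι → ℝ`. -/
abbrev stdPi (ι : Type*) [Fintype ι] : Measure (ι → ℝ) := Measure.pi fun _ => gaussianReal 0 1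

/-- The fourth moment of the standard normal distribution. -/
def gaussM4 : ℝ := ∫ z, z ^ 4 ∂gaussianReal 0 1

lemma gaussM4_nonneg : 0 ≤ gaussM4 := integral_nonneg fun _ => by positivity

lemma integrable_pow_stdGaussian (p : ℕ) : Integrable (fun z : ℝ => z ^ p) (gaussianReal 0 1) := by
  rcases eq_or_ne p 0 with rfl | hp
  · simp
  have h := (memLp_id_gaussianReal (μ := 0) (v := 1) (p : NNReal)).integrable_norm_rpow
    (by simpa using hp) (by simp)
  rw [← integrable_norm_iff (by fun_prop)]
  simpa using h

lemma integral_sq_stdGaussian : ∫ z, z ^ 2 ∂gaussianReal 0 1 = 1 := by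
  have h := variance_fun_id_gaussianReal (μ := 0) (v := 1)
  rwa [variance_of_integral_eq_zero (by fun_prop) (by simp)] at h

lemma memLp_sq_stdGaussian : MemLp (fun z : ℝ => z ^ 2) 2 (gaussianReal 0 1) := by
  rw [memLp_two_iff_integrable_sq (by fun_prop)]
  simpa [← pow_mul] using integrable_pow_stdGaussian 4

/-- The weighted square norm `∑ a_j u_j ^ 2`. -/
def wsq {ι : Type*} [Fintype ι] (a u : ι → ℝ) : ℝ := ∑ j, a j * u j ^ 2

/-- The normalised fluctuation `|u|² / N - 1` of the squared Euclidean norm in dimension `N`. -/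
def fluct {ι : Type*} [Fintype ι] (u : ι → ℝ) : ℝ := (∑ j, u j ^ 2) / Fintype.card ι - 1

variable {ι : Type*} [Fintype ι]

lemma memLp_eval_stdPi (i : ι) : MemLp (fun ξ : ι → ℝ => ξ i) 2 (stdPi ι) :=
  (memLp_id_gaussianReal 2).comp_measurePreserving (measurePreserving_eval _ i)

lemma integrable_eval_pow (i : ι) (p : ℕ) : Integrable (fun ξ => ξ i ^ p) (stdPi ι) :=
  integrable_comp_eval (μ := fun _ : ι => gaussianReal 0 1) (f := fun z : ℝ => z ^ p)
    (integrable_pow_stdGaussian p)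

lemma integral_eval_pow (i : ι) (p : ℕ) :
    ∫ ξ, ξ i ^ p ∂stdPi ι = ∫ z, z ^ p ∂gaussianReal 0 1 :=
  integral_comp_eval (μ := fun _ : ι => gaussianReal 0 1) (f := fun z : ℝ => z ^ p)
    (by fun_prop)

lemma integral_eval_sq (i : ι) : ∫ ξ, ξ i ^ 2 ∂stdPi ι = 1 := by
  rw [integral_eval_pow, integral_sq_stdGaussian]

/-! ### Weighted square norms -/

variable {a : ι → ℝ}

lemma wsq_nonneg (ha : ∀ j, 0 ≤ a j) (u : ι → ℝ) : 0 ≤ wsq a u :=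
  Finset.sum_nonneg fun j _ => mul_nonneg (ha j) (sq_nonneg _)

lemma continuous_wsq (a : ι → ℝ) : Continuous (wsq a) := by unfold wsq; fun_prop

lemma wsq_smul (a : ι → ℝ) (c : ℝ) (u : ι → ℝ) : wsq a (c • u) = c ^ 2 * wsq a u := by
  simp only [wsq, Pi.smul_apply, smul_eq_mul, Finset.mul_sum]
  exact Finset.sum_congr rfl fun j _ => by ring

lemma wsq_add_le (ha : ∀ j, 0 ≤ a j) (u v : ι → ℝ) :
    wsq a (u + v) ≤ 2 * (wsq a u + wsq a v) := by
  simp only [wsq, ← Finset.sum_add_distrib, Finset.mul_sum, Pi.add_apply, ← mul_add,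
    mul_left_comm (2 : ℝ)]
  exact Finset.sum_le_sum fun j _ => mul_le_mul_of_nonneg_left add_sq_le (ha j)

lemma wsq_single [DecidableEq ι] (a : ι → ℝ) (i : ι) : wsq a (Pi.single i 1) = a i := by
  rw [wsq, Finset.sum_eq_single i (fun j _ hj => by simp [hj]) (by simp)]
  simp

lemma wsq_sq_le (ha : ∀ j, 0 ≤ a j) (u : ι → ℝ) :
    wsq a u ^ 2 ≤ (∑ j, a j) * ∑ j, a j * u j ^ 4 :=
  Finset.sum_sq_le_sum_mul_sum_of_sq_le_mul _ (fun j _ => ha j)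
    (fun j _ => mul_nonneg (ha j) (by positivity)) fun j _ => by ring_nf; rfl

lemma integrable_wsq (a : ι → ℝ) : Integrable (wsq a) (stdPi ι) :=
  integrable_finsetSum _ fun j _ => (integrable_eval_pow j 2).const_mul (a j)

lemma integral_wsq (a : ι → ℝ) : ∫ ξ, wsq a ξ ∂stdPi ι = ∑ j, a j := by
  unfold wsq
  rw [integral_finsetSum _ fun j _ => (integrable_eval_pow j 2).const_mul (a j)]
  exact Finset.sum_congr rfl fun j _ => by rw [integral_const_mul, integral_eval_sq, mul_one]

lemma integrable_sum_mul_eval_pow_four (a : ι → ℝ) :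
    Integrable (fun ξ => ∑ j, a j * ξ j ^ 4) (stdPi ι) :=
  integrable_finsetSum _ fun j _ => (integrable_eval_pow j 4).const_mul (a j)

lemma integrable_wsq_sq (ha : ∀ j, 0 ≤ a j) : Integrable (fun ξ => wsq a ξ ^ 2) (stdPi ι) := by
  refine ((integrable_sum_mul_eval_pow_four a).const_mul (∑ j, a j)).mono'
    ((continuous_wsq a).pow 2).aestronglyMeasurable (ae_of_all _ fun ξ => ?_)
  rw [Real.norm_of_nonneg (sq_nonneg _)]
  exact wsq_sq_le ha ξ

lemma integral_wsq_sq_le (ha : ∀ j, 0 ≤ a j) :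
    ∫ ξ, wsq a ξ ^ 2 ∂stdPi ι ≤ gaussM4 * (∑ j, a j) ^ 2 := by
  calc _ ≤ ∫ ξ, (∑ j, a j) * ∑ j, a j * ξ j ^ 4 ∂stdPi ι :=
        integral_mono (integrable_wsq_sq ha)
          ((integrable_sum_mul_eval_pow_four a).const_mul _) (wsq_sq_le ha)
    _ = gaussM4 * (∑ j, a j) ^ 2 := by
      rw [integral_const_mul, integral_finsetSum _ fun j _ =>
        (integrable_eval_pow j 4).const_mul (a j)]
      simp_rw [integral_const_mul, integral_eval_pow, ← Finset.sum_mul]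
      rw [gaussM4]
      ring

/-! ### Fluctuation of the squared norm -/

lemma memLp_sum_sq : MemLp (fun ξ : ι → ℝ => ∑ j, ξ j ^ 2) 2 (stdPi ι) :=
  memLp_finsetSum _ fun j _ =>
    memLp_sq_stdGaussian.comp_measurePreserving (measurePreserving_eval _ j)

lemma memLp_fluct : MemLp (fluct : (ι → ℝ) → ℝ) 2 (stdPi ι) :=
  (memLp_sum_sq.mul_const (Fintype.card ι : ℝ)⁻¹).sub (memLp_const 1)

lemma variance_sum_sq_le :
    Var[fun ξ : ι → ℝ => ∑ j, ξ j ^ 2; stdPi ι] ≤ Fintype.card ι * gaussM4 := by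
  have hvar : Var[fun z : ℝ => z ^ 2; gaussianReal 0 1] ≤ gaussM4 :=
    (variance_le_expectation_sq (by fun_prop)).trans_eq (by simp [gaussM4, ← pow_mul])
  have hsum := variance_sum_pi (μ := fun _ : ι => gaussianReal 0 1) (X := fun _ z => z ^ 2)
    fun _ => memLp_sq_stdGaussian
  rw [show (fun ξ : ι → ℝ => ∑ j, ξ j ^ 2) = ∑ j, fun ξ : ι → ℝ => ξ j ^ 2 by ext; simp, hsum]
  exact (Finset.sum_le_sum fun _ _ => hvar).trans_eq (by simp)

lemma integral_fluct_sq_le [Nonempty ι] :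
    ∫ ξ : ι → ℝ, fluct ξ ^ 2 ∂stdPi ι ≤ gaussM4 / Fintype.card ι := by
  have hmean : ∫ ξ : ι → ℝ, ∑ j, ξ j ^ 2 ∂stdPi ι = Fintype.card ι := by
    rw [integral_finsetSum _ fun j _ => integrable_eval_pow j 2]
    simp [integral_eval_sq]
  have hfluct (ξ : ι → ℝ) : fluct ξ ^ 2 =
      (Fintype.card ι : ℝ)⁻¹ ^ 2 * (∑ j, ξ j ^ 2 - Fintype.card ι) ^ 2 := by
    unfold fluct
    field_simp
  have hvar := variance_sum_sq_le (ι := ι)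
  rw [variance_eq_integral memLp_sum_sq.aemeasurable, hmean] at hvar
  simp_rw [hfluct]
  rw [integral_const_mul]
  calc _ ≤ (Fintype.card ι : ℝ)⁻¹ ^ 2 * (Fintype.card ι * gaussM4) := by gcongr
    _ = gaussM4 / Fintype.card ι := by field_simp

/-! ### Linear functionals of a standard Gaussian vector -/

lemma hasLaw_sum_mul_stdPi (e : ι → ℝ) :
    HasLaw (fun ξ : ι → ℝ => ∑ j, e j * ξ j) (gaussianReal 0 (∑ j, e j ^ 2).toNNReal)
      (stdPi ι) := by
  have hgauss : HasGaussianLaw (fun ξ : ι → ℝ => ∑ j, e j * ξ j) (stdPi ι) := by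
    have hproj : HasGaussianLaw (fun ξ : ι → ℝ => fun i => ξ i) (stdPi ι) :=
      iIndepFun.hasGaussianLaw (fun i => (measurePreserving_eval
        (fun _ : ι => gaussianReal 0 1) i).hasLaw.hasGaussianLaw)
        (iIndepFun_pi (X := fun _ z => z) fun _ => aemeasurable_id)
    have h := hproj.map_fun (∑ j, e j • ContinuousLinearMap.proj j : (ι → ℝ) →L[ℝ] ℝ)
    simpa only [sum_apply, smul_apply,
      ContinuousLinearMap.proj_apply, smul_eq_mul] using h
  have hmean : ∫ ξ : ι → ℝ, ∑ j, e j * ξ j ∂stdPi ι = 0 := by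
    have hone (j : ι) : ∫ ξ : ι → ℝ, ξ j ∂stdPi ι = 0 := by simpa using integral_eval_pow j 1
    rw [integral_finsetSum _ fun j _ => ((memLp_eval_stdPi j).integrable one_le_two).const_mul _]
    simp [integral_const_mul, hone]
  have hvar : Var[fun ξ : ι → ℝ => ∑ j, e j * ξ j; stdPi ι] = ∑ j, e j ^ 2 := by
    have h := variance_sum_pi (μ := fun _ : ι => gaussianReal 0 1) (X := fun j z => e j * z)
      fun j => (memLp_id_gaussianReal 2).const_mul (e j)
    rw [show (fun ξ : ι → ℝ => ∑ j, e j * ξ j) = ∑ j, fun ξ : ι → ℝ => e j * ξ j by ext; simp, h]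
    exact Finset.sum_congr rfl fun j _ => by rw [variance_const_mul]; simp
  exact ⟨hgauss.aemeasurable, by rw [hgauss.map_eq_gaussianReal, hmean, hvar]⟩

lemma integral_sum_mul_sq (e : ι → ℝ) :
    ∫ ξ : ι → ℝ, (∑ j, e j * ξ j) ^ 2 ∂stdPi ι = ∑ j, e j ^ 2 := by
  have hlaw := hasLaw_sum_mul_stdPi e
  have hmean : ∫ ξ : ι → ℝ, ∑ j, e j * ξ j ∂stdPi ι = 0 := by simp [hlaw.integral_eq]
  rw [← variance_of_integral_eq_zero hlaw.aemeasurable hmean, hlaw.variance_eq,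
    variance_id_gaussianReal, Real.coe_toNNReal _ (Finset.sum_nonneg fun j _ => sq_nonneg _)]

lemma hasLaw_limitLaw {e : ι → ℝ} (he : ∑ j, e j ^ 2 = 1) (ℓ : ℝ) :
    HasLaw (fun ξ : ι → ℝ => -ℓ ^ 2 - √2 * ℓ * ∑ j, e j * ξ j) (limitLaw ℓ) (stdPi ι) := by
  have hlin := hasLaw_sum_mul_stdPi e
  rw [he, Real.toNNReal_one] at hlin
  have haff : HasLaw (fun z : ℝ => -ℓ ^ 2 + -(√2 * ℓ) * z) (limitLaw ℓ) (gaussianReal 0 1) :=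
    ⟨by fun_prop, by
      rw [map_affine_stdGaussian, neg_sq, mul_pow, Real.sq_sqrt zero_le_two, limitLaw]⟩
  exact (haff.comp hlin).congr (ae_of_all _ fun ξ => by simp; ring)

end GaussianVectors

/-! ### Gaussian integration by parts -/

lemma integral_eq_zero_of_hasDerivAt_off_countable {F F' : ℝ → ℝ} {S : Set ℝ} (hS : S.Countable)
    (hcont : Continuous F) (hderiv : ∀ z ∉ S, HasDerivAt F (F' z) z) (hF : Integrable F)
    (hF' : Integrable F') : ∫ z, F' z = 0 := by
  have hint (t : ℝ) : ∫ z in (-t)..t, F' z = F t - F (-t) :=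
    integral_eq_of_hasDerivAt_off_countable F F' hS hcont.continuousOn
      (fun z hz => hderiv z hz.2) hF'.intervalIntegrable
  have hlim : Tendsto (fun t => F t - F (-t)) atTop (𝓝 (∫ z, F' z)) := by
    simpa only [hint, id] using
      intervalIntegral_tendsto_integral hF' tendsto_neg_atTop_atBot tendsto_id
  have hat : IntegrableAtFilter (fun t => F t - F (-t)) atTop :=
    (hF.sub hF.comp_neg).integrableAtFilter _
  refine hat.eq_zero_of_tendsto (fun s hs => ?_) hlim
  obtain ⟨a, ha⟩ := mem_atTop_sets.1 hs
  exact top_unique (Real.volume_Ici.symm.le.trans (measure_mono fun b hb => ha b hb))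

lemma integral_mul_id_stdGaussian {f f' : ℝ → ℝ} {S : Set ℝ} (hS : S.Countable)
    (hcont : Continuous f) (hderiv : ∀ z ∉ S, HasDerivAt f (f' z) z)
    (hf : Integrable f (gaussianReal 0 1)) (hzf : Integrable (fun z => z * f z) (gaussianReal 0 1))
    (hf' : Integrable f' (gaussianReal 0 1)) :
    ∫ z, z * f z ∂gaussianReal 0 1 = ∫ z, f' z ∂gaussianReal 0 1 := by
  have hpdf (z : ℝ) : HasDerivAt (gaussianPDFReal 0 1) (-z * gaussianPDFReal 0 1 z) z := by
    have hexp : HasDerivAt (fun y : ℝ => -y ^ 2 / 2) (-z) z :=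
      ((hasDerivAt_pow 2 z).neg.div_const 2).congr_deriv (by ring)
    have hconst := hexp.exp.const_mul (√(2 * Real.pi))⁻¹
    simp only [gaussianPDFReal_def, NNReal.coe_one, mul_one, sub_zero]
    exact hconst.congr_deriv (by ring)
  have hvol (g : ℝ → ℝ) : Integrable g (gaussianReal 0 1) ↔
      Integrable fun z => gaussianPDFReal 0 1 z * g z := by
    rw [gaussianReal_of_var_ne_zero _ one_ne_zero, integrable_withDensity_iff_integrable_smul'
      (measurable_gaussianPDF _ _) (ae_of_all _ fun _ => gaussianPDF_lt_top)]
    simp [gaussianPDF, gaussianPDFReal_nonneg]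
  have hzero := integral_eq_zero_of_hasDerivAt_off_countable hS
    (F := fun z => gaussianPDFReal 0 1 z * f z)
    (F' := fun z => gaussianPDFReal 0 1 z * (f' z - z * f z))
    ((continuous_iff_continuousAt.2 fun z => (hpdf z).continuousAt).mul hcont)
    (fun z hz => ((hpdf z).mul (hderiv z hz)).congr_deriv (by ring))
    ((hvol _).1 hf) ((hvol _).1 (hf'.sub hzf))
  simp only [← smul_eq_mul (gaussianPDFReal 0 1 _),
    ← integral_gaussianReal_eq_integral_smul one_ne_zero] at hzero
  rw [integral_sub hf' hzf] at hzero
  exact (sub_eq_zero.1 hzero).symm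

lemma measurePreserving_update {ι : Type*} [Fintype ι] [DecidableEq ι] {α : ι → Type*}
    [∀ i, MeasurableSpace (α i)] (μ : ∀ i, Measure (α i)) [∀ i, IsProbabilityMeasure (μ i)]
    (i : ι) : MeasurePreserving (fun p : (∀ j, α j) × α i => Function.update p.1 i p.2)
      ((Measure.pi μ).prod (μ i)) (Measure.pi μ) := by
  have hmeas : Measurable fun p : (∀ j, α j) × α i => Function.update p.1 i p.2 :=
    measurable_update'
  refine ⟨hmeas, (Measure.pi_eq fun t ht => ?_).symm⟩
  have hpre : (fun p : (∀ j, α j) × α i => Function.update p.1 i p.2) ⁻¹' Set.univ.pi t =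
      Set.univ.pi (Function.update t i Set.univ) ×ˢ t i := by
    ext ⟨u, z⟩
    simp only [Set.mem_preimage, Set.mem_pi, Set.mem_univ, true_imp_iff, Set.mem_prod]
    rw [Function.forall_update_iff u (fun j v => v ∈ t j),
      Function.forall_update_iff t (fun j s => u j ∈ s), and_comm]
    simp
  rw [Measure.map_apply hmeas (MeasurableSet.univ_pi ht), hpre, Measure.prod_prod, Measure.pi_pi,
    ← Finset.prod_erase_mul _ _ (Finset.mem_univ i),
    ← Finset.prod_erase_mul _ (fun j => μ j (t j)) (Finset.mem_univ i)]
  simp only [Function.update_self, measure_univ, mul_one]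
  congr 1
  exact Finset.prod_congr rfl fun j hj => by rw [Function.update_of_ne (Finset.ne_of_mem_erase hj)]

lemma countable_setOf_eq_zero_of_deriv_ne_zero {q q' : ℝ → ℝ} (hq : ∀ z, HasDerivAt q (q' z) z) :
    {z | q z = 0 ∧ q' z ≠ 0}.Countable := by
  have hdisc : DiscreteTopology {z | q z = 0 ∧ q' z ≠ 0} := by
    refine discreteTopology_subtype_iff.2 fun z hz => inf_principal_eq_bot.2 ?_
    filter_upwards [(hq z).eventually_ne (c := q z) hz.2] with w hw hw0
    exact hw (hw0.1.trans hz.1.symm)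
  exact TopologicalSpace.separableSpace_iff_countable.1 inferInstance

lemma hasDerivAt_acc_comp {q : ℝ → ℝ} {q' z : ℝ} (hq : HasDerivAt q q' z)
    (hz : q z = 0 → q' = 0) : HasDerivAt (fun z => acc (q z)) (accDeriv (q z) * q') z := by
  by_cases h0 : q z = 0
  · rw [hz h0] at hq ⊢
    rw [hasDerivAt_iff_isLittleO] at hq ⊢
    refine Asymptotics.IsBigO.trans_isLittleO (Asymptotics.isBigO_of_le _ fun w => ?_) hq
    simpa using abs_acc_sub_acc_le (q w) (q z)
  · exact (hasDerivAt_acc h0).comp z hq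

section IntegrationByParts

variable {ι : Type*} [Fintype ι] [DecidableEq ι]

lemma integral_stdPi_eq_integral_update {F : (ι → ℝ) → ℝ} (hF : Integrable F (stdPi ι)) (i : ι) :
    ∫ ξ, F ξ ∂stdPi ι =
      ∫ ξ, ∫ z, F (Function.update ξ i z) ∂gaussianReal 0 1 ∂stdPi ι := by
  have hmp : MeasurePreserving (fun p : (ι → ℝ) × ℝ => Function.update p.1 i p.2)
      ((stdPi ι).prod (gaussianReal 0 1)) (stdPi ι) := measurePreserving_update _ i
  rw [← hmp.map_eq] at hF
  conv_lhs => rw [← hmp.map_eq, integral_map hmp.aemeasurable hF.aestronglyMeasurable]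
  exact integral_prod _ (hF.comp_aemeasurable hmp.aemeasurable)

lemma ae_integrable_update {F : (ι → ℝ) → ℝ} (hF : Integrable F (stdPi ι)) (i : ι) :
    ∀ᵐ ξ ∂stdPi ι, Integrable (fun z => F (Function.update ξ i z)) (gaussianReal 0 1) :=
  ((measurePreserving_update (fun _ : ι => gaussianReal 0 1) i).integrable_comp_of_integrable
    hF).prod_right_ae

lemma integral_mul_eval_stdPi {F F' : (ι → ℝ) → ℝ} {i : ι} (hcont : Continuous F)
    (hderiv : ∀ ξ, ∃ S : Set ℝ, S.Countable ∧ ∀ z ∉ S,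
      HasDerivAt (fun z => F (Function.update ξ i z)) (F' (Function.update ξ i z)) z)
    (hF : Integrable F (stdPi ι)) (hzF : Integrable (fun ξ => ξ i * F ξ) (stdPi ι))
    (hF' : Integrable F' (stdPi ι)) :
    ∫ ξ, ξ i * F ξ ∂stdPi ι = ∫ ξ, F' ξ ∂stdPi ι := by
  rw [integral_stdPi_eq_integral_update hzF i, integral_stdPi_eq_integral_update hF' i]
  refine integral_congr_ae ?_
  filter_upwards [ae_integrable_update hF i, ae_integrable_update hzF i,
    ae_integrable_update hF' i] with ξ hξ hzξ hξ'
  obtain ⟨S, hS, hderivS⟩ := hderiv ξ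
  simp only [Function.update_self] at hzξ ⊢
  exact integral_mul_id_stdGaussian hS (hcont.comp (by fun_prop)) hderivS hξ hzξ hξ'

lemma integral_eval_mul_acc_mul {U g : (ι → ℝ) → ℝ} {i : ι} (hU : Differentiable ℝ U)
    (hg : Differentiable ℝ g) (hg2 : MemLp g 2 (stdPi ι))
    (hU2 : MemLp (fun ξ => fderiv ℝ U ξ (Pi.single i 1)) 2 (stdPi ι))
    (hg1 : Integrable (fun ξ => fderiv ℝ g ξ (Pi.single i 1)) (stdPi ι)) :
    ∫ ξ, ξ i * (acc (U ξ) * g ξ) ∂stdPi ι =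
      ∫ ξ, (accDeriv (U ξ) * fderiv ℝ U ξ (Pi.single i 1) * g ξ +
        acc (U ξ) * fderiv ℝ g ξ (Pi.single i 1)) ∂stdPi ι := by
  have hacc : Continuous fun ξ => acc (U ξ) := continuous_acc.comp hU.continuous
  have hbdd {f h : (ι → ℝ) → ℝ} (hf : Measurable f) (hf1 : ∀ ξ, |f ξ| ≤ 1)
      (hh : Integrable h (stdPi ι)) : Integrable (fun ξ => f ξ * h ξ) (stdPi ι) :=
    hh.bdd_mul hf.aestronglyMeasurable (ae_of_all _ hf1)
  refine integral_mul_eval_stdPi (hacc.mul hg.continuous) (fun ξ => ?_)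
    (hbdd hacc.measurable (fun _ => abs_acc_le_one _) (hg2.integrable one_le_two))
    ?_ ((?_ : Integrable _ _).add (hbdd hacc.measurable (fun _ => abs_acc_le_one _) hg1))
  · have hslice {f : (ι → ℝ) → ℝ} (hf : Differentiable ℝ f) (z : ℝ) :
        HasDerivAt (fun z => f (Function.update ξ i z))
          (fderiv ℝ f (Function.update ξ i z) (Pi.single i 1)) z :=
      (hf _).hasFDerivAt.comp_hasDerivAt z (hasDerivAt_update ξ i z)
    refine ⟨_, countable_setOf_eq_zero_of_deriv_ne_zero (hslice hU), fun z hz => ?_⟩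
    exact (hasDerivAt_acc_comp (hslice hU z) (by simpa using hz)).mul (hslice hg z)
  · exact (hbdd hacc.measurable (fun _ => abs_acc_le_one _)
      ((memLp_eval_stdPi i).integrable_mul hg2)).congr (ae_of_all _ fun ξ => mul_left_comm _ _ _)
  · exact (hbdd (measurable_accDeriv.comp hU.continuous.measurable)
      (fun _ => abs_accDeriv_le_one _) (hU2.integrable_mul hg2)).congr
      (ae_of_all _ fun ξ => (mul_assoc _ _ _).symm)

end IntegrationByParts

/-! ### The Metropolis step in normalised coordinates -/

section MetropolisStep

/-- A potential `V` whose derivative grows linearly and is Lipschitz in the dual of the norm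
`wsq a`, uniformly in the dimension. All bounds are squared, so that no square root appears. -/
structure PotentialControl {ι : Type*} [Fintype ι] (a : ι → ℝ) (V : (ι → ℝ) → ℝ) (B S : ℝ) :
    Prop where
  weight_nonneg : ∀ j, 0 ≤ a j
  sum_le : ∑ j, a j ≤ S
  const_nonneg : 0 ≤ B
  differentiable : Differentiable ℝ V
  fderiv_sq_le : ∀ X u, fderiv ℝ V X u ^ 2 ≤ B * (1 + wsq a X) * wsq a u
  fderiv_sub_sq_le : ∀ X Y u,
    (fderiv ℝ V X u - fderiv ℝ V Y u) ^ 2 ≤ B * wsq a (X - Y) * wsq a u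

/-- The negative logarithm of the density of the target with respect to Lebesgue measure, up to a
constant: the target has density `exp (-V)` with respect to the standard Gaussian measure. -/
def energy {ι : Type*} [Fintype ι] (V : (ι → ℝ) → ℝ) (X : ι → ℝ) : ℝ := (∑ j, X j ^ 2) / 2 + V X

/-- The step size `√(2 ℓ² / N)` of the proposal in dimension `N`. -/
def stepSize (ℓ : ℝ) (N : ℕ) : ℝ := √(2 * ℓ ^ 2 / N)

/-- The logarithm of the acceptance ratio of a move from `X` in the direction `ξ`. -/
def moveRatio {ι : Type*} [Fintype ι] (V : (ι → ℝ) → ℝ) (ℓ : ℝ) (X ξ : ι → ℝ) : ℝ :=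
  energy V X - energy V (X + stepSize ℓ (Fintype.card ι) • ξ)

lemma stepSize_nonneg (ℓ : ℝ) (N : ℕ) : 0 ≤ stepSize ℓ N := Real.sqrt_nonneg _

lemma stepSize_sq (ℓ : ℝ) (N : ℕ) : stepSize ℓ N ^ 2 = 2 * ℓ ^ 2 / N := Real.sq_sqrt (by positivity)

lemma stepSize_eq {ℓ : ℝ} (hℓ : 0 ≤ ℓ) (N : ℕ) : stepSize ℓ N = √2 * ℓ / √N := by
  rw [stepSize, Real.sqrt_div' _ N.cast_nonneg, Real.sqrt_mul zero_le_two, Real.sqrt_sq hℓ]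

variable {ι : Type*} [Fintype ι] {a : ι → ℝ} {V : (ι → ℝ) → ℝ} {B S : ℝ}

/-- The partial derivatives of `energy V`. -/
def score [DecidableEq ι] (V : (ι → ℝ) → ℝ) (X : ι → ℝ) (i : ι) : ℝ :=
  X i + fderiv ℝ V X (Pi.single i 1)

lemma hasFDerivAt_energy (hV : Differentiable ℝ V) (X : ι → ℝ) :
    HasFDerivAt (energy V) (∑ j, X j • ContinuousLinearMap.proj j + fderiv ℝ V X) X := by
  have hproj (j : ι) : HasFDerivAt (fun X : ι → ℝ => X j ^ 2 / 2)
      (X j • ContinuousLinearMap.proj (R := ℝ) j) X := by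
    refine (((hasFDerivAt_apply j X).pow 2).mul_const 2⁻¹).congr_fderiv ?_
    ext u
    simp [mul_assoc]
  have hsum := (HasFDerivAt.fun_sum fun j (_ : j ∈ Finset.univ) => hproj j).add
    (hV X).hasFDerivAt
  exact hsum.congr_of_eventuallyEq (Eventually.of_forall fun Y => by
    simp [energy, Finset.sum_div])

lemma differentiable_energy (hV : Differentiable ℝ V) : Differentiable ℝ (energy V) :=
  fun X => (hasFDerivAt_energy hV X).differentiableAt

lemma hasFDerivAt_moveRatio (hV : Differentiable ℝ V) (ℓ : ℝ) (X ξ : ι → ℝ) :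
    HasFDerivAt (moveRatio V ℓ X) (-stepSize ℓ (Fintype.card ι) •
      fderiv ℝ (energy V) (X + stepSize ℓ (Fintype.card ι) • ξ)) ξ := by
  have hmove : HasFDerivAt (fun ξ : ι → ℝ => X + stepSize ℓ (Fintype.card ι) • ξ)
      (stepSize ℓ (Fintype.card ι) • ContinuousLinearMap.id ℝ (ι → ℝ)) ξ :=
    ((hasFDerivAt_id ξ).fun_const_smul _).const_add X
  refine (((differentiable_energy hV _).hasFDerivAt.comp ξ hmove).const_sub _).congr_fderiv ?_
  ext u
  simp

lemma differentiable_moveRatio (hV : Differentiable ℝ V) (ℓ : ℝ) (X : ι → ℝ) :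
    Differentiable ℝ (moveRatio V ℓ X) :=
  fun ξ => (hasFDerivAt_moveRatio hV ℓ X ξ).differentiableAt

lemma fderiv_moveRatio_single [DecidableEq ι] (hV : Differentiable ℝ V) (ℓ : ℝ) (X ξ : ι → ℝ)
    (i : ι) : fderiv ℝ (moveRatio V ℓ X) ξ (Pi.single i 1) = -stepSize ℓ (Fintype.card ι) *
      score V (X + stepSize ℓ (Fintype.card ι) • ξ) i := by
  rw [(hasFDerivAt_moveRatio hV ℓ X ξ).fderiv, smul_apply, smul_eq_mul,
    (hasFDerivAt_energy hV _).fderiv]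
  simp [score, Pi.single_apply]

lemma measurable_score {ι : Type*} [Finite ι] [DecidableEq ι] (V : (ι → ℝ) → ℝ) (i : ι) :
    Measurable fun X => score V X i := by
  have := Fintype.ofFinite ι
  exact (measurable_pi_apply i).add (measurable_fderiv_apply_const ℝ V _)

namespace PotentialControl

variable (h : PotentialControl a V B S)
include h

lemma sum_nonneg : 0 ≤ S := (Finset.sum_nonneg fun j _ => h.weight_nonneg j).trans h.sum_le

lemma sub_sq_le (X u : ι → ℝ) :
    (V (X + u) - V X) ^ 2 ≤ B * (1 + 2 * (wsq a X + wsq a u)) * wsq a u := by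
  obtain ⟨z, hz, hmvt⟩ := domain_mvt (f := V) (s := Set.univ)
    (fun x _ => (h.differentiable x).hasFDerivAt.hasFDerivWithinAt) convex_univ
    (Set.mem_univ X) (Set.mem_univ (X + u))
  rw [segment_eq_image'] at hz
  obtain ⟨t, ⟨ht0, ht1⟩, rfl⟩ := hz
  simp only [add_sub_cancel_left] at hmvt
  have hu := wsq_nonneg h.weight_nonneg u
  have hB := h.const_nonneg
  have hseg : wsq a (X + t • u) ≤ 2 * (wsq a X + wsq a u) := by
    refine (wsq_add_le h.weight_nonneg X (t • u)).trans ?_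
    rw [wsq_smul]
    gcongr
    exact mul_le_of_le_one_left hu (pow_le_one₀ ht0 ht1)
  rw [hmvt]
  calc _ ≤ B * (1 + wsq a (X + t • u)) * wsq a u := h.fderiv_sq_le _ _
    _ ≤ _ := by gcongr

lemma sum_mul_sq_le {c : ℝ} (hc : 0 ≤ c) {f : ι → ℝ} (hf : ∀ i, f i ^ 2 ≤ c * a i) :
    wsq a f ≤ c * S ^ 2 := by
  have ha := h.weight_nonneg
  calc wsq a f ≤ ∑ i, c * a i ^ 2 :=
        Finset.sum_le_sum fun i _ =>
          (mul_le_mul_of_nonneg_left (hf i) (ha i)).trans_eq (by ring)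
    _ = c * ∑ i, a i ^ 2 := (Finset.mul_sum ..).symm
    _ ≤ c * (∑ i, a i) ^ 2 := by
        gcongr
        exact Finset.sum_sq_le_sq_sum_of_nonneg fun i _ => ha i
    _ ≤ c * S ^ 2 := by
        gcongr
        exacts [Finset.sum_nonneg fun i _ => ha i, h.sum_le]

variable [DecidableEq ι]

lemma wsq_score_le (X : ι → ℝ) : wsq a (score V X) ≤ 2 * (1 + B * S ^ 2) * (1 + wsq a X) := by
  have hB := h.const_nonneg
  have hX := wsq_nonneg h.weight_nonneg X
  have hgrad : wsq a (fun i => fderiv ℝ V X (Pi.single i 1)) ≤ B * (1 + wsq a X) * S ^ 2 :=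
    h.sum_mul_sq_le (by positivity) fun i => by
      simpa [wsq_single] using h.fderiv_sq_le X (Pi.single i 1)
  calc _ ≤ 2 * (wsq a X + wsq a fun i => fderiv ℝ V X (Pi.single i 1)) :=
        wsq_add_le h.weight_nonneg _ _
    _ ≤ 2 * (1 + wsq a X + B * (1 + wsq a X) * S ^ 2) := by gcongr; linarith
    _ = _ := by ring

lemma wsq_score_sub_le (X u : ι → ℝ) :
    wsq a (score V (X + u) - score V X) ≤ 2 * (1 + B * S ^ 2) * wsq a u := by
  have hB := h.const_nonneg
  have hu := wsq_nonneg h.weight_nonneg u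
  set g : ι → ℝ := fun i => fderiv ℝ V (X + u) (Pi.single i 1) - fderiv ℝ V X (Pi.single i 1)
  have hgrad : wsq a g ≤ B * wsq a u * S ^ 2 :=
    h.sum_mul_sq_le (by positivity) fun i => by
      simpa [wsq_single] using h.fderiv_sub_sq_le (X + u) X (Pi.single i 1)
  have hsplit : score V (X + u) - score V X = u + g := by
    ext i
    simp only [score, g, Pi.sub_apply, Pi.add_apply]
    ring
  calc _ ≤ 2 * (wsq a u + wsq a g) := hsplit ▸ wsq_add_le h.weight_nonneg _ _
    _ ≤ 2 * (wsq a u + B * wsq a u * S ^ 2) := by gcongr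
    _ = _ := by ring

lemma score_sq_le (X : ι → ℝ) (i : ι) :
    score V X i ^ 2 ≤ 2 * (X i ^ 2 + B * S * (1 + wsq a X)) := by
  have hB := h.const_nonneg
  have hX := wsq_nonneg h.weight_nonneg X
  have hi : a i ≤ S :=
    (Finset.single_le_sum (fun j _ => h.weight_nonneg j) (Finset.mem_univ i)).trans h.sum_le
  have hgrad : fderiv ℝ V X (Pi.single i 1) ^ 2 ≤ B * S * (1 + wsq a X) :=
    calc _ ≤ B * (1 + wsq a X) * a i := by simpa [wsq_single] using h.fderiv_sq_le X (Pi.single i 1)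
      _ ≤ B * (1 + wsq a X) * S := by gcongr
      _ = _ := by ring
  exact add_sq_le.trans (by gcongr)

end PotentialControl

/-! ### Gaussian approximation of the acceptance ratio -/

/-- The size of a state `X`, as it enters the error bounds: `wsq a X` and `√N * fluct X` are of
order one under the standard Gaussian measure. -/
def stateSize {ι : Type*} [Fintype ι] (a X : ι → ℝ) : ℝ :=
  (1 + wsq a X) ^ 2 + Fintype.card ι * fluct X ^ 2

/-- A bound for the mean of `stateSize a` under the standard Gaussian measure when
`∑ j, a j ≤ S`. -/
def stateSizeConst (S : ℝ) : ℝ := 1 + (2 * S + gaussM4 * S ^ 2) + gaussM4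

/-- The constant in the mean square distance between `moveRatio V ℓ X` and a variable with law
`limitLaw ℓ`, in terms of the constants in `PotentialControl`. -/
def ratioConst (ℓ B S : ℝ) : ℝ :=
  3 * (2 * ℓ ^ 2 + ℓ ^ 4 * gaussM4 + 4 * ℓ ^ 2 * B * (S + 2 * ℓ ^ 2 * gaussM4 * S ^ 2))

lemma stateSize_nonneg (a X : ι → ℝ) : 0 ≤ stateSize a X := by unfold stateSize; positivity

lemma one_add_wsq_sq_le_stateSize (a X : ι → ℝ) : (1 + wsq a X) ^ 2 ≤ stateSize a X :=
  le_add_of_nonneg_right (by positivity)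

lemma one_le_stateSize (ha : ∀ j, 0 ≤ a j) (X : ι → ℝ) : 1 ≤ stateSize a X :=
  (one_le_pow₀ (le_add_of_nonneg_right (wsq_nonneg ha X))).trans (one_add_wsq_sq_le_stateSize a X)

lemma one_add_wsq_le_stateSize (ha : ∀ j, 0 ≤ a j) (X : ι → ℝ) : 1 + wsq a X ≤ stateSize a X :=
  (le_self_pow₀ (le_add_of_nonneg_right (wsq_nonneg ha X)) two_ne_zero).trans
    (one_add_wsq_sq_le_stateSize a X)

lemma stateSize_eq (a X : ι → ℝ) :
    stateSize a X = (1 + (2 * wsq a X + wsq a X ^ 2)) + Fintype.card ι * fluct X ^ 2 := by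
  rw [stateSize]
  ring

lemma integrable_stateSize (ha : ∀ j, 0 ≤ a j) : Integrable (stateSize a) (stdPi ι) := by
  have hw := ((integrable_wsq a).const_mul 2).add (integrable_wsq_sq ha)
  have hfluct := (memLp_fluct (ι := ι)).integrable_sq.const_mul (Fintype.card ι : ℝ)
  exact (((integrable_const 1).add hw).add hfluct).congr
    (ae_of_all _ fun X => (stateSize_eq a X).symm)

lemma integral_stateSize_le [Nonempty ι] (ha : ∀ j, 0 ≤ a j) (hS : ∑ j, a j ≤ S) :
    ∫ X, stateSize a X ∂stdPi ι ≤ stateSizeConst S := by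
  have hw : Integrable (fun X => 2 * wsq a X + wsq a X ^ 2) (stdPi ι) :=
    ((integrable_wsq a).const_mul 2).add (integrable_wsq_sq ha)
  have hfluct := (memLp_fluct (ι := ι)).integrable_sq.const_mul (Fintype.card ι : ℝ)
  have hM4 := gaussM4_nonneg
  have hsum : 0 ≤ ∑ j, a j := Finset.sum_nonneg fun j _ => ha j
  calc ∫ X, stateSize a X ∂stdPi ι
      = 1 + (2 * ∫ X, wsq a X ∂stdPi ι + ∫ X, wsq a X ^ 2 ∂stdPi ι) +
          Fintype.card ι * ∫ X : ι → ℝ, fluct X ^ 2 ∂stdPi ι := by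
        simp_rw [stateSize_eq]
        rw [integral_add (by exact (integrable_const 1).add hw) hfluct,
          integral_add (integrable_const 1) hw,
          integral_add ((integrable_wsq a).const_mul 2) (integrable_wsq_sq ha)]
        simp [integral_const_mul]
    _ ≤ 1 + (2 * ∑ j, a j + gaussM4 * (∑ j, a j) ^ 2) +
          Fintype.card ι * (gaussM4 / Fintype.card ι) := by
        rw [integral_wsq]
        gcongr
        · exact integral_wsq_sq_le ha
        · exact integral_fluct_sq_le
    _ ≤ 1 + (2 * S + gaussM4 * S ^ 2) + Fintype.card ι * (gaussM4 / Fintype.card ι) := by gcongr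
    _ = stateSizeConst S := by
        rw [mul_div_cancel₀ _ (Nat.cast_ne_zero.2 Fintype.card_ne_zero), stateSizeConst]

lemma ratioConst_pos {ℓ : ℝ} (hℓ : 0 < ℓ) (hB : 0 ≤ B) (hS : 0 ≤ S) : 0 < ratioConst ℓ B S := by
  have := gaussM4_nonneg
  unfold ratioConst
  positivity

lemma exists_unit_smul [Nonempty ι] (X : ι → ℝ) :
    ∃ e : ι → ℝ, ∑ j, e j ^ 2 = 1 ∧ ∀ j, X j = √(∑ j, X j ^ 2) * e j := by
  classical
  by_cases hX : ∑ j, X j ^ 2 = 0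
  · obtain ⟨i⟩ := ‹Nonempty ι›
    refine ⟨Pi.single i 1, by simp [Pi.single_apply], fun j => ?_⟩
    rw [hX, Real.sqrt_zero, zero_mul]
    exact pow_eq_zero_iff two_ne_zero |>.1
      ((Finset.sum_eq_zero_iff_of_nonneg fun k _ => sq_nonneg (X k)).1 hX j (Finset.mem_univ j))
  · have hpos : 0 < ∑ j, X j ^ 2 := (Finset.sum_nonneg fun j _ => sq_nonneg _).lt_of_ne' hX
    have := Real.sqrt_pos.2 hpos
    refine ⟨fun j => X j / √(∑ j, X j ^ 2), ?_, fun j => by field_simp⟩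
    simp_rw [div_pow, Real.sq_sqrt hpos.le, ← Finset.sum_div]
    exact div_self hX

/-- `ρ` stands for `|X| / √N`. -/
lemma moveRatio_sub_eq [Nonempty ι] {ℓ ρ : ℝ} (hℓ : 0 ≤ ℓ) {X e : ι → ℝ}
    (hX : ∀ j, X j = ρ * √(Fintype.card ι) * e j) (ξ : ι → ℝ) :
    moveRatio V ℓ X ξ - (-ℓ ^ 2 - √2 * ℓ * ∑ j, e j * ξ j) =
      √2 * ℓ * (1 - ρ) * (∑ j, e j * ξ j) + -ℓ ^ 2 * fluct ξ +
        (V X - V (X + stepSize ℓ (Fintype.card ι) • ξ)) := by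
  have : (Fintype.card ι : ℝ) ≠ 0 := Nat.cast_ne_zero.2 Fintype.card_ne_zero
  set τ := stepSize ℓ (Fintype.card ι)
  have hτ : τ * √(Fintype.card ι) = √2 * ℓ := by
    rw [show τ = _ from stepSize_eq hℓ _]
    field_simp
  have hτ2 : τ ^ 2 = 2 * ℓ ^ 2 / Fintype.card ι := stepSize_sq ℓ _
  have hexpand : ∑ j, (X + τ • ξ) j ^ 2 =
      ∑ j, X j ^ 2 + 2 * (√2 * ℓ * ρ) * ∑ j, e j * ξ j + τ ^ 2 * ∑ j, ξ j ^ 2 := by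
    simp only [Finset.mul_sum, ← Finset.sum_add_distrib, ← hτ, Pi.add_apply, Pi.smul_apply,
      smul_eq_mul]
    exact Finset.sum_congr rfl fun j _ => by rw [hX]; ring
  have hfluct : ℓ ^ 2 * fluct ξ = τ ^ 2 * (∑ j, ξ j ^ 2) / 2 - ℓ ^ 2 := by
    rw [hτ2, fluct]
    ring
  simp only [moveRatio, energy]
  rw [hexpand]
  linear_combination hfluct

lemma integral_add_add_sq_le {Ω : Type*} [MeasurableSpace Ω] {μ : Measure Ω} {f g k : Ω → ℝ}
    (hf : MemLp f 2 μ) (hg : MemLp g 2 μ) (hk : MemLp k 2 μ) :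
    ∫ ω, (f ω + g ω + k ω) ^ 2 ∂μ ≤
      3 * (∫ ω, f ω ^ 2 ∂μ + ∫ ω, g ω ^ 2 ∂μ + ∫ ω, k ω ^ 2 ∂μ) := by
  have hfg : Integrable (fun ω => f ω ^ 2 + g ω ^ 2) μ := hf.integrable_sq.add hg.integrable_sq
  rw [← integral_add hf.integrable_sq hg.integrable_sq, ← integral_add hfg hk.integrable_sq,
    ← integral_const_mul]
  refine integral_mono ((hf.add hg).add hk).integrable_sq
    ((hfg.add hk.integrable_sq).const_mul 3) fun ω => ?_
  nlinarith [sq_nonneg (f ω - g ω), sq_nonneg (f ω - k ω), sq_nonneg (g ω - k ω)]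

lemma sq_one_sub_sqrt_le {x : ℝ} (hx : 0 ≤ x) : (1 - √x) ^ 2 ≤ (x - 1) ^ 2 := by
  have hsq := Real.sq_sqrt hx
  have hone : (1 : ℝ) ≤ (1 + √x) ^ 2 := one_le_pow₀ (by linarith [Real.sqrt_nonneg x])
  calc (1 - √x) ^ 2 ≤ (1 - √x) ^ 2 * (1 + √x) ^ 2 := le_mul_of_one_le_right (sq_nonneg _) hone
    _ = (√x ^ 2 - 1) ^ 2 := by ring
    _ = _ := by rw [hsq]

namespace PotentialControl

variable (h : PotentialControl a V B S)
include h

lemma sub_smul_sq_le (τ : ℝ) (X ξ : ι → ℝ) :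
    (V X - V (X + τ • ξ)) ^ 2 ≤
      B * τ ^ 2 * ((1 + 2 * wsq a X) * wsq a ξ + 2 * τ ^ 2 * wsq a ξ ^ 2) := by
  rw [sub_sq_comm]
  refine (h.sub_sq_le X (τ • ξ)).trans_eq ?_
  rw [wsq_smul]
  ring

lemma memLp_sub (τ : ℝ) (X : ι → ℝ) :
    MemLp (fun ξ => V X - V (X + τ • ξ)) 2 (stdPi ι) := by
  have hmeas : AEStronglyMeasurable (fun ξ => V X - V (X + τ • ξ)) (stdPi ι) :=
    (continuous_const.sub (h.differentiable.continuous.comp (by fun_prop))).aestronglyMeasurable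
  rw [memLp_two_iff_integrable_sq hmeas]
  refine ((((integrable_wsq a).const_mul (1 + 2 * wsq a X)).add
    ((integrable_wsq_sq h.weight_nonneg).const_mul (2 * τ ^ 2))).const_mul (B * τ ^ 2)).mono'
    (hmeas.pow 2) (ae_of_all _ fun ξ => ?_)
  rw [Real.norm_of_nonneg (sq_nonneg _)]
  exact h.sub_smul_sq_le τ X ξ

lemma integral_sub_sq_le (τ : ℝ) (X : ι → ℝ) :
    ∫ ξ, (V X - V (X + τ • ξ)) ^ 2 ∂stdPi ι ≤
      B * τ ^ 2 * ((1 + 2 * wsq a X) * S + 2 * τ ^ 2 * (gaussM4 * S ^ 2)) := by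
  have hw := wsq_nonneg h.weight_nonneg X
  have hB := h.const_nonneg
  have hm := gaussM4_nonneg
  have hsum : 0 ≤ ∑ j, a j := Finset.sum_nonneg fun j _ => h.weight_nonneg j
  have hint := (integrable_wsq a).const_mul (1 + 2 * wsq a X)
  have hint_sq := (integrable_wsq_sq h.weight_nonneg).const_mul (2 * τ ^ 2)
  calc _ ≤ ∫ ξ, B * τ ^ 2 * ((1 + 2 * wsq a X) * wsq a ξ + 2 * τ ^ 2 * wsq a ξ ^ 2) ∂stdPi ι :=
        integral_mono (h.memLp_sub τ X).integrable_sq ((hint.add hint_sq).const_mul _)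
          (h.sub_smul_sq_le τ X)
    _ = B * τ ^ 2 * ((1 + 2 * wsq a X) * (∑ j, a j) +
          2 * τ ^ 2 * ∫ ξ, wsq a ξ ^ 2 ∂stdPi ι) := by
        rw [integral_const_mul, integral_add hint hint_sq, integral_const_mul, integral_const_mul,
          integral_wsq]
    _ ≤ B * τ ^ 2 * ((1 + 2 * wsq a X) * (∑ j, a j) +
          2 * τ ^ 2 * (gaussM4 * (∑ j, a j) ^ 2)) := by
        gcongr
        exact integral_wsq_sq_le h.weight_nonneg
    _ ≤ _ := by
        have := h.sum_le
        gcongr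

lemma integral_sub_stepSize_sq_le [Nonempty ι] (ℓ : ℝ) (X : ι → ℝ) :
    ∫ ξ, (V X - V (X + stepSize ℓ (Fintype.card ι) • ξ)) ^ 2 ∂stdPi ι ≤
      4 * ℓ ^ 2 * B * (S + 2 * ℓ ^ 2 * gaussM4 * S ^ 2) * stateSize a X / Fintype.card ι := by
  have hB := h.const_nonneg
  have hS := h.sum_nonneg
  have hm := gaussM4_nonneg
  have hw := wsq_nonneg h.weight_nonneg X
  have hN : (1 : ℝ) ≤ Fintype.card ι := by exact_mod_cast Fintype.card_pos
  have hτ : stepSize ℓ (Fintype.card ι) ^ 2 ≤ 2 * ℓ ^ 2 := by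
    rw [stepSize_sq]
    exact div_le_self (by positivity) hN
  calc _ ≤ B * stepSize ℓ (Fintype.card ι) ^ 2 * ((1 + 2 * wsq a X) * S +
        2 * stepSize ℓ (Fintype.card ι) ^ 2 * (gaussM4 * S ^ 2)) := h.integral_sub_sq_le _ X
    _ ≤ B * stepSize ℓ (Fintype.card ι) ^ 2 * ((2 * (1 + wsq a X)) * S +
        2 * (2 * ℓ ^ 2) * (gaussM4 * S ^ 2 * (1 + wsq a X))) := by
        gcongr ?_ * (?_ * S + 2 * ?_ * ?_)
        · linarith
        · exact le_mul_of_one_le_right (by positivity) (by linarith)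
    _ = 4 * ℓ ^ 2 * B * (S + 2 * ℓ ^ 2 * gaussM4 * S ^ 2) * (1 + wsq a X) / Fintype.card ι := by
        rw [stepSize_sq]
        ring
    _ ≤ _ := by
        gcongr
        exact one_add_wsq_le_stateSize h.weight_nonneg X

lemma exists_hasLaw_limitLaw [Nonempty ι] {ℓ : ℝ} (hℓ : 0 ≤ ℓ) (X : ι → ℝ) :
    ∃ Z : (ι → ℝ) → ℝ, HasLaw Z (limitLaw ℓ) (stdPi ι) ∧
      MemLp (fun ξ => moveRatio V ℓ X ξ - Z ξ) 2 (stdPi ι) ∧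
      ∫ ξ, (moveRatio V ℓ X ξ - Z ξ) ^ 2 ∂stdPi ι ≤
        ratioConst ℓ B S * stateSize a X / Fintype.card ι := by
  obtain ⟨e, he, hX⟩ := exists_unit_smul X
  set ρ := √((∑ j, X j ^ 2) / Fintype.card ι)
  have hN : (0 : ℝ) < Fintype.card ι := by exact_mod_cast Fintype.card_pos
  have hρ : (1 - ρ) ^ 2 ≤ fluct X ^ 2 := sq_one_sub_sqrt_le (by positivity)
  have hXρ (j : ι) : X j = ρ * √(Fintype.card ι) * e j := by
    rw [← Real.sqrt_mul (by positivity), div_mul_cancel₀ _ hN.ne']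
    exact hX j
  have hlin : MemLp (fun ξ : ι → ℝ => √2 * ℓ * (1 - ρ) * ∑ j, e j * ξ j) 2 (stdPi ι) :=
    (memLp_finsetSum _ fun j _ => (memLp_eval_stdPi j).const_mul (e j)).const_mul _
  have hquad : MemLp (fun ξ : ι → ℝ => -ℓ ^ 2 * fluct ξ) 2 (stdPi ι) := memLp_fluct.const_mul _
  have hpot := h.memLp_sub (stepSize ℓ (Fintype.card ι)) X
  refine ⟨_, hasLaw_limitLaw he ℓ, ?_, ?_⟩ <;> simp only [moveRatio_sub_eq hℓ hXρ]
  · exact (hlin.add hquad).add hpot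
  calc _ ≤ 3 * (∫ ξ, (√2 * ℓ * (1 - ρ) * ∑ j, e j * ξ j) ^ 2 ∂stdPi ι +
          ∫ ξ, (-ℓ ^ 2 * fluct ξ) ^ 2 ∂stdPi ι +
          ∫ ξ, (V X - V (X + stepSize ℓ (Fintype.card ι) • ξ)) ^ 2 ∂stdPi ι) :=
        integral_add_add_sq_le hlin hquad hpot
    _ = 3 * (2 * ℓ ^ 2 * (1 - ρ) ^ 2 + ℓ ^ 4 * ∫ ξ : ι → ℝ, fluct ξ ^ 2 ∂stdPi ι +
          ∫ ξ, (V X - V (X + stepSize ℓ (Fintype.card ι) • ξ)) ^ 2 ∂stdPi ι) := by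
        simp only [mul_pow, integral_const_mul, integral_sum_mul_sq, he, Real.sq_sqrt zero_le_two]
        ring
    _ ≤ 3 * (2 * ℓ ^ 2 * (stateSize a X / Fintype.card ι) +
          ℓ ^ 4 * (gaussM4 * stateSize a X / Fintype.card ι) +
          4 * ℓ ^ 2 * B * (S + 2 * ℓ ^ 2 * gaussM4 * S ^ 2) * stateSize a X / Fintype.card ι) := by
        gcongr
        · rw [le_div_iff₀ hN, mul_comm]
          exact (mul_le_mul_of_nonneg_left hρ hN.le).trans
            (le_add_of_nonneg_left (sq_nonneg _))
        · refine integral_fluct_sq_le.trans ?_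
          gcongr
          exact le_mul_of_one_le_right gaussM4_nonneg (one_le_stateSize h.weight_nonneg X)
        · exact h.integral_sub_stepSize_sq_le ℓ X
    _ = _ := by rw [ratioConst]; ring

end PotentialControl

end MetropolisStep

/-! ### Drift and covariance of the Metropolis step -/

section MeanIncrement

/-- The constant in `PotentialControl.wsq_driftError_le`. -/
def driftConst (ℓ B S : ℝ) : ℝ :=
  16 * ℓ ^ 4 * (1 + B * S ^ 2) *
    ((2 + 1 / (√Real.pi * ℓ)) ^ 2 * √(ratioConst ℓ B S) + 2 * ℓ ^ 2 * S)

/-- The constant in `PotentialControl.abs_covError_le`. -/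
def covConst (ℓ B S : ℝ) : ℝ :=
  √(ratioConst ℓ B S) + √2 * ℓ * (1 + 2 * ℓ ^ 2 + B * S * (1 + 2 * ℓ ^ 2 * S))

lemma driftConst_nonneg {ℓ B S : ℝ} (hB : 0 ≤ B) (hS : 0 ≤ S) : 0 ≤ driftConst ℓ B S := by
  unfold driftConst; positivity

lemma covConst_nonneg {ℓ B S : ℝ} (hℓ : 0 ≤ ℓ) (hB : 0 ≤ B) (hS : 0 ≤ S) :
    0 ≤ covConst ℓ B S := by
  unfold covConst; positivity

lemma sq_integral_le_integral_sq {Ω : Type*} [MeasurableSpace Ω] {μ : Measure Ω}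
    [IsProbabilityMeasure μ] {f : Ω → ℝ} (hf : MemLp f 2 μ) :
    (∫ ω, f ω ∂μ) ^ 2 ≤ ∫ ω, f ω ^ 2 ∂μ := by
  have hvar := variance_nonneg f μ
  rw [variance_eq_sub hf] at hvar
  exact sub_nonneg.1 hvar

variable {ι : Type*} [Fintype ι] {a : ι → ℝ} {V : (ι → ℝ) → ℝ} {B S ℓ : ℝ}

/-- The deviation of the `i`-th coordinate of the rescaled mean increment of the Metropolis step
started at `X` from its limit. -/
def driftError [DecidableEq ι] (V : (ι → ℝ) → ℝ) (ℓ : ℝ) (X : ι → ℝ) (i : ι) : ℝ :=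
  Fintype.card ι * stepSize ℓ (Fintype.card ι) *
    ∫ ξ, ξ i * acc (moveRatio V ℓ X ξ) ∂stdPi ι + ℓ ^ 2 * beta ℓ * score V X i

/-- The deviation of the `(i, j)` entry of the second moment of the Metropolis step started at `X`,
in units of the step size, from its limit. -/
def covError [DecidableEq ι] (V : (ι → ℝ) → ℝ) (ℓ : ℝ) (X : ι → ℝ) (i j : ι) : ℝ :=
  ∫ ξ, ξ i * (acc (moveRatio V ℓ X ξ) * ξ j) ∂stdPi ι - beta ℓ * if i = j then 1 else 0

lemma memLp_add_smul_eval (τ : ℝ) (X : ι → ℝ) (i : ι) :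
    MemLp (fun ξ : ι → ℝ => (X + τ • ξ) i) 2 (stdPi ι) :=
  (memLp_const (X i)).add ((memLp_eval_stdPi i).const_mul τ)

lemma integral_add_smul_eval_sq (τ : ℝ) (X : ι → ℝ) (i : ι) :
    ∫ ξ, (X + τ • ξ) i ^ 2 ∂stdPi ι = X i ^ 2 + τ ^ 2 := by
  have hlin : Integrable (fun ξ : ι → ℝ => 2 * X i * τ * ξ i) (stdPi ι) :=
    ((memLp_eval_stdPi i).integrable one_le_two).const_mul _
  have haffine : Integrable (fun ξ : ι → ℝ => X i ^ 2 + 2 * X i * τ * ξ i) (stdPi ι) :=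
    (integrable_const _).add hlin
  have hsq : Integrable (fun ξ : ι → ℝ => τ ^ 2 * ξ i ^ 2) (stdPi ι) :=
    (integrable_eval_pow i 2).const_mul _
  have hmean : ∫ ξ : ι → ℝ, ξ i ∂stdPi ι = 0 := by simpa using integral_eval_pow i 1
  have hexpand (ξ : ι → ℝ) : (X + τ • ξ) i ^ 2 =
      X i ^ 2 + 2 * X i * τ * ξ i + τ ^ 2 * ξ i ^ 2 := by
    simp only [Pi.add_apply, Pi.smul_apply, smul_eq_mul]
    ring
  simp_rw [hexpand]
  rw [integral_add haffine hsq, integral_add (integrable_const _) hlin,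
    integral_const_mul, integral_const_mul, integral_eval_sq, hmean]
  simp

lemma integrable_wsq_add_smul (a : ι → ℝ) (τ : ℝ) (X : ι → ℝ) :
    Integrable (fun ξ => wsq a (X + τ • ξ)) (stdPi ι) :=
  integrable_finsetSum _ fun j _ => (memLp_add_smul_eval τ X j).integrable_sq.const_mul (a j)

lemma integral_wsq_add_smul (a : ι → ℝ) (τ : ℝ) (X : ι → ℝ) :
    ∫ ξ, wsq a (X + τ • ξ) ∂stdPi ι = wsq a X + τ ^ 2 * ∑ j, a j := by
  unfold wsq
  rw [integral_finsetSum _ fun j _ =>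
    (memLp_add_smul_eval τ X j).integrable_sq.const_mul (a j)]
  simp only [integral_const_mul, integral_add_smul_eval_sq, mul_add, Finset.sum_add_distrib,
    Finset.mul_sum, mul_comm (a _) (τ ^ 2)]

lemma stepSize_sq_le [Nonempty ι] (ℓ : ℝ) : stepSize ℓ (Fintype.card ι) ^ 2 ≤ 2 * ℓ ^ 2 := by
  rw [stepSize_sq]
  exact div_le_self (by positivity) (by exact_mod_cast Fintype.card_pos)

namespace PotentialControl

variable (h : PotentialControl a V B S)
include h

lemma abs_integral_acc_moveRatio_sub_le [Nonempty ι] (hℓ : 0 < ℓ) (X : ι → ℝ) :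
    |∫ ξ, acc (moveRatio V ℓ X ξ) ∂stdPi ι - beta ℓ| ≤
      √(ratioConst ℓ B S * stateSize a X / Fintype.card ι) := by
  obtain ⟨Z, hZ, hQZ, hle⟩ := h.exists_hasLaw_limitLaw hℓ.le X
  have hQ := (differentiable_moveRatio h.differentiable ℓ X).continuous.measurable
  refine (abs_integral_acc_sub_beta_le hℓ hQ.aemeasurable hZ (hQZ.integrable one_le_two)).trans
    (Real.le_sqrt_of_sq_le ((sq_integral_le_integral_sq hQZ.abs).trans ?_))
  simpa only [Pi.abs_apply, sq_abs] using hle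

lemma sq_integral_accDeriv_moveRatio_sub_le [Nonempty ι] (hℓ : 0 < ℓ) (X : ι → ℝ) :
    (∫ ξ, accDeriv (moveRatio V ℓ X ξ) ∂stdPi ι - beta ℓ / 2) ^ 2 ≤
      (2 + 1 / (√Real.pi * ℓ)) ^ 2 * √(ratioConst ℓ B S * stateSize a X / Fintype.card ι) := by
  obtain ⟨Z, hZ, hQZ, hle⟩ := h.exists_hasLaw_limitLaw hℓ.le X
  have hQ := (differentiable_moveRatio h.differentiable ℓ X).continuous.measurable
  have hK := ratioConst_pos hℓ h.const_nonneg h.sum_nonneg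
  have hσ := zero_lt_one.trans_le (one_le_stateSize h.weight_nonneg X)
  refine sq_integral_accDeriv_sub_half_beta_le hℓ hQ.aemeasurable hZ (hQZ.integrable one_le_two)
    (by positivity) (Real.le_sqrt_of_sq_le ((sq_integral_le_integral_sq hQZ.abs).trans ?_))
  simpa only [Pi.abs_apply, sq_abs] using hle

lemma sq_integral_accDeriv_moveRatio_sub_mul_le [Nonempty ι] (hℓ : 0 < ℓ) (X : ι → ℝ) :
    (∫ ξ, accDeriv (moveRatio V ℓ X ξ) ∂stdPi ι - beta ℓ / 2) ^ 2 * (1 + wsq a X) ≤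
      (2 + 1 / (√Real.pi * ℓ)) ^ 2 * √(ratioConst ℓ B S) * stateSize a X /
        √(Fintype.card ι) := by
  have hw := wsq_nonneg h.weight_nonneg X
  have hσ := stateSize_nonneg a X
  set L := (2 + 1 / (√Real.pi * ℓ)) ^ 2
  calc _ ≤ L * √(ratioConst ℓ B S * stateSize a X / Fintype.card ι) * √(stateSize a X) := by
        gcongr
        · exact h.sq_integral_accDeriv_moveRatio_sub_le hℓ X
        · exact Real.le_sqrt_of_sq_le (one_add_wsq_sq_le_stateSize a X)
    _ = L * √(ratioConst ℓ B S) * (√(stateSize a X) * √(stateSize a X)) /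
          √(Fintype.card ι) := by
        rw [Real.sqrt_div' _ (by positivity), Real.sqrt_mul' _ (by positivity)]
        ring
    _ = _ := by rw [Real.mul_self_sqrt hσ]

lemma integrable_accDeriv_mul {f : (ι → ℝ) → ℝ} (hf : Integrable f (stdPi ι)) (X : ι → ℝ) :
    Integrable (fun ξ => accDeriv (moveRatio V ℓ X ξ) * f ξ) (stdPi ι) :=
  hf.bdd_mul (measurable_accDeriv.comp
    (differentiable_moveRatio h.differentiable ℓ X).continuous.measurable).aestronglyMeasurable
    (ae_of_all _ fun _ => abs_accDeriv_le_one _)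

variable [DecidableEq ι]

lemma memLp_score_add_smul (τ : ℝ) (X : ι → ℝ) (i : ι) :
    MemLp (fun ξ => score V (X + τ • ξ) i) 2 (stdPi ι) := by
  have hmeas : AEStronglyMeasurable (fun ξ => score V (X + τ • ξ) i) (stdPi ι) :=
    ((measurable_score V i).comp (by fun_prop)).aestronglyMeasurable
  rw [memLp_two_iff_integrable_sq hmeas]
  refine (((memLp_add_smul_eval τ X i).integrable_sq.add
    (((integrable_const 1).add (integrable_wsq_add_smul a τ X)).const_mul (B * S))).const_mul
      2).mono' (hmeas.pow 2) (ae_of_all _ fun ξ => ?_)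
  rw [Real.norm_of_nonneg (sq_nonneg _)]
  exact h.score_sq_le _ i

lemma integral_score_add_smul_sq_le (τ : ℝ) (X : ι → ℝ) (i : ι) :
    ∫ ξ, score V (X + τ • ξ) i ^ 2 ∂stdPi ι ≤
      2 * (X i ^ 2 + τ ^ 2 + B * S * (1 + wsq a X + τ ^ 2 * S)) := by
  have hB := h.const_nonneg
  have hS := h.sum_nonneg
  have hone_add : Integrable (fun ξ => 1 + wsq a (X + τ • ξ)) (stdPi ι) :=
    (integrable_const 1).add (integrable_wsq_add_smul a τ X)
  have hsq := (memLp_add_smul_eval τ X i).integrable_sq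
  calc _ ≤ ∫ ξ, 2 * ((X + τ • ξ) i ^ 2 + B * S * (1 + wsq a (X + τ • ξ))) ∂stdPi ι :=
        integral_mono (h.memLp_score_add_smul τ X i).integrable_sq
          ((hsq.add (hone_add.const_mul _)).const_mul 2) fun ξ => h.score_sq_le _ i
    _ = 2 * (X i ^ 2 + τ ^ 2 + B * S * (1 + (wsq a X + τ ^ 2 * ∑ j, a j))) := by
        rw [integral_const_mul, integral_add hsq (hone_add.const_mul _), integral_const_mul,
          integral_add (integrable_const 1) (integrable_wsq_add_smul a τ X),
          integral_wsq_add_smul, integral_add_smul_eval_sq]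
        simp
    _ ≤ _ := by
        rw [← add_assoc]
        gcongr
        exact h.sum_le

lemma memLp_fderiv_moveRatio_single (X : ι → ℝ) (i : ι) :
    MemLp (fun ξ => fderiv ℝ (moveRatio V ℓ X) ξ (Pi.single i 1)) 2 (stdPi ι) := by
  simp only [fderiv_moveRatio_single h.differentiable]
  exact (h.memLp_score_add_smul _ X i).const_mul _

lemma integral_eval_mul_acc_moveRatio_mul {g : (ι → ℝ) → ℝ} {i : ι} (hg : Differentiable ℝ g)
    (hg2 : MemLp g 2 (stdPi ι))
    (hg1 : Integrable (fun ξ => fderiv ℝ g ξ (Pi.single i 1)) (stdPi ι)) (X : ι → ℝ) :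
    ∫ ξ, ξ i * (acc (moveRatio V ℓ X ξ) * g ξ) ∂stdPi ι =
      ∫ ξ, acc (moveRatio V ℓ X ξ) * fderiv ℝ g ξ (Pi.single i 1) ∂stdPi ι -
      stepSize ℓ (Fintype.card ι) * ∫ ξ, accDeriv (moveRatio V ℓ X ξ) *
        (score V (X + stepSize ℓ (Fintype.card ι) • ξ) i * g ξ) ∂stdPi ι := by
  have hQ := differentiable_moveRatio h.differentiable ℓ X
  have hacc : Integrable
      (fun ξ => acc (moveRatio V ℓ X ξ) * fderiv ℝ g ξ (Pi.single i 1)) (stdPi ι) :=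
    hg1.bdd_mul (continuous_acc.comp hQ.continuous).aestronglyMeasurable
      (ae_of_all _ fun _ => abs_acc_le_one _)
  have hscore : Integrable (fun ξ => accDeriv (moveRatio V ℓ X ξ) *
      (score V (X + stepSize ℓ (Fintype.card ι) • ξ) i * g ξ)) (stdPi ι) :=
    h.integrable_accDeriv_mul ((h.memLp_score_add_smul _ X i).integrable_mul hg2) X
  rw [integral_eval_mul_acc_mul hQ hg hg2 (h.memLp_fderiv_moveRatio_single X i) hg1,
    ← integral_const_mul, ← integral_sub hacc (hscore.const_mul _)]
  simp only [fderiv_moveRatio_single h.differentiable]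
  congr 1 with ξ
  ring

lemma driftError_eq [Nonempty ι] (X : ι → ℝ) (i : ι) :
    driftError V ℓ X i = -2 * ℓ ^ 2 *
      ((∫ ξ, accDeriv (moveRatio V ℓ X ξ) *
          (score V (X + stepSize ℓ (Fintype.card ι) • ξ) - score V X) i ∂stdPi ι) +
        (∫ ξ, accDeriv (moveRatio V ℓ X ξ) ∂stdPi ι - beta ℓ / 2) * score V X i) := by
  set τ := stepSize ℓ (Fintype.card ι)
  have hτ : Fintype.card ι * τ ^ 2 = 2 * ℓ ^ 2 := by
    rw [show τ ^ 2 = _ from stepSize_sq ℓ _]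
    exact mul_div_cancel₀ _ (Nat.cast_ne_zero.2 Fintype.card_ne_zero)
  have hscore := h.integrable_accDeriv_mul (ℓ := ℓ)
    ((h.memLp_score_add_smul τ X i).integrable one_le_two) X
  have hstein : ∫ ξ, ξ i * acc (moveRatio V ℓ X ξ) ∂stdPi ι =
      -τ * ∫ ξ, accDeriv (moveRatio V ℓ X ξ) * score V (X + τ • ξ) i ∂stdPi ι := by
    simpa using h.integral_eval_mul_acc_moveRatio_mul (g := fun _ => 1) (i := i)
      (differentiable_const _) (memLp_const _) (by simp) X
  have hsub : ∫ ξ, accDeriv (moveRatio V ℓ X ξ) * (score V (X + τ • ξ) - score V X) i ∂stdPi ι =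
      ∫ ξ, accDeriv (moveRatio V ℓ X ξ) * score V (X + τ • ξ) i ∂stdPi ι -
        (∫ ξ, accDeriv (moveRatio V ℓ X ξ) ∂stdPi ι) * score V X i := by
    rw [← integral_mul_const, ← integral_sub hscore
      (h.integrable_accDeriv_mul (integrable_const (score V X i)) X)]
    simp only [Pi.sub_apply, mul_sub]
  rw [driftError, hstein, hsub]
  linear_combination (-∫ ξ, accDeriv (moveRatio V ℓ X ξ) * score V (X + τ • ξ) i ∂stdPi ι) * hτ

lemma covError_eq (X : ι → ℝ) (i j : ι) :
    covError V ℓ X i j =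
      (∫ ξ, acc (moveRatio V ℓ X ξ) ∂stdPi ι - beta ℓ) * (if i = j then 1 else 0) -
      stepSize ℓ (Fintype.card ι) * ∫ ξ, accDeriv (moveRatio V ℓ X ξ) *
        (score V (X + stepSize ℓ (Fintype.card ι) • ξ) i * ξ j) ∂stdPi ι := by
  have hderiv (ξ : ι → ℝ) :
      fderiv ℝ (fun ξ : ι → ℝ => ξ j) ξ (Pi.single i 1) = if i = j then 1 else 0 := by
    rw [(hasFDerivAt_apply j ξ).fderiv]
    simp [Pi.single_apply, eq_comm]
  rw [covError, h.integral_eval_mul_acc_moveRatio_mul (differentiable_apply j)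
    (memLp_eval_stdPi j) (by simp only [hderiv, integrable_const])]
  simp only [hderiv, integral_mul_const]
  ring

lemma driftError_sq_le [Nonempty ι] (X : ι → ℝ) (i : ι) :
    driftError V ℓ X i ^ 2 ≤ 8 * ℓ ^ 4 *
      ((∫ ξ, (score V (X + stepSize ℓ (Fintype.card ι) • ξ) - score V X) i ^ 2 ∂stdPi ι) +
        (∫ ξ, accDeriv (moveRatio V ℓ X ξ) ∂stdPi ι - beta ℓ / 2) ^ 2 * score V X i ^ 2) := by
  set D : (ι → ℝ) → ℝ := fun ξ => (score V (X + stepSize ℓ (Fintype.card ι) • ξ) - score V X) i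
  have hD : MemLp D 2 (stdPi ι) := (h.memLp_score_add_smul _ X i).sub (memLp_const _)
  have hmeas : AEStronglyMeasurable (fun ξ => accDeriv (moveRatio V ℓ X ξ)) (stdPi ι) :=
    (measurable_accDeriv.comp
      (differentiable_moveRatio h.differentiable ℓ X).continuous.measurable).aestronglyMeasurable
  have hle (ξ : ι → ℝ) : |accDeriv (moveRatio V ℓ X ξ) * D ξ| ≤ |D ξ| := by
    rw [abs_mul]
    exact mul_le_of_le_one_left (abs_nonneg _) (abs_accDeriv_le_one _)
  have haD : MemLp (fun ξ => accDeriv (moveRatio V ℓ X ξ) * D ξ) 2 (stdPi ι) :=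
    hD.mono (hmeas.mul hD.aestronglyMeasurable) (ae_of_all _ hle)
  have hjensen : (∫ ξ, accDeriv (moveRatio V ℓ X ξ) * D ξ ∂stdPi ι) ^ 2 ≤
      ∫ ξ, D ξ ^ 2 ∂stdPi ι :=
    (sq_integral_le_integral_sq haD).trans <|
      integral_mono haD.integrable_sq hD.integrable_sq fun ξ => sq_le_sq.2 (hle ξ)
  rw [h.driftError_eq, mul_pow, ← mul_pow _ (score V X i)]
  calc _ ≤ (-2 * ℓ ^ 2) ^ 2 * (2 * ((∫ ξ, accDeriv (moveRatio V ℓ X ξ) * D ξ ∂stdPi ι) ^ 2 +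
          ((∫ ξ, accDeriv (moveRatio V ℓ X ξ) ∂stdPi ι - beta ℓ / 2) * score V X i) ^ 2)) := by
        gcongr
        exact add_sq_le
    _ ≤ (-2 * ℓ ^ 2) ^ 2 * (2 * (∫ ξ, D ξ ^ 2 ∂stdPi ι +
          ((∫ ξ, accDeriv (moveRatio V ℓ X ξ) ∂stdPi ι - beta ℓ / 2) * score V X i) ^ 2)) := by
        gcongr
    _ = _ := by ring

lemma integral_wsq_score_sub_le (τ : ℝ) (X : ι → ℝ) :
    ∑ i, a i * ∫ ξ, (score V (X + τ • ξ) - score V X) i ^ 2 ∂stdPi ι ≤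
      2 * (1 + B * S ^ 2) * (τ ^ 2 * S) := by
  have hB := h.const_nonneg
  have hint (i : ι) : Integrable
      (fun ξ => a i * (score V (X + τ • ξ) - score V X) i ^ 2) (stdPi ι) :=
    ((h.memLp_score_add_smul τ X i).sub (memLp_const (score V X i))).integrable_sq.const_mul _
  calc _ = ∫ ξ, wsq a (score V (X + τ • ξ) - score V X) ∂stdPi ι := by
        unfold wsq
        rw [integral_finsetSum _ fun i _ => hint i]
        simp only [integral_const_mul]
    _ ≤ ∫ ξ, 2 * (1 + B * S ^ 2) * (τ ^ 2 * wsq a ξ) ∂stdPi ι :=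
        integral_mono (integrable_finsetSum _ fun i _ => hint i)
          (((integrable_wsq a).const_mul _).const_mul _) fun ξ => by
            simpa only [wsq_smul] using h.wsq_score_sub_le X (τ • ξ)
    _ ≤ _ := by
        rw [integral_const_mul, integral_const_mul, integral_wsq]
        gcongr
        exact h.sum_le

lemma wsq_driftError_le [Nonempty ι] (hℓ : 0 < ℓ) (X : ι → ℝ) :
    wsq a (driftError V ℓ X) ≤
      driftConst ℓ B S * stateSize a X / √(Fintype.card ι) := by
  have hB := h.const_nonneg
  have hS := h.sum_nonneg
  have hσ := one_le_stateSize h.weight_nonneg X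
  have hN : (1 : ℝ) ≤ Fintype.card ι := by exact_mod_cast Fintype.card_pos
  set L := (2 + 1 / (√Real.pi * ℓ)) ^ 2
  set τ := stepSize ℓ (Fintype.card ι)
  set K := √(ratioConst ℓ B S)
  set β' := (∫ ξ, accDeriv (moveRatio V ℓ X ξ) ∂stdPi ι - beta ℓ / 2) ^ 2
  have hβ' : β' * (1 + wsq a X) ≤ L * K * stateSize a X / √(Fintype.card ι) :=
    h.sq_integral_accDeriv_moveRatio_sub_mul_le hℓ X
  have hτ : τ ^ 2 * S ≤ 2 * ℓ ^ 2 * S * stateSize a X / √(Fintype.card ι) := by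
    rw [show τ ^ 2 = _ from stepSize_sq ℓ _, div_mul_eq_mul_div]
    exact div_le_div₀ (by positivity) (le_mul_of_one_le_right (by positivity) hσ) (by positivity)
      (Real.sqrt_le_self_iff.2 (.inr hN))
  calc _ ≤ ∑ i, a i * (8 * ℓ ^ 4 *
          ((∫ ξ, (score V (X + τ • ξ) - score V X) i ^ 2 ∂stdPi ι) + β' * score V X i ^ 2)) :=
        Finset.sum_le_sum fun i _ =>
          mul_le_mul_of_nonneg_left (h.driftError_sq_le X i) (h.weight_nonneg i)
    _ = 8 * ℓ ^ 4 * ((∑ i, a i * ∫ ξ, (score V (X + τ • ξ) - score V X) i ^ 2 ∂stdPi ι) +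
          β' * wsq a (score V X)) := by
        simp only [wsq, Finset.mul_sum, ← Finset.sum_add_distrib]
        exact Finset.sum_congr rfl fun i _ => by ring
    _ ≤ 8 * ℓ ^ 4 * (2 * (1 + B * S ^ 2) * (τ ^ 2 * S) +
          β' * (2 * (1 + B * S ^ 2) * (1 + wsq a X))) := by
        gcongr
        · exact h.integral_wsq_score_sub_le τ X
        · exact h.wsq_score_le X
    _ = 16 * ℓ ^ 4 * (1 + B * S ^ 2) * (β' * (1 + wsq a X) + τ ^ 2 * S) := by ring
    _ ≤ 16 * ℓ ^ 4 * (1 + B * S ^ 2) * (L * K * stateSize a X / √(Fintype.card ι) +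
          2 * ℓ ^ 2 * S * stateSize a X / √(Fintype.card ι)) := by gcongr
    _ = _ := by rw [driftConst]; ring

lemma abs_integral_accDeriv_mul_score_mul_le [Nonempty ι] (X : ι → ℝ) (i j : ι) :
    |∫ ξ, accDeriv (moveRatio V ℓ X ξ) *
        (score V (X + stepSize ℓ (Fintype.card ι) • ξ) i * ξ j) ∂stdPi ι| ≤
      (1 + 2 * ℓ ^ 2 + B * S * (1 + 2 * ℓ ^ 2 * S)) * (stateSize a X + X i ^ 2) := by
  have hB := h.const_nonneg
  have hS := h.sum_nonneg
  have hw := wsq_nonneg h.weight_nonneg X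
  have hσ := one_add_wsq_le_stateSize h.weight_nonneg X
  have hτ := stepSize_sq_le (ι := ι) ℓ
  set τ := stepSize ℓ (Fintype.card ι)
  have hscore := h.memLp_score_add_smul τ X i
  calc _ ≤ ∫ ξ, |accDeriv (moveRatio V ℓ X ξ) * (score V (X + τ • ξ) i * ξ j)| ∂stdPi ι :=
        abs_integral_le_integral_abs
    _ ≤ ∫ ξ, (score V (X + τ • ξ) i ^ 2 + ξ j ^ 2) / 2 ∂stdPi ι := by
        refine integral_mono
          (h.integrable_accDeriv_mul (hscore.integrable_mul (memLp_eval_stdPi j)) X).abs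
          ((hscore.integrable_sq.add (integrable_eval_pow j 2)).div_const 2) fun ξ => ?_
        rw [abs_mul]
        refine (mul_le_of_le_one_left (abs_nonneg _) (abs_accDeriv_le_one _)).trans ?_
        rw [abs_mul, ← sq_abs (score V _ i), ← sq_abs (ξ j)]
        linarith [two_mul_le_add_sq |score V (X + τ • ξ) i| |ξ j|]
    _ = (∫ ξ, score V (X + τ • ξ) i ^ 2 ∂stdPi ι + 1) / 2 := by
        rw [integral_div, integral_add hscore.integrable_sq (integrable_eval_pow j 2),
          integral_eval_sq]
    _ ≤ (2 * (X i ^ 2 + τ ^ 2 + B * S * (1 + wsq a X + τ ^ 2 * S)) + 1) / 2 := by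
        gcongr
        exact h.integral_score_add_smul_sq_le τ X i
    _ ≤ (2 * (X i ^ 2 + 2 * ℓ ^ 2 + B * S * (1 + wsq a X + 2 * ℓ ^ 2 * S)) + 1) / 2 := by gcongr
    _ ≤ X i ^ 2 + (1 + 2 * ℓ ^ 2) * (1 + wsq a X) +
          B * S * ((1 + 2 * ℓ ^ 2 * S) * (1 + wsq a X)) := by
        have : 0 ≤ B * S * (2 * ℓ ^ 2 * S * wsq a X) := by positivity
        have : 0 ≤ ℓ ^ 2 * wsq a X := by positivity
        linarith
    _ ≤ (1 + 2 * ℓ ^ 2 + B * S * (1 + 2 * ℓ ^ 2 * S)) * (1 + wsq a X + X i ^ 2) := by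
        have : 0 ≤ (2 * ℓ ^ 2 + B * S * (1 + 2 * ℓ ^ 2 * S)) * X i ^ 2 := by positivity
        linarith
    _ ≤ _ := by gcongr

lemma abs_covError_le [Nonempty ι] (hℓ : 0 < ℓ) (X : ι → ℝ) (i j : ι) :
    |covError V ℓ X i j| ≤
      covConst ℓ B S * (stateSize a X + X i ^ 2) / √(Fintype.card ι) := by
  have hσ := one_le_stateSize h.weight_nonneg X
  have hdiag : |(∫ ξ, acc (moveRatio V ℓ X ξ) ∂stdPi ι - beta ℓ) * (if i = j then 1 else 0)| ≤
      √(ratioConst ℓ B S) * (stateSize a X + X i ^ 2) / √(Fintype.card ι) :=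
    calc _ ≤ |∫ ξ, acc (moveRatio V ℓ X ξ) ∂stdPi ι - beta ℓ| := by split_ifs <;> simp
      _ ≤ √(ratioConst ℓ B S) * √(stateSize a X) / √(Fintype.card ι) := by
          refine (h.abs_integral_acc_moveRatio_sub_le hℓ X).trans_eq ?_
          rw [Real.sqrt_div' _ (by positivity), Real.sqrt_mul' _ (by positivity)]
      _ ≤ _ := by
          gcongr
          exact (Real.sqrt_le_self_iff.2 (.inr hσ)).trans (le_add_of_nonneg_right (sq_nonneg _))
  have hstein := h.abs_integral_accDeriv_mul_score_mul_le (ℓ := ℓ) X i j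
  rw [h.covError_eq]
  refine (abs_sub _ _).trans ?_
  rw [abs_mul (stepSize _ _), abs_of_nonneg (stepSize_nonneg _ _)]
  calc _ ≤ √(ratioConst ℓ B S) * (stateSize a X + X i ^ 2) / √(Fintype.card ι) +
          stepSize ℓ (Fintype.card ι) *
            ((1 + 2 * ℓ ^ 2 + B * S * (1 + 2 * ℓ ^ 2 * S)) * (stateSize a X + X i ^ 2)) := by
        gcongr
        exact stepSize_nonneg _ _
    _ = _ := by
        rw [covConst, stepSize_eq hℓ.le]
        ring

lemma sum_mul_abs_covError_le [Nonempty ι] (hℓ : 0 < ℓ) (X : ι → ℝ) :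
    ∑ i, a i * |covError V ℓ X i i| ≤
      covConst ℓ B S * (S + 1) / √(Fintype.card ι) * stateSize a X := by
  have hS := h.sum_nonneg
  have hB := h.const_nonneg
  calc ∑ i, a i * |covError V ℓ X i i|
      ≤ ∑ i, a i * (covConst ℓ B S * (stateSize a X + X i ^ 2) / √(Fintype.card ι)) := by
        gcongr with i
        · exact h.weight_nonneg i
        · exact h.abs_covError_le hℓ X i i
    _ = covConst ℓ B S / √(Fintype.card ι) * ((∑ i, a i) * stateSize a X + wsq a X) := by
        rw [wsq, Finset.sum_mul, ← Finset.sum_add_distrib, Finset.mul_sum]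
        exact Finset.sum_congr rfl fun i _ => by ring
    _ ≤ covConst ℓ B S / √(Fintype.card ι) * (S * stateSize a X + stateSize a X) := by
        have hσ := stateSize_nonneg a X
        have hC := covConst_nonneg hℓ.le hB hS
        gcongr
        · exact h.sum_le
        · linarith [one_add_wsq_le_stateSize h.weight_nonneg X]
    _ = _ := by ring

end PotentialControl

end MeanIncrement

/-! ### The potential in normalised coordinates -/

open SobolevSpace

lemma EigenvalueDecay.pos {lam : ℕ → ℝ} {κ : ℝ} (h : EigenvalueDecay lam κ) (j : ℕ) :
    0 < lam j := by
  obtain ⟨Mm, Mp, hm, -, hb⟩ := h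
  exact pos_of_mul_pos_right (hm.trans_le (hb j).1) (by positivity)

lemma EigenvalueDecay.summable {s κ : ℝ} {lam : ℕ → ℝ} (h : EigenvalueDecay lam κ)
    (hs : s < κ - 1 / 2) : Summable fun j => weight s j * lam j ^ 2 := by
  have hpos := h.pos
  obtain ⟨Mm, Mp, -, -, hb⟩ := h
  have hzeta : Summable fun j : ℕ => ((j : ℝ) + 1) ^ (2 * s - 2 * κ) := by
    simpa using (summable_nat_add_iff 1).2
      (Real.summable_nat_rpow (p := 2 * s - 2 * κ).2 (by linarith))
  refine Summable.of_nonneg_of_le (fun j => mul_nonneg (weight_pos s j).le (sq_nonneg _))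
    (fun j => ?_) (hzeta.mul_left (Mp ^ 2))
  have hj : (0 : ℝ) < (j : ℝ) + 1 := by positivity
  have hle : lam j ≤ Mp * ((j : ℝ) + 1) ^ (-κ) := by
    rw [Real.rpow_neg hj.le, ← div_eq_mul_inv, le_div_iff₀ (by positivity), mul_comm]
    exact (hb j).2
  calc weight s j * lam j ^ 2 ≤ weight s j * (Mp * ((j : ℝ) + 1) ^ (-κ)) ^ 2 :=
        mul_le_mul_of_nonneg_left (pow_le_pow_left₀ (hpos j).le hle 2) (weight_pos s j).le
    _ = Mp ^ 2 * (((j : ℝ) + 1) ^ (2 * s) * (((j : ℝ) + 1) ^ (-κ) * ((j : ℝ) + 1) ^ (-κ))) := by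
        rw [weight]; ring
    _ = Mp ^ 2 * ((j : ℝ) + 1) ^ (2 * s - 2 * κ) := by
        rw [← Real.rpow_add hj, ← Real.rpow_add hj]; ring_nf

variable {s : ℝ} {lam : ℕ → ℝ} {N : ℕ}

/-- The weights of the norm of order `s` on `X^N` in the normalised coordinates
`⟨x, φ_j⟩ / lam j`, in which `π₀` becomes a standard Gaussian measure. -/
def finWeight (s : ℝ) (lam : ℕ → ℝ) (N : ℕ) (j : Fin N) : ℝ := weight s j * lam j ^ 2

lemma finWeight_nonneg (s : ℝ) (lam : ℕ → ℝ) (N : ℕ) (j : Fin N) : 0 ≤ finWeight s lam N j :=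
  mul_nonneg (weight_pos s j).le (sq_nonneg _)

lemma sum_finWeight_le (hsum : Summable fun j => weight s j * lam j ^ 2) (N : ℕ) :
    ∑ j, finWeight s lam N j ≤ ∑' j, weight s j * lam j ^ 2 := by
  unfold finWeight
  rw [Fin.sum_univ_eq_sum_range fun j => weight s j * lam j ^ 2]
  exact hsum.sum_le_tsum _ fun j _ => mul_nonneg (weight_pos s j).le (sq_nonneg _)

/-- The element `∑_{j < N} lam_j X_j φ_j` of `H^s` with normalised coordinates `X`. -/
def embed (s : ℝ) (lam : ℕ → ℝ) (N : ℕ) : (Fin N → ℝ) →L[ℝ] SobolevSpace s :=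
  ∑ j : Fin N, (lam j • ContinuousLinearMap.proj j : (Fin N → ℝ) →L[ℝ] ℝ).smulRight (basisVec s j)

lemma embed_apply (X : Fin N → ℝ) :
    embed s lam N X = ∑ j : Fin N, (lam j * X j) • basisVec s j := by
  simp [embed]

lemma SobolevSpace.coord_basisVec (s : ℝ) (j k : ℕ) :
    (basisVec s j).coord k = if k = j then 1 else 0 := by
  simp [basisVec, Pi.single_apply]

lemma SobolevSpace.coord_sub {r : ℝ} (x y : SobolevSpace r) (j : ℕ) :
    (x - y).coord j = x.coord j - y.coord j := rfl

lemma SobolevSpace.coord_grad (f : SobolevSpace s → ℝ) (x : SobolevSpace s) (j : ℕ) :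
    (grad f x).coord j = fderiv ℝ f x (basisVec s j) := rfl

lemma coord_embed (X : Fin N → ℝ) (k : ℕ) :
    (embed s lam N X).coord k = if h : k < N then lam k * X ⟨k, h⟩ else 0 := by
  rw [embed_apply, coord_sum]
  simp only [coord_smul, coord_basisVec, mul_ite, mul_one, mul_zero]
  split_ifs with h
  · rw [Finset.sum_eq_single ⟨k, h⟩ (fun j _ hj => if_neg fun e => hj (Fin.ext e.symm)) (by simp),
      if_pos rfl]
  · exact Finset.sum_eq_zero fun j _ => if_neg fun e : k = j => h (e ▸ j.2)

lemma norm_embed_sq (X : Fin N → ℝ) : ‖embed s lam N X‖ ^ 2 = wsq (finWeight s lam N) X := by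
  rw [norm_sq_eq, tsum_eq_sum (s := Finset.range N), Finset.sum_range]
  · refine Finset.sum_congr rfl fun j _ => ?_
    rw [coord_embed, dif_pos j.2, finWeight]; ring
  · intro j hj
    rw [coord_embed, dif_neg (by simpa using hj)]; simp

lemma sum_mul_coord_sq_le (g : SobolevSpace (-s)) (u : Fin N → ℝ) :
    (∑ j : Fin N, lam j * u j * g.coord j) ^ 2 ≤ ‖g‖ ^ 2 * wsq (finWeight s lam N) u := by
  have hcs : (∑ j : Fin N, lam j * u j * g.coord j) ^ 2 ≤
      (∑ j : Fin N, weight (-s) j * g.coord j ^ 2) * wsq (finWeight s lam N) u := by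
    refine Finset.sum_sq_le_sum_mul_sum_of_sq_le_mul _
      (fun j _ => mul_nonneg (weight_pos _ j).le (sq_nonneg _))
      (fun j _ => mul_nonneg (finWeight_nonneg _ _ _ _) (sq_nonneg _)) fun j _ => le_of_eq ?_
    rw [weight_neg, finWeight]
    have := (weight_pos s j).ne'
    field_simp
  refine hcs.trans (mul_le_mul_of_nonneg_right ?_ (wsq_nonneg (finWeight_nonneg _ _ _) _))
  rw [norm_sq_eq, Fin.sum_univ_eq_sum_range fun j => weight (-s) j * g.coord j ^ 2]
  exact g.summable.sum_le_tsum _ fun j _ => mul_nonneg (weight_pos _ j).le (sq_nonneg _)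

/-- The potential `Ψ` restricted to `X^N`, as a function of the normalised coordinates. -/
def coordPotential (Ψ : SobolevSpace s → ℝ) (lam : ℕ → ℝ) (N : ℕ) (X : Fin N → ℝ) : ℝ :=
  Ψ (embed s lam N X)

lemma fderiv_coordPotential {Ψ : SobolevSpace s → ℝ} (hd : Differentiable ℝ Ψ)
    (X u : Fin N → ℝ) :
    fderiv ℝ (coordPotential Ψ lam N) X u =
      ∑ j : Fin N, lam j * u j * (grad Ψ (embed s lam N X)).coord j := by
  have hcomp : coordPotential Ψ lam N = Ψ ∘ embed s lam N := rfl
  rw [hcomp, fderiv_comp _ (hd _) (embed s lam N).differentiableAt, ContinuousLinearMap.fderiv,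
    ContinuousLinearMap.comp_apply, embed_apply u]
  simp only [map_sum, map_smul, smul_eq_mul, coord_grad]

lemma PotentialBounds.exists_potentialControl {Ψ : SobolevSpace s → ℝ} (hΨ : PotentialBounds Ψ)
    (hsum : Summable fun j => weight s j * lam j ^ 2) :
    ∃ B, ∀ N, PotentialControl (finWeight s lam N) (coordPotential Ψ lam N) B
      (∑' j, weight s j * lam j ^ 2) := by
  obtain ⟨M₁, M₂, M₃, M₄, hM⟩ := hΨ.bounds
  have hlip (p q : SobolevSpace s) : ‖grad Ψ p - grad Ψ q‖ ≤ M₄ * ‖p - q‖ :=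
    Convex.norm_image_sub_le_of_norm_fderiv_le (𝕜 := ℝ) (s := Set.univ)
      (fun x _ => hΨ.differentiable_grad x) (fun x _ => (hM x).2.2.2) convex_univ
      (Set.mem_univ _) (Set.mem_univ _)
  refine ⟨2 * M₃ ^ 2 + M₄ ^ 2, fun N => ?_⟩
  have hw := wsq_nonneg (finWeight_nonneg s lam N)
  refine
  { weight_nonneg := finWeight_nonneg s lam N
    sum_le := sum_finWeight_le hsum N
    const_nonneg := by positivity
    differentiable := hΨ.differentiable.comp (embed s lam N).differentiable
    fderiv_sq_le := fun X u => ?_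
    fderiv_sub_sq_le := fun X Y u => ?_ }
  · have hgrad : ‖grad Ψ (embed s lam N X)‖ ^ 2 ≤
        (2 * M₃ ^ 2 + M₄ ^ 2) * (1 + wsq (finWeight s lam N) X) := by
      rw [← norm_embed_sq]
      have hsq := pow_le_pow_left₀ (norm_nonneg _) (hM (embed s lam N X)).2.2.1 2
      nlinarith [mul_nonneg (sq_nonneg M₃) (sq_nonneg (1 - ‖embed s lam N X‖)),
        mul_nonneg (sq_nonneg M₄) (sq_nonneg ‖embed s lam N X‖), sq_nonneg M₄]
    rw [fderiv_coordPotential hΨ.differentiable]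
    exact (sum_mul_coord_sq_le _ _).trans (mul_le_mul_of_nonneg_right hgrad (hw u))
  · have hgrad : ‖grad Ψ (embed s lam N X) - grad Ψ (embed s lam N Y)‖ ^ 2 ≤
        (2 * M₃ ^ 2 + M₄ ^ 2) * wsq (finWeight s lam N) (X - Y) := by
      rw [← norm_embed_sq, map_sub]
      have hsq := pow_le_pow_left₀ (norm_nonneg _) (hlip (embed s lam N X) (embed s lam N Y)) 2
      nlinarith [mul_nonneg (sq_nonneg M₃) (sq_nonneg ‖embed s lam N X - embed s lam N Y‖)]
    rw [fderiv_coordPotential hΨ.differentiable, fderiv_coordPotential hΨ.differentiable,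
      ← Finset.sum_sub_distrib]
    simp only [← mul_sub, ← coord_sub]
    exact (sum_mul_coord_sq_le _ _).trans (mul_le_mul_of_nonneg_right hgrad (hw u))

variable {H : Type*} [NormedAddCommGroup H] [InnerProductSpace ℝ H]

/-! ### Normalised coordinates on the Hilbert space -/

/-- The first `N` coordinates of a vector of `H`. -/
def hcoord (φ : HilbertBasis ℕ ℝ H) (N : ℕ) (x : H) (j : Fin N) : ℝ := inner ℝ (φ j) x

/-- The first `N` coordinates of `C^{-1/2} x`, in which `π₀` becomes a standard Gaussian
measure. -/
def ncoord (φ : HilbertBasis ℕ ℝ H) (lam : ℕ → ℝ) (N : ℕ) (x : H) (j : Fin N) : ℝ :=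
  inner ℝ (φ j) x / lam j

lemma continuous_hcoord (φ : HilbertBasis ℕ ℝ H) (N : ℕ) : Continuous (hcoord φ N) := by
  unfold hcoord; fun_prop

lemma continuous_ncoord (φ : HilbertBasis ℕ ℝ H) (lam : ℕ → ℝ) (N : ℕ) :
    Continuous (ncoord φ lam N) := by
  unfold ncoord; fun_prop

lemma inner_basis (φ : HilbertBasis ℕ ℝ H) (i j : ℕ) :
    inner ℝ (φ i) (φ j) = if i = j then (1 : ℝ) else 0 :=
  orthonormal_iff_ite.1 φ.orthonormal i j

lemma hcoord_sum (φ : HilbertBasis ℕ ℝ H) (z : Fin N → ℝ) :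
    hcoord φ N (∑ i : Fin N, z i • φ i) = z := by
  ext j
  simp only [hcoord, inner_sum, inner_smul_right, inner_basis, mul_ite, mul_one, mul_zero,
    Fin.val_inj, Finset.sum_ite_eq, Finset.mem_univ, if_true]

lemma diagN_apply (φ : HilbertBasis ℕ ℝ H) (d : ℕ → ℝ) (N : ℕ) (x : H) :
    diagN φ d N x = ∑ j ∈ Finset.range N, (d j * inner ℝ (φ j) x) • φ j := by
  simp [diagN, mul_smul]

lemma inner_diagN (φ : HilbertBasis ℕ ℝ H) (d : ℕ → ℝ) (N : ℕ) (i : ℕ) (x : H) :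
    inner ℝ (φ i) (diagN φ d N x) = if i < N then d i * inner ℝ (φ i) x else 0 := by
  simp only [diagN_apply, inner_sum, inner_smul_right, inner_basis, mul_ite, mul_one, mul_zero,
    Finset.sum_ite_eq, Finset.mem_range]

lemma norm_diagN_sq (φ : HilbertBasis ℕ ℝ H) (d : ℕ → ℝ) (N : ℕ) (x : H) :
    ‖diagN φ d N x‖ ^ 2 = ∑ j : Fin N, (d j * inner ℝ (φ j) x) ^ 2 := by
  rw [diagN_apply, ← real_inner_self_eq_norm_sq, φ.orthonormal.inner_sum, Finset.sum_range]
  simp [sq]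

lemma proj_toSobolev (φ : HilbertBasis ℕ ℝ H) (s : ℝ) (N : ℕ) (x : H) :
    proj N (toSobolev φ s N x) = toSobolev φ s N x := by
  ext j
  simp only [proj, toSobolev, ofFinite, coord_mk]
  split_ifs <;> rfl

lemma toSobolev_eq_embed (hlam : ∀ j, lam j ≠ 0) (φ : HilbertBasis ℕ ℝ H) (x : H) :
    toSobolev φ s N x = embed s lam N (ncoord φ lam N x) := by
  ext j
  simp only [coord_embed, toSobolev, ofFinite, coord_mk, ncoord, mul_div_cancel₀ _ (hlam j),
    dite_eq_ite]

lemma psiN_toSobolev (hlam : ∀ j, lam j ≠ 0) (φ : HilbertBasis ℕ ℝ H) (Ψ : SobolevSpace s → ℝ)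
    (x : H) : psiN Ψ N (toSobolev φ s N x) = coordPotential Ψ lam N (ncoord φ lam N x) := by
  rw [psiN, proj_toSobolev, toSobolev_eq_embed hlam, coordPotential]

lemma ncoord_proposal (hlam : ∀ j, lam j ≠ 0) (φ : HilbertBasis ℕ ℝ H) (ℓ : ℝ) (x ξ : H) :
    ncoord φ lam N (proposal φ lam ℓ N x ξ) =
      ncoord φ lam N x + stepSize ℓ N • hcoord φ N ξ := by
  ext j
  simp only [ncoord, proposal, inner_add_right, inner_smul_right, inner_diagN, j.2, if_true,
    Pi.add_apply, Pi.smul_apply, smul_eq_mul, hcoord, stepSize]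
  have := hlam j
  field_simp

lemma logRatio_eq_moveRatio (hlam : ∀ j, lam j ≠ 0) (φ : HilbertBasis ℕ ℝ H)
    (Ψ : SobolevSpace s → ℝ) (ℓ : ℝ) (x ξ : H) :
    logRatio φ lam Ψ ℓ N x ξ =
      moveRatio (coordPotential Ψ lam N) ℓ (ncoord φ lam N x) (hcoord φ N ξ) := by
  have hnorm (y : H) :
      ‖diagN φ (fun j => (lam j)⁻¹) N y‖ ^ 2 = ∑ j, ncoord φ lam N y j ^ 2 := by
    simp only [norm_diagN_sq, ncoord, div_eq_inv_mul]
  simp only [logRatio, hnorm, psiN_toSobolev hlam, ncoord_proposal hlam, moveRatio, energy,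
    Fintype.card_fin]
  ring

lemma acceptProb_eq_acc (hlam : ∀ j, lam j ≠ 0) (φ : HilbertBasis ℕ ℝ H)
    (Ψ : SobolevSpace s → ℝ) (ℓ : ℝ) (x ξ : H) :
    acceptProb φ lam Ψ ℓ N x ξ =
      acc (moveRatio (coordPotential Ψ lam N) ℓ (ncoord φ lam N x) (hcoord φ N ξ)) := by
  rw [acceptProb, logRatio_eq_moveRatio hlam, acc]

lemma CN_eq_diagN (φ : HilbertBasis ℕ ℝ H) {C : H →L[ℝ] H}
    (hC : ∀ j, C (φ j) = (lam j) ^ 2 • φ j) (N : ℕ) :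
    CN φ C N = diagN φ (fun j => lam j ^ 2) N := by
  have hCP (x : H) : C (PN φ N x) = diagN φ (fun j => lam j ^ 2) N x := by
    simp only [PN, diagN_apply, map_sum, map_smul, hC, one_mul, smul_smul, mul_comm]
  ext x
  simp only [CN, ContinuousLinearMap.comp_apply, hCP]
  rw [PN, diagN_apply, diagN_apply φ (fun j => lam j ^ 2)]
  refine Finset.sum_congr rfl fun j hj => ?_
  rw [← diagN_apply, inner_diagN, if_pos (Finset.mem_range.1 hj), one_mul]

/-- The projection `P^N` of `H^r` as a bounded operator. -/
def projCLM (r : ℝ) (N : ℕ) : SobolevSpace r →L[ℝ] SobolevSpace r :=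
  LinearMap.mkContinuous
    { toFun := proj N
      map_add' := fun x y => by
        ext j
        simp only [proj, ofFinite, coord_mk, coord_add]
        split_ifs <;> simp
      map_smul' := fun c x => by
        ext j
        simp only [proj, ofFinite, coord_mk, coord_smul, RingHom.id_apply]
        split_ifs <;> simp }
    1 fun x => by
      rw [one_mul]
      refine le_of_sq_le_sq ?_ (norm_nonneg _)
      rw [norm_sq_eq, norm_sq_eq]
      refine Summable.tsum_le_tsum (fun j => ?_) (SobolevSpace.summable _) x.summable
      refine mul_le_mul_of_nonneg_left ?_ (weight_pos r j).le
      simp only [LinearMap.coe_mk, AddHom.coe_mk, proj, ofFinite, coord_mk]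
      split_ifs
      · exact le_rfl
      · simpa using sq_nonneg _

lemma projCLM_apply (r : ℝ) (N : ℕ) (x : SobolevSpace r) : projCLM r N x = proj N x := rfl

lemma proj_basisVec {j : ℕ} (hj : j < N) : proj N (basisVec s j) = basisVec s j := by
  ext k
  simp only [proj, ofFinite, coord_mk, coord_basisVec]
  split_ifs <;> first | rfl | omega

lemma coord_grad_psiN (φ : HilbertBasis ℕ ℝ H) {Ψ : SobolevSpace s → ℝ}
    (hd : Differentiable ℝ Ψ) (x : H) {j : ℕ} (hj : j < N) :
    (grad (psiN Ψ N) (toSobolev φ s N x)).coord j = (grad Ψ (toSobolev φ s N x)).coord j := by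
  have hcomp : psiN Ψ N = Ψ ∘ projCLM s N := rfl
  rw [coord_grad, coord_grad, hcomp, fderiv_comp _ (hd _) (projCLM s N).differentiableAt,
    ContinuousLinearMap.fderiv, ContinuousLinearMap.comp_apply, projCLM_apply, projCLM_apply,
    proj_basisVec hj, proj_toSobolev]

lemma inner_gradPsiN (φ : HilbertBasis ℕ ℝ H) {Ψ : SobolevSpace s → ℝ}
    (hd : Differentiable ℝ Ψ) (x : H) (i : Fin N) :
    inner ℝ (φ i) (gradPsiN φ Ψ N x) = (grad Ψ (toSobolev φ s N x)).coord i := by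
  simp only [gradPsiN, inner_sum, inner_smul_right, inner_basis, mul_ite, mul_one, mul_zero,
    Finset.sum_ite_eq, Finset.mem_range, i.2, if_true]
  exact coord_grad_psiN φ hd x i.2

lemma score_coordPotential {Ψ : SobolevSpace s → ℝ} (hd : Differentiable ℝ Ψ) (X : Fin N → ℝ)
    (i : Fin N) :
    score (coordPotential Ψ lam N) X i = X i + lam i * (grad Ψ (embed s lam N X)).coord i := by
  rw [score, fderiv_coordPotential hd, Finset.sum_eq_single i
    (fun j _ hj => by simp [Pi.single_eq_of_ne hj]) (by simp), Pi.single_eq_same, mul_one]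

lemma inner_drift (hlam : ∀ j, lam j ≠ 0) (φ : HilbertBasis ℕ ℝ H) {C : H →L[ℝ] H}
    (hC : ∀ j, C (φ j) = (lam j) ^ 2 • φ j) {Ψ : SobolevSpace s → ℝ} (hd : Differentiable ℝ Ψ)
    (x : H) (i : Fin N) :
    inner ℝ (φ i) (PN φ N x + CN φ C N (gradPsiN φ Ψ N x)) =
      lam i * score (coordPotential Ψ lam N) (ncoord φ lam N x) i := by
  rw [CN_eq_diagN φ hC, inner_add_right, PN, inner_diagN, inner_diagN, if_pos i.2, if_pos i.2,
    inner_gradPsiN φ hd, score_coordPotential hd, ncoord, toSobolev_eq_embed hlam, mul_add,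
    mul_div_cancel₀ _ (hlam i)]
  ring

lemma inner_drift_of_le (φ : HilbertBasis ℕ ℝ H) {C : H →L[ℝ] H}
    (hC : ∀ j, C (φ j) = (lam j) ^ 2 • φ j) (x y : H) {i : ℕ} (hi : N ≤ i) :
    inner ℝ (φ i) (PN φ N x + CN φ C N y) = 0 := by
  rw [CN_eq_diagN φ hC, inner_add_right, PN, inner_diagN, inner_diagN, if_neg hi.not_gt,
    if_neg hi.not_gt, add_zero]

lemma sobInner_basis (φ : HilbertBasis ℕ ℝ H) (s : ℝ) (i : ℕ) (v : H) :
    sobInner φ s (φ i) v = weight s i * inner ℝ (φ i) v := by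
  rw [sobInner, tsum_eq_single i]
  · rw [inner_basis, if_pos rfl, one_mul]
  · intro j hj
    rw [inner_basis, if_neg hj, zero_mul, mul_zero]

/-! ### The laws of the noise and of the initial state -/

section Laws

lemma tilted_le_smul {α : Type*} [MeasurableSpace α] {μ : Measure α} {f : α → ℝ} {M c : ℝ}
    (hc : 0 < c) (hf : ∀ x, f x ≤ M) (hint : c ≤ ∫ x, Real.exp (f x) ∂μ) :
    μ.tilted f ≤ ENNReal.ofReal (Real.exp M / c) • μ := by
  rw [← withDensity_const]
  refine withDensity_mono (ae_of_all _ fun x => ENNReal.ofReal_le_ofReal ?_)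
  gcongr
  exact hf x

lemma exp_neg_integral_le {α : Type*} [MeasurableSpace α] {μ : Measure α} [IsProbabilityMeasure μ]
    {f g : α → ℝ} (hf : Integrable (fun x => Real.exp (-f x)) μ) (hg : Integrable g μ)
    (hfg : ∀ x, f x ≤ g x) : Real.exp (-∫ x, g x ∂μ) ≤ ∫ x, Real.exp (-f x) ∂μ := by
  have hexp (x : α) : Real.exp (-g x) ≤ Real.exp (-f x) := Real.exp_le_exp.2 (neg_le_neg (hfg x))
  have hgexp : Integrable (fun x => Real.exp (-g x)) μ :=
    hf.mono' (Real.continuous_exp.comp_aestronglyMeasurable hg.1.neg)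
      (ae_of_all _ fun x => by simpa using hfg x)
  calc Real.exp (-∫ x, g x ∂μ) = Real.exp (∫ x, -g x ∂μ) := by rw [integral_neg]
    _ ≤ ∫ x, Real.exp (-g x) ∂μ := convexOn_exp.map_integral_le Real.continuous_exp.continuousOn
        isClosed_univ (ae_of_all _ fun _ => Set.mem_univ _) hg.neg hgexp
    _ ≤ ∫ x, Real.exp (-f x) ∂μ := integral_mono hgexp hf hexp

variable [MeasurableSpace H] [BorelSpace H]

lemma map_hcoord_noiseLaw (φ : HilbertBasis ℕ ℝ H) (N : ℕ) :
    (noiseLaw φ N).map (hcoord φ N) = stdPi (Fin N) := by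
  have hsum : Measurable fun z : Fin N → ℝ => ∑ i : Fin N, z i • φ i :=
    Continuous.measurable (by fun_prop)
  rw [noiseLaw, Measure.map_map (continuous_hcoord φ N).measurable hsum,
    show (hcoord φ N ∘ fun z : Fin N → ℝ => ∑ i : Fin N, z i • φ i) = id from
      funext fun z => hcoord_sum φ z, Measure.map_id]

variable [CompleteSpace H] {C : H →L[ℝ] H} {π₀ : Measure H}

lemma IsCenteredGaussian.integral_ncoord [SecondCountableTopology H]
    (hπ₀ : IsCenteredGaussian π₀ C) (φ : HilbertBasis ℕ ℝ H)
    (lam : ℕ → ℝ) (j : Fin N) : ∫ x, ncoord φ lam N x j ∂π₀ = 0 := by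
  have := hπ₀.gaussian
  have hdual := IsGaussian.integral_dual (μ := π₀) (innerSL ℝ (φ j))
  rw [hπ₀.mean_zero, map_zero] at hdual
  simp only [innerSL_apply_apply] at hdual
  simp only [ncoord, integral_div, hdual, zero_div]

lemma IsCenteredGaussian.covariance_ncoord [SecondCountableTopology H]
    (hπ₀ : IsCenteredGaussian π₀ C) (hlam : ∀ j, lam j ≠ 0)
    (φ : HilbertBasis ℕ ℝ H) (hC : ∀ j, C (φ j) = (lam j) ^ 2 • φ j) (i j : Fin N) :
    cov[fun x => ncoord φ lam N x i, fun x => ncoord φ lam N x j; π₀] = if i = j then 1 else 0 := by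
  have := hπ₀.gaussian
  have hcov := covarianceBilin_apply_eq_cov (μ := π₀) IsGaussian.memLp_two_id (φ i) (φ j)
  rw [hπ₀.covariance, hC, inner_smul_left, inner_basis] at hcov
  simp only [ncoord, div_eq_inv_mul]
  rw [covariance_const_mul_left, covariance_const_mul_right, ← hcov]
  simp only [conj_trivial, Fin.val_inj]
  split_ifs with hij
  · subst hij
    have := hlam i
    field_simp
  · simp

lemma IsCenteredGaussian.map_ncoord [SecondCountableTopology H]
    (hπ₀ : IsCenteredGaussian π₀ C) (hlam : ∀ j, lam j ≠ 0)
    (φ : HilbertBasis ℕ ℝ H) (hC : ∀ j, C (φ j) = (lam j) ^ 2 • φ j) (N : ℕ) :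
    π₀.map (ncoord φ lam N) = stdPi (Fin N) := by
  have := hπ₀.gaussian
  have hcov := hπ₀.covariance_ncoord (N := N) hlam φ hC
  have hmeas (j : Fin N) : Measurable fun x => ncoord φ lam N x j :=
    ((continuous_apply j).comp (continuous_ncoord φ lam N)).measurable
  have hlaw : HasGaussianLaw (fun x : H => fun j => ncoord φ lam N x j) π₀ := by
    simpa [ncoord, div_eq_inv_mul] using (IsGaussian.hasGaussianLaw_id (μ := π₀)).map_fun
      (ContinuousLinearMap.pi fun j : Fin N => (lam j)⁻¹ • innerSL ℝ (φ j))
  have hindep : iIndepFun (fun (j : Fin N) x => ncoord φ lam N x j) π₀ :=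
    hlaw.iIndepFun_of_covariance_eq_zero fun i j hij => by rw [hcov, if_neg hij]
  refine ((iIndepFun_iff_map_fun_eq_pi_map fun j => (hmeas j).aemeasurable).1 hindep).trans ?_
  congr 1
  ext1 j
  rw [(hlaw.eval j).map_eq_gaussianReal, hπ₀.integral_ncoord,
    ← covariance_self (hmeas j).aemeasurable, hcov, if_pos rfl, Real.toNNReal_one]

/-- By Jensen's inequality the normalising constants of `π^N` are bounded below uniformly in `N`. -/
lemma IsCenteredGaussian.exists_targetN_le [SecondCountableTopology H]
    (hπ₀ : IsCenteredGaussian π₀ C) (hlam : ∀ j, lam j ≠ 0)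
    (φ : HilbertBasis ℕ ℝ H) (hC : ∀ j, C (φ j) = (lam j) ^ 2 • φ j)
    {Ψ : SobolevSpace s → ℝ} (hΨ : PotentialBounds Ψ)
    (hsum : Summable fun j => weight s j * lam j ^ 2) :
    ∃ K, 0 ≤ K ∧ ∀ N, targetN φ Ψ π₀ N ≤ ENNReal.ofReal K • π₀ := by
  have := hπ₀.gaussian
  obtain ⟨M₁, M₂, M₃, M₄, hM⟩ := hΨ.bounds
  set S := ∑' j, weight s j * lam j ^ 2
  refine ⟨Real.exp (-M₁) / Real.exp (-(|M₂| * (1 + S))), by positivity, fun N => ?_⟩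
  set V := coordPotential Ψ lam N
  have hmeas := (continuous_ncoord φ lam N).measurable
  have hV : Continuous V := hΨ.differentiable.continuous.comp (embed s lam N).continuous
  have hgrowth (X : Fin N → ℝ) : V X ≤ |M₂| * (1 + wsq (finWeight s lam N) X) := by
    rw [← norm_embed_sq]
    exact (hM _).2.1.trans (mul_le_mul_of_nonneg_right (le_abs_self _) (by positivity))
  have hgint := ((integrable_const 1).add (integrable_wsq (finWeight s lam N))).const_mul |M₂|
  have hexp : Integrable (fun X => Real.exp (-V X)) (stdPi (Fin N)) :=
    Integrable.of_bound (by fun_prop) (Real.exp (-M₁)) (ae_of_all _ fun X => by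
      rw [Real.norm_of_nonneg (Real.exp_nonneg _)]
      exact Real.exp_le_exp.2 (neg_le_neg (hM _).1))
  rw [targetN]
  simp only [psiN_toSobolev hlam]
  refine tilted_le_smul (Real.exp_pos _) (fun x => neg_le_neg (hM _).1) ?_
  calc Real.exp (-(|M₂| * (1 + S)))
      ≤ Real.exp (-∫ X, |M₂| * (1 + wsq (finWeight s lam N) X) ∂stdPi (Fin N)) := by
        rw [integral_const_mul, integral_add (integrable_const 1) (integrable_wsq _),
          integral_wsq, integral_const, probReal_univ, one_smul]
        have := sum_finWeight_le hsum N
        gcongr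
    _ ≤ ∫ X, Real.exp (-V X) ∂stdPi (Fin N) := exp_neg_integral_le hexp hgint hgrowth
    _ = ∫ x, Real.exp (-V (ncoord φ lam N x)) ∂π₀ := by
        rw [← hπ₀.map_ncoord hlam φ hC N, integral_map hmeas.aemeasurable (by fun_prop)]

end Laws

/-! ### One step of the chain -/

section Chain

lemma condExp_comp_ae_eq_integral_of_indepFun {Ω α β : Type*} [MeasurableSpace Ω]
    [MeasurableSpace α] [MeasurableSpace β] [StandardBorelSpace β] [Nonempty β] {P : Measure Ω}
    [IsProbabilityMeasure P] {X : Ω → α} {Z : Ω → β} {f : α × β → ℝ} (hX : Measurable X)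
    (hZ : Measurable Z) (hindep : IndepFun X Z P) (hf : StronglyMeasurable f)
    (hint : Integrable (fun ω => f (X ω, Z ω)) P) :
    P[fun ω => f (X ω, Z ω) | MeasurableSpace.comap X inferInstance] =ᵐ[P]
      fun ω => ∫ z, f (X ω, z) ∂P.map Z := by
  have hlaw := (indepFun_iff_map_prod_eq_prod_map_map hX.aemeasurable hZ.aemeasurable).1 hindep
  have := Measure.isProbabilityMeasure_map hZ.aemeasurable (μ := P)
  rw [← Measure.compProd_const] at hlaw
  filter_upwards [condExp_prod_ae_eq_integral_condDistrib hX hZ.aemeasurable hf hint,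
    ae_of_ae_map hX.aemeasurable
      (condDistrib_ae_eq_of_measure_eq_compProd X hZ.aemeasurable hlaw)] with ω hω hdistrib
  rw [hω, hdistrib, Kernel.const_apply]

lemma measurable_acc_moveRatio {ι : Type*} [Fintype ι] {V : (ι → ℝ) → ℝ} (hV : Continuous V)
    (ℓ : ℝ) : Measurable fun q : (ι → ℝ) × (ι → ℝ) => acc (moveRatio V ℓ q.1 q.2) := by
  have hratio : Continuous fun q : (ι → ℝ) × (ι → ℝ) => moveRatio V ℓ q.1 q.2 := by
    unfold moveRatio energy
    fun_prop
  exact (continuous_acc.comp hratio).measurable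

lemma continuous_rankOne_self : Continuous fun v : H => InnerProductSpace.rankOne ℝ v v :=
  (InnerProductSpace.rankOne (E := H) (F := H) ℝ).continuous₂.comp
    (continuous_id.prodMk continuous_id)

variable [MeasurableSpace H] {π₀ : Measure H}

namespace IsRWMChain

variable {Ω : Type*} [MeasurableSpace Ω] {P : Measure Ω} {φ : HilbertBasis ℕ ℝ H}
  {Ψ : SobolevSpace s → ℝ} {ℓ : ℝ} {x ξ : ℕ → Ω → H} {γ : ℕ → Ω → ℝ}
  (h : IsRWMChain P φ lam Ψ π₀ ℓ N x ξ γ)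
include h

lemma history_zero : history x ξ γ 0 = MeasurableSpace.comap (x 0) inferInstance := by
  simp [history, h.noise_zero, h.accept_zero, Pi.zero_def, MeasurableSpace.comap_const]

lemma history_zero_le : history x ξ γ 0 ≤ ‹MeasurableSpace Ω› := by
  rw [h.history_zero]
  exact (h.measurable_x 0).comap_le

lemma abs_accept_le_one (ω : Ω) : |γ 1 ω| ≤ 1 := by
  obtain hγ | hγ : γ 1 ω = 0 ∨ γ 1 ω = 1 := h.accept_values 0 ω <;> simp [hγ]

lemma increment_eq (ω : Ω) :
    x 1 ω - x 0 ω = γ 1 ω • (stepSize ℓ N • diagN φ lam N (ξ 1 ω)) := by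
  have hstep := h.step 0 ω
  rw [zero_add, proposal, ← stepSize] at hstep
  rw [hstep]
  module

lemma inner_increment (i : Fin N) (ω : Ω) :
    inner ℝ (φ i) (x 1 ω - x 0 ω) =
      γ 1 ω * (stepSize ℓ N * lam i * hcoord φ N (ξ 1 ω) i) := by
  simp only [h.increment_eq, inner_smul_right, inner_diagN, i.2, if_true, hcoord, mul_assoc]

lemma inner_increment_of_le {i : ℕ} (hi : N ≤ i) (ω : Ω) :
    inner ℝ (φ i) (x 1 ω - x 0 ω) = (0 : ℝ) := by
  simp only [h.increment_eq, inner_smul_right, inner_diagN, hi.not_gt, if_false, mul_zero]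

lemma inner_increment_mul (i j : Fin N) (ω : Ω) :
    inner ℝ (φ i) (x 1 ω - x 0 ω) * inner ℝ (φ j) (x 1 ω - x 0 ω) =
      γ 1 ω * (2 * ℓ ^ 2 / N * lam i * lam j *
        (hcoord φ N (ξ 1 ω) i * hcoord φ N (ξ 1 ω) j)) := by
  have hγ : γ 1 ω * γ 1 ω = γ 1 ω := by
    obtain hγ | hγ : γ 1 ω = 0 ∨ γ 1 ω = 1 := h.accept_values 0 ω <;> simp [hγ]
  rw [h.inner_increment, h.inner_increment, ← stepSize_sq]
  linear_combination stepSize ℓ N ^ 2 * lam i * lam j *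
    (hcoord φ N (ξ 1 ω) i * hcoord φ N (ξ 1 ω) j) * hγ

variable [BorelSpace H]

lemma measurable_hcoord_noise : Measurable fun ω => hcoord φ N (ξ 1 ω) :=
  (continuous_hcoord φ N).measurable.comp (h.measurable_noise 1)

lemma map_hcoord_noise : P.map (fun ω => hcoord φ N (ξ 1 ω)) = stdPi (Fin N) := by
  rw [← map_hcoord_noiseLaw φ N, ← h.law_noise 0,
    Measure.map_map (continuous_hcoord φ N).measurable (h.measurable_noise 1)]
  rfl

lemma indepFun_init_hcoord_noise : IndepFun (x 0) (fun ω => hcoord φ N (ξ 1 ω)) P := by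
  have hindep := (h.indep_noise 0).symm
  rw [h.history_zero] at hindep
  exact ((IndepFun_iff_Indep _ _ _).2 hindep).comp measurable_id
    (continuous_hcoord φ N).measurable

lemma integrable_comp_noise {p : (Fin N → ℝ) → ℝ} (hp : Integrable p (stdPi (Fin N))) :
    Integrable (fun ω => p (hcoord φ N (ξ 1 ω))) P := by
  rw [← h.map_hcoord_noise] at hp
  exact hp.comp_measurable h.measurable_hcoord_noise

lemma memLp_increment : MemLp (fun ω => x 1 ω - x 0 ω) 2 P := by
  have hcoordLp (j : Fin N) : MemLp (fun ω => hcoord φ N (ξ 1 ω) j) 2 P :=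
    (h.map_hcoord_noise ▸ memLp_eval_stdPi j).comp_of_map h.measurable_hcoord_noise.aemeasurable
  have hmove : MemLp (fun ω => stepSize ℓ N • diagN φ lam N (ξ 1 ω)) 2 P := by
    simp only [diagN_apply, Finset.sum_range]
    exact (memLp_finsetSum Finset.univ fun (j : Fin N) _ =>
      (ContinuousLinearMap.toSpanSingleton ℝ (φ j)).comp_memLp'
        ((hcoordLp j).const_mul (lam j))).const_smul (stepSize ℓ N)
  simp only [h.increment_eq]
  refine hmove.of_le ((h.measurable_accept 1).aestronglyMeasurable.smul hmove.1)
    (ae_of_all _ fun ω => ?_)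
  rw [norm_smul]
  exact mul_le_of_le_one_left (norm_nonneg _) (h.abs_accept_le_one ω)

lemma integrable_rankOne_increment :
    Integrable (fun ω => InnerProductSpace.rankOne ℝ (x 1 ω - x 0 ω) (x 1 ω - x 0 ω)) P :=
  h.memLp_increment.integrable_norm_pow two_ne_zero |>.mono
    (continuous_rankOne_self.comp_aestronglyMeasurable h.memLp_increment.1)
    (ae_of_all _ fun ω => by rw [InnerProductSpace.norm_rankOne, norm_pow, norm_norm, sq])

variable [IsProbabilityMeasure P]

lemma condExp_accept_mul_of_noise (hlam : ∀ j, lam j ≠ 0) {p : (Fin N → ℝ) → ℝ}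
    (hpm : Measurable p) (hp : Integrable p (stdPi (Fin N))) :
    P[fun ω => γ 1 ω * p (hcoord φ N (ξ 1 ω)) |
        history x ξ γ 0 ⊔ MeasurableSpace.comap (ξ 1) inferInstance] =ᵐ[P] fun ω =>
      acc (moveRatio (coordPotential Ψ lam N) ℓ (ncoord φ lam N (x 0 ω)) (hcoord φ N (ξ 1 ω))) *
        p (hcoord φ N (ξ 1 ω)) := by
  have hγ (p : Ω → ℝ) (hp : Integrable p P) : Integrable (fun ω => γ 1 ω * p ω) P :=
    hp.bdd_mul (h.measurable_accept 1).aestronglyMeasurable (ae_of_all _ h.abs_accept_le_one)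
  have hξ : StronglyMeasurable[history x ξ γ 0 ⊔ MeasurableSpace.comap (ξ 1) inferInstance]
      fun ω => p (hcoord φ N (ξ 1 ω)) :=
    (((hpm.comp (continuous_hcoord φ N).measurable).comp (comap_measurable (ξ 1))).mono
      (le_sup_right (a := history x ξ γ 0)) le_rfl).stronglyMeasurable
  filter_upwards [condExp_mul_of_stronglyMeasurable_right hξ (hγ _ (h.integrable_comp_noise hp))
    (by simpa using hγ _ (integrable_const 1)), h.accept_prob 0] with ω hω hprob
  rw [zero_add] at hprob
  exact hω.trans (by rw [Pi.mul_apply, hprob, acceptProb_eq_acc hlam])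

lemma condExp_accept_mul (hlam : ∀ j, lam j ≠ 0) (hV : Continuous (coordPotential Ψ lam N))
    {p : (Fin N → ℝ) → ℝ} (hpm : Measurable p) (hp : Integrable p (stdPi (Fin N))) :
    P[fun ω => γ 1 ω * p (hcoord φ N (ξ 1 ω)) | history x ξ γ 0] =ᵐ[P] fun ω =>
      ∫ z, acc (moveRatio (coordPotential Ψ lam N) ℓ (ncoord φ lam N (x 0 ω)) z) * p z
        ∂stdPi (Fin N) := by
  set f : H × (Fin N → ℝ) → ℝ := fun q =>
    acc (moveRatio (coordPotential Ψ lam N) ℓ (ncoord φ lam N q.1) q.2) * p q.2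
  have hf : Measurable f :=
    ((measurable_acc_moveRatio hV ℓ).comp (((continuous_ncoord φ lam N).measurable.comp
      measurable_fst).prodMk measurable_snd)).mul (hpm.comp measurable_snd)
  have hint : Integrable (fun ω => f (x 0 ω, hcoord φ N (ξ 1 ω))) P :=
    (h.integrable_comp_noise hp).mono
      (hf.comp ((h.measurable_x 0).prodMk h.measurable_hcoord_noise)).aestronglyMeasurable
      (ae_of_all _ fun ω => by
        rw [norm_mul]
        exact mul_le_of_le_one_left (norm_nonneg _) (abs_acc_le_one _))
  have htower := (condExp_condExp_of_le (f := fun ω => γ 1 ω * p (hcoord φ N (ξ 1 ω)))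
    (μ := P) (le_sup_left (a := history x ξ γ 0) (b := MeasurableSpace.comap (ξ 1) inferInstance))
    (sup_le h.history_zero_le (h.measurable_noise 1).comap_le)).symm
  refine (htower.trans (condExp_congr_ae (h.condExp_accept_mul_of_noise hlam hpm hp))).trans ?_
  rw [h.history_zero, ← h.map_hcoord_noise]
  exact condExp_comp_ae_eq_integral_of_indepFun (h.measurable_x 0) h.measurable_hcoord_noise
    h.indepFun_init_hcoord_noise hf.stronglyMeasurable hint

lemma integrable_increment : Integrable (fun ω => x 1 ω - x 0 ω) P :=
  h.memLp_increment.integrable one_le_two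

lemma clm_condExp_eq_integral {F : Type*} [NormedAddCommGroup F] [NormedSpace ℝ F]
    [CompleteSpace F] (hlam : ∀ j, lam j ≠ 0) (hV : Continuous (coordPotential Ψ lam N))
    {p : (Fin N → ℝ) → ℝ} (hpm : Measurable p) (hp : Integrable p (stdPi (Fin N)))
    {Y : Ω → F} (hY : Integrable Y P) (T : F →L[ℝ] ℝ)
    (hTY : ∀ ω, T (Y ω) = γ 1 ω * p (hcoord φ N (ξ 1 ω))) :
    ∀ᵐ ω ∂P, T (P[Y | history x ξ γ 0] ω) =
      ∫ z, acc (moveRatio (coordPotential Ψ lam N) ℓ (ncoord φ lam N (x 0 ω)) z) * p z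
        ∂stdPi (Fin N) := by
  have hcomp : T ∘ Y = fun ω => γ 1 ω * p (hcoord φ N (ξ 1 ω)) := funext hTY
  filter_upwards [T.comp_condExp_comm hY (m := history x ξ γ 0),
    h.condExp_accept_mul hlam hV hpm hp] with ω hT hω
  rw [← hω, ← hcomp]
  exact hT

variable [CompleteSpace H]

lemma inner_condExp_increment (hlam : ∀ j, lam j ≠ 0)
    (hV : Continuous (coordPotential Ψ lam N)) (i : Fin N) :
    ∀ᵐ ω ∂P, inner ℝ (φ i) (P[fun ω => x 1 ω - x 0 ω | history x ξ γ 0] ω) =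
      stepSize ℓ N * lam i *
        ∫ z, z i * acc (moveRatio (coordPotential Ψ lam N) ℓ (ncoord φ lam N (x 0 ω)) z)
          ∂stdPi (Fin N) := by
  filter_upwards [h.clm_condExp_eq_integral hlam hV
    (p := fun z => stepSize ℓ N * lam i * z i) (by fun_prop)
    (((memLp_eval_stdPi i).integrable one_le_two).const_mul _) h.integrable_increment
    (innerSL ℝ (φ i)) (h.inner_increment i)] with ω hω
  rw [← integral_const_mul]
  exact hω.trans (integral_congr_ae (ae_of_all _ fun z => by ring))

lemma inner_condExp_increment_of_le {i : ℕ} (hi : N ≤ i) :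
    ∀ᵐ ω ∂P, inner ℝ (φ i) (P[fun ω => x 1 ω - x 0 ω | history x ξ γ 0] ω) = (0 : ℝ) := by
  have hzero : (innerSL ℝ (φ i)) ∘ (fun ω => x 1 ω - x 0 ω) = 0 :=
    funext fun ω => h.inner_increment_of_le hi ω
  filter_upwards [(innerSL ℝ (φ i)).comp_condExp_comm h.integrable_increment
    (m := history x ξ γ 0)] with ω hω
  rw [hzero, condExp_zero] at hω
  exact hω

lemma inner_condExp_rankOne_increment (hlam : ∀ j, lam j ≠ 0)
    (hV : Continuous (coordPotential Ψ lam N)) (i j : Fin N) :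
    ∀ᵐ ω ∂P, inner ℝ (φ i) (P[fun ω => InnerProductSpace.rankOne ℝ (x 1 ω - x 0 ω)
        (x 1 ω - x 0 ω) | history x ξ γ 0] ω (φ j)) =
      2 * ℓ ^ 2 / N * lam i * lam j *
        ∫ z, z i * (acc (moveRatio (coordPotential Ψ lam N) ℓ (ncoord φ lam N (x 0 ω)) z) * z j)
          ∂stdPi (Fin N) := by
  filter_upwards [h.clm_condExp_eq_integral hlam hV
    (p := fun z => 2 * ℓ ^ 2 / N * lam i * lam j * (z i * z j)) (by fun_prop)
    (((memLp_eval_stdPi i).integrable_mul (memLp_eval_stdPi j)).const_mul _)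
    h.integrable_rankOne_increment
    (innerSL ℝ (φ i) ∘L ContinuousLinearMap.apply ℝ H (φ j)) fun ω => by
      rw [← h.inner_increment_mul]
      rw [ContinuousLinearMap.comp_apply, ContinuousLinearMap.apply_apply, innerSL_apply_apply,
        InnerProductSpace.rankOne_apply, inner_smul_right, real_inner_comm, mul_comm]] with ω hω
  rw [← integral_const_mul]
  exact hω.trans (integral_congr_ae (ae_of_all _ fun z => by ring))

end IsRWMChain

end Chain

/-! ### The remainders -/

lemma sobNormSq_eq_wsq {φ : HilbertBasis ℕ ℝ H} {v : H} {u : Fin N → ℝ}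
    (hv : ∀ i : Fin N, inner ℝ (φ i) v = lam i * u i)
    (hv_tail : ∀ i, N ≤ i → inner ℝ (φ i) v = (0 : ℝ)) :
    sobNormSq φ s v = ENNReal.ofReal (wsq (finWeight s lam N) u) := by
  rw [sobNormSq, tsum_eq_sum (s := Finset.range N) fun j hj => by
      rw [hv_tail j (not_lt.1 (Finset.mem_range.not.1 hj))]; simp, Finset.sum_range, wsq,
    ENNReal.ofReal_sum_of_nonneg fun j _ =>
      mul_nonneg (finWeight_nonneg s lam N j) (sq_nonneg _)]
  refine Finset.sum_congr rfl fun j _ => ?_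
  rw [hv, finWeight]
  ring_nf

/-- The remainder `r^N` of the drift: the difference between `N E₀(x¹ - x)` and its limiting
expression `-ℓ²β (P^N x + C^N ∇Ψ^N(x))`. -/
def driftRemainder {Ω : Type*} [MeasurableSpace Ω] (P : Measure Ω) [MeasurableSpace H]
    (φ : HilbertBasis ℕ ℝ H) (C : H →L[ℝ] H) (Ψ : SobolevSpace s → ℝ) (ℓ : ℝ) (N : ℕ)
    (x ξ : ℕ → Ω → H) (γ : ℕ → Ω → ℝ) (ω : Ω) : H :=
  (N : ℝ) • (P[fun ω' => x 1 ω' - x 0 ω' | history x ξ γ 0]) ω -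
    -(ℓ ^ 2 * beta ℓ) • (PN φ N (x 0 ω) + CN φ C N (gradPsiN φ Ψ N (x 0 ω)))

/-- The remainder `E^N` of the diffusion: the difference between `N E₀((x¹ - x) ⊗ (x¹ - x))` and
its limiting expression `2ℓ²β C^N`. -/
def covRemainder {Ω : Type*} [MeasurableSpace Ω] (P : Measure Ω) [MeasurableSpace H]
    (φ : HilbertBasis ℕ ℝ H) (C : H →L[ℝ] H) (ℓ : ℝ) (N : ℕ)
    (x ξ : ℕ → Ω → H) (γ : ℕ → Ω → ℝ) (ω : Ω) : H →L[ℝ] H :=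
  (N : ℝ) • (P[fun ω' => InnerProductSpace.rankOne ℝ (x 1 ω' - x 0 ω') (x 1 ω' - x 0 ω') |
    history x ξ γ 0]) ω - (2 * ℓ ^ 2 * beta ℓ) • CN φ C N

lemma tendsto_zero_of_le_ofReal_mul_div_sqrt_mul {e : ℕ → ENNReal} {n : ℕ} {K c M : ℝ}
    (he : ∀ N, n < N → e N ≤ ENNReal.ofReal (K * (c / √N * M))) : Tendsto e atTop (𝓝 0) := by
  have hdiv : Tendsto (fun N : ℕ => c / √N) atTop (𝓝 0) :=
    (Real.tendsto_sqrt_atTop.comp tendsto_natCast_atTop_atTop).const_div_atTop c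
  have hbound : Tendsto (fun N : ℕ => ENNReal.ofReal (K * (c / √N * M))) atTop (𝓝 0) := by
    simpa using ENNReal.tendsto_ofReal ((hdiv.mul_const M).const_mul K)
  exact tendsto_of_tendsto_of_tendsto_of_le_of_le' tendsto_const_nhds hbound
    (Eventually.of_forall fun _ => zero_le)
    ((eventually_gt_atTop n).mono he)

variable [MeasurableSpace H] [BorelSpace H]

namespace IsRWMChain

variable {Ω : Type*} [MeasurableSpace Ω] {P : Measure Ω} {φ : HilbertBasis ℕ ℝ H}
  {C : H →L[ℝ] H} {Ψ : SobolevSpace s → ℝ} {π₀ : Measure H} {ℓ : ℝ} {x ξ : ℕ → Ω → H}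
  {γ : ℕ → Ω → ℝ} {B S K : ℝ} (h : IsRWMChain P φ lam Ψ π₀ ℓ N x ξ γ)
include h

section Remainders

variable [CompleteSpace H] [IsProbabilityMeasure P] (hlam : ∀ j, lam j ≠ 0)
  (hC : ∀ j, C (φ j) = (lam j) ^ 2 • φ j)

include hlam hC in
lemma inner_driftRemainder (hd : Differentiable ℝ Ψ)
    (hV : Continuous (coordPotential Ψ lam N)) (i : Fin N) :
    ∀ᵐ ω ∂P, inner ℝ (φ i) (driftRemainder P φ C Ψ ℓ N x ξ γ ω) =
      lam i * driftError (coordPotential Ψ lam N) ℓ (ncoord φ lam N (x 0 ω)) i := by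
  filter_upwards [h.inner_condExp_increment hlam hV i] with ω hω
  rw [driftRemainder, inner_sub_right, inner_smul_right, inner_smul_right, hω,
    inner_drift hlam φ hC hd, driftError, Fintype.card_fin]
  ring

include hC in
lemma inner_driftRemainder_of_le {i : ℕ} (hi : N ≤ i) :
    ∀ᵐ ω ∂P, inner ℝ (φ i) (driftRemainder P φ C Ψ ℓ N x ξ γ ω) = (0 : ℝ) := by
  filter_upwards [h.inner_condExp_increment_of_le hi] with ω hω
  rw [driftRemainder, inner_sub_right, inner_smul_right, inner_smul_right, hω,
    inner_drift_of_le φ hC _ _ hi, mul_zero, mul_zero, sub_zero]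

include hlam hC in
lemma sobNormSq_driftRemainder (hd : Differentiable ℝ Ψ)
    (hV : Continuous (coordPotential Ψ lam N)) :
    ∀ᵐ ω ∂P, sobNormSq φ s (driftRemainder P φ C Ψ ℓ N x ξ γ ω) =
      ENNReal.ofReal (wsq (finWeight s lam N)
        (driftError (coordPotential Ψ lam N) ℓ (ncoord φ lam N (x 0 ω)))) := by
  filter_upwards [ae_all_iff.2 (h.inner_driftRemainder hlam hC hd hV),
    ae_all_iff.2 fun i => ae_all_iff.2 (h.inner_driftRemainder_of_le hC (i := i))] with ω hω h_tail
  exact sobNormSq_eq_wsq hω h_tail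

include hlam hC in
lemma sobInner_covRemainder (hV : Continuous (coordPotential Ψ lam N)) (i j : Fin N) :
    ∀ᵐ ω ∂P, sobInner φ s (φ i) (covRemainder P φ C ℓ N x ξ γ ω (φ j)) =
      2 * ℓ ^ 2 * (weight s i * (lam i * lam j)) *
        covError (coordPotential Ψ lam N) ℓ (ncoord φ lam N (x 0 ω)) i j := by
  have hN : (N : ℝ) ≠ 0 := Nat.cast_ne_zero.2 (Fin.pos i).ne'
  have hCN : inner ℝ (φ i) (CN φ C N (φ j)) = lam i * lam j * if i = j then 1 else 0 := by
    rw [CN_eq_diagN φ hC, inner_diagN, if_pos i.2, inner_basis]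
    simp only [Fin.val_inj]
    split_ifs with hij
    · rw [hij]; ring
    · simp
  filter_upwards [h.inner_condExp_rankOne_increment hlam hV i j] with ω hω
  rw [sobInner_basis, covRemainder, sub_apply, smul_apply, smul_apply, inner_sub_right,
    inner_smul_right, inner_smul_right, hω, hCN, covError]
  field_simp

end Remainders

lemma map_ncoord_le [CompleteSpace H] [SecondCountableTopology H]
    (hπ₀ : IsCenteredGaussian π₀ C) (hlam : ∀ j, lam j ≠ 0)
    (hC : ∀ j, C (φ j) = (lam j) ^ 2 • φ j)
    (hK : targetN φ Ψ π₀ N ≤ ENNReal.ofReal K • π₀) :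
    P.map (fun ω => ncoord φ lam N (x 0 ω)) ≤ ENNReal.ofReal K • stdPi (Fin N) := by
  have hmeas := (continuous_ncoord φ lam N).measurable
  calc P.map (fun ω => ncoord φ lam N (x 0 ω))
      = (targetN φ Ψ π₀ N).map (ncoord φ lam N) := by
        rw [← h.law_init, Measure.map_map hmeas (h.measurable_x 0)]
        rfl
    _ ≤ (ENNReal.ofReal K • π₀).map (ncoord φ lam N) := Measure.map_mono hK hmeas
    _ = ENNReal.ofReal K • stdPi (Fin N) := by rw [Measure.map_smul, hπ₀.map_ncoord hlam φ hC]

section Bounds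

variable (hK : 0 ≤ K)
  (hmap : P.map (fun ω => ncoord φ lam N (x 0 ω)) ≤ ENNReal.ofReal K • stdPi (Fin N))
include hK hmap

lemma lintegral_le_of_ae_le_ncoord {e : Ω → ENNReal} {g : (Fin N → ℝ) → ℝ} {c M : ℝ}
    (hg : 0 ≤ g) (hg_int : Integrable g (stdPi (Fin N))) (hM : ∫ X, g X ∂stdPi (Fin N) ≤ M)
    (hc : 0 ≤ c) (he : ∀ᵐ ω ∂P, e ω ≤ ENNReal.ofReal (c * g (ncoord φ lam N (x 0 ω)))) :
    ∫⁻ ω, e ω ∂P ≤ ENNReal.ofReal (K * (c * M)) := by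
  have hmeas : AEMeasurable (fun ω => ncoord φ lam N (x 0 ω)) P :=
    ((continuous_ncoord φ lam N).measurable.comp (h.measurable_x 0)).aemeasurable
  calc ∫⁻ ω, e ω ∂P ≤ ∫⁻ ω, ENNReal.ofReal (c * g (ncoord φ lam N (x 0 ω))) ∂P :=
        lintegral_mono_ae he
    _ = ∫⁻ X, ENNReal.ofReal (c * g X) ∂P.map fun ω => ncoord φ lam N (x 0 ω) :=
        (lintegral_map' ((hg_int.const_mul c).1.aemeasurable.ennreal_ofReal.mono_ac
          (Measure.absolutelyContinuous_of_le_smul hmap)) hmeas).symm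
    _ ≤ ∫⁻ X, ENNReal.ofReal (c * g X) ∂(ENNReal.ofReal K • stdPi (Fin N)) :=
        lintegral_mono' hmap le_rfl
    _ = ENNReal.ofReal (K * (c * ∫ X, g X ∂stdPi (Fin N))) := by
        rw [lintegral_smul_measure, smul_eq_mul, ENNReal.ofReal_mul hK, ← integral_const_mul,
          ofReal_integral_eq_lintegral_ofReal (hg_int.const_mul c)
            (ae_of_all _ fun X => mul_nonneg hc (hg X))]
    _ ≤ ENNReal.ofReal (K * (c * M)) := by gcongr

variable [CompleteSpace H] [IsProbabilityMeasure P] (hlam : ∀ j, lam j ≠ 0)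
  (hC : ∀ j, C (φ j) = (lam j) ^ 2 • φ j) (hℓ : 0 < ℓ)
  (hV : PotentialControl (finWeight s lam N) (coordPotential Ψ lam N) B S)
include hlam hC hℓ hV

lemma lintegral_sobNormSq_driftRemainder_le (hN : 0 < N) (hd : Differentiable ℝ Ψ) :
    ∫⁻ ω, sobNormSq φ s (driftRemainder P φ C Ψ ℓ N x ξ γ ω) ∂P ≤
      ENNReal.ofReal (K * (driftConst ℓ B S / √N * stateSizeConst S)) := by
  have : Nonempty (Fin N) := Fin.pos_iff_nonempty.1 hN
  refine h.lintegral_le_of_ae_le_ncoord hK hmap (stateSize_nonneg (finWeight s lam N))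
    (integrable_stateSize hV.weight_nonneg) (integral_stateSize_le hV.weight_nonneg hV.sum_le)
    (div_nonneg (driftConst_nonneg hV.const_nonneg hV.sum_nonneg) (Real.sqrt_nonneg _)) ?_
  filter_upwards [h.sobNormSq_driftRemainder hlam hC hd hV.differentiable.continuous] with ω hω
  rw [hω, div_mul_eq_mul_div]
  exact ENNReal.ofReal_le_ofReal (by simpa using hV.wsq_driftError_le hℓ (ncoord φ lam N (x 0 ω)))

lemma lintegral_sum_sobInner_covRemainder_le (hN : 0 < N) :
    ∫⁻ ω, ∑ i ∈ Finset.range N, ‖sobInner φ s (φ i) (covRemainder P φ C ℓ N x ξ γ ω (φ i))‖ₑ ∂P ≤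
      ENNReal.ofReal (K * (2 * ℓ ^ 2 * (covConst ℓ B S * (S + 1)) / √N * stateSizeConst S)) := by
  have : Nonempty (Fin N) := Fin.pos_iff_nonempty.1 hN
  have hS := hV.sum_nonneg
  have hcov := covConst_nonneg hℓ.le hV.const_nonneg hS
  refine h.lintegral_le_of_ae_le_ncoord hK hmap (stateSize_nonneg (finWeight s lam N))
    (integrable_stateSize hV.weight_nonneg) (integral_stateSize_le hV.weight_nonneg hV.sum_le)
    (by positivity) ?_
  filter_upwards [ae_all_iff.2 fun i =>
    h.sobInner_covRemainder hlam hC hV.differentiable.continuous i i] with ω hω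
  set X := ncoord φ lam N (x 0 ω)
  have habs (i : Fin N) : ‖sobInner φ s (φ i) (covRemainder P φ C ℓ N x ξ γ ω (φ i))‖ₑ =
      ENNReal.ofReal (2 * ℓ ^ 2 * (finWeight s lam N i *
        |covError (coordPotential Ψ lam N) ℓ X i i|)) := by
    rw [hω, Real.enorm_eq_ofReal_abs, abs_mul, ← sq, ← finWeight, abs_of_nonneg
      (mul_nonneg (by positivity) (finWeight_nonneg s lam N i)), mul_assoc]
  rw [Finset.sum_range]
  simp only [habs]
  rw [← ENNReal.ofReal_sum_of_nonneg fun i _ => mul_nonneg (by positivity)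
    (mul_nonneg (finWeight_nonneg s lam N i) (abs_nonneg _)), ← Finset.mul_sum]
  have hsum := hV.sum_mul_abs_covError_le hℓ X
  rw [Fintype.card_fin] at hsum
  exact ENNReal.ofReal_le_ofReal
    ((mul_le_mul_of_nonneg_left hsum (by positivity)).trans_eq (by ring))

lemma lintegral_sobInner_covRemainder_le {i j : ℕ} (hi : i < N) (hj : j < N) :
    ∫⁻ ω, ‖sobInner φ s (φ i) (covRemainder P φ C ℓ N x ξ γ ω (φ j))‖ₑ ∂P ≤
      ENNReal.ofReal (K * (|2 * ℓ ^ 2 * (weight s i * (lam i * lam j))| * covConst ℓ B S / √N *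
        (stateSizeConst S + 1))) := by
  lift i to Fin N using hi
  lift j to Fin N using hj
  have : Nonempty (Fin N) := ⟨i⟩
  have hcov := covConst_nonneg hℓ.le hV.const_nonneg hV.sum_nonneg
  have hstate := integrable_stateSize hV.weight_nonneg
  refine h.lintegral_le_of_ae_le_ncoord hK hmap
    (g := fun X => stateSize (finWeight s lam N) X + X i ^ 2)
    (fun X => add_nonneg (stateSize_nonneg _ X) (sq_nonneg _))
    (hstate.add (integrable_eval_pow i 2)) ?_ (by positivity) ?_
  · rw [integral_add hstate (integrable_eval_pow i 2), integral_eval_sq]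
    gcongr
    exact integral_stateSize_le hV.weight_nonneg hV.sum_le
  filter_upwards [h.sobInner_covRemainder hlam hC hV.differentiable.continuous i j] with ω hω
  have hle := hV.abs_covError_le hℓ (ncoord φ lam N (x 0 ω)) i j
  rw [Fintype.card_fin] at hle
  rw [hω, Real.enorm_eq_ofReal_abs, abs_mul]
  exact ENNReal.ofReal_le_ofReal
    ((mul_le_mul_of_nonneg_left hle (abs_nonneg _)).trans_eq (by ring))

end Bounds

end IsRWMChain

end

end RWM

theorem proposition2p1_general {H : Type*} [NormedAddCommGroup H] [InnerProductSpace ℝ H]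
    [CompleteSpace H] [TopologicalSpace.SeparableSpace H] [MeasurableSpace H] [BorelSpace H]
    (φ : HilbertBasis ℕ ℝ H) (lam : ℕ → ℝ) (C : H →L[ℝ] H)
    (hC : ∀ j, C (φ j) = (lam j) ^ 2 • φ j)
    (s ℓ : ℝ) (hlam : ∀ j, lam j ≠ 0) (hsum : Summable fun j => RWM.weight s j * lam j ^ 2)
    (Ψ : RWM.SobolevSpace s → ℝ) (hΨ : RWM.PotentialBounds Ψ)
    (hℓ : 0 < ℓ)
    (π₀ : Measure H) (hπ₀ : RWM.IsCenteredGaussian π₀ C)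
    {Ω : ℕ → Type*} [∀ N, MeasurableSpace (Ω N)]
    (P : ∀ N, Measure (Ω N)) [∀ N, IsProbabilityMeasure (P N)]
    (x ξ : ∀ N, ℕ → Ω N → H) (γ : ∀ N, ℕ → Ω N → ℝ)
    (hchain : ∀ N, RWM.IsRWMChain (P N) φ lam Ψ π₀ ℓ N (x N) (ξ N) (γ N)) :
    (∀ N, Integrable (fun ω => x N 1 ω - x N 0 ω) (P N)) ∧
    (∀ N, Integrable (fun ω => InnerProductSpace.rankOne ℝ (x N 1 ω - x N 0 ω)
      (x N 1 ω - x N 0 ω)) (P N)) ∧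
    ∃ (r : ∀ N, Ω N → H) (E : ∀ N, Ω N → H →L[ℝ] H),
      (∀ N : ℕ, ∀ᵐ ω ∂(P N),
        (N : ℝ) • condExp (RWM.history (x N) (ξ N) (γ N) 0) (P N)
            (fun ω' => x N 1 ω' - x N 0 ω') ω =
          -(ℓ ^ 2 * RWM.beta ℓ) •
            (RWM.PN φ N (x N 0 ω) + RWM.CN φ C N (RWM.gradPsiN φ Ψ N (x N 0 ω))) + r N ω) ∧
      (∀ N : ℕ, ∀ᵐ ω ∂(P N),
        (N : ℝ) • condExp (RWM.history (x N) (ξ N) (γ N) 0) (P N)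
            (fun ω' => InnerProductSpace.rankOne ℝ (x N 1 ω' - x N 0 ω')
              (x N 1 ω' - x N 0 ω')) ω =
          (2 * ℓ ^ 2 * RWM.beta ℓ) • RWM.CN φ C N + E N ω) ∧
      Tendsto (fun N => ∫⁻ ω, RWM.sobNormSq φ s (r N ω) ∂(P N)) atTop (𝓝 0) ∧
      Tendsto (fun N => ∫⁻ ω, ∑ i ∈ Finset.range N,
        ‖RWM.sobInner φ s (φ i) (E N ω (φ i))‖ₑ ∂(P N)) atTop (𝓝 0) ∧
      ∀ i j : ℕ, Tendsto (fun N => ∫⁻ ω,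
        ‖RWM.sobInner φ s (φ i) (E N ω (φ j))‖ₑ ∂(P N)) atTop (𝓝 0) := by
  have := UniformSpace.secondCountable_of_separable H
  obtain ⟨B, hV⟩ := hΨ.exists_potentialControl hsum
  obtain ⟨K, hK, hle⟩ := hπ₀.exists_targetN_le hlam φ hC hΨ hsum
  have hmap (N : ℕ) := (hchain N).map_ncoord_le hπ₀ hlam hC (hle N)
  refine ⟨fun N => (hchain N).integrable_increment,
    fun N => (hchain N).integrable_rankOne_increment,
    fun N => RWM.driftRemainder (P N) φ C Ψ ℓ N (x N) (ξ N) (γ N),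
    fun N => RWM.covRemainder (P N) φ C ℓ N (x N) (ξ N) (γ N),
    fun N => ae_of_all _ fun ω => (add_sub_cancel _ _).symm,
    fun N => ae_of_all _ fun ω => (add_sub_cancel _ _).symm, ?_, ?_, fun i j => ?_⟩
  · exact RWM.tendsto_zero_of_le_ofReal_mul_div_sqrt_mul fun N hN =>
      (hchain N).lintegral_sobNormSq_driftRemainder_le hK (hmap N) hlam hC hℓ (hV N) hN
        hΨ.differentiable
  · exact RWM.tendsto_zero_of_le_ofReal_mul_div_sqrt_mul fun N hN =>
      (hchain N).lintegral_sum_sobInner_covRemainder_le hK (hmap N) hlam hC hℓ (hV N) hN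
  · exact RWM.tendsto_zero_of_le_ofReal_mul_div_sqrt_mul (n := max i j) fun N hN =>
      (hchain N).lintegral_sobInner_covRemainder_le hK (hmap N) hlam hC hℓ (hV N)
        (max_lt_iff.1 hN).1 (max_lt_iff.1 hN).2

theorem proposition2p1 {H : Type*} [NormedAddCommGroup H] [InnerProductSpace ℝ H]
    [CompleteSpace H] [TopologicalSpace.SeparableSpace H] [MeasurableSpace H] [BorelSpace H]
    (φ : HilbertBasis ℕ ℝ H) (lam : ℕ → ℝ) (C : H →L[ℝ] H)
    (hC : ∀ j, C (φ j) = (lam j) ^ 2 • φ j)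
    (κ s ℓ : ℝ) (hκ : 1 / 2 < κ) (hlam : RWM.EigenvalueDecay lam κ)
    (hs0 : 0 ≤ s) (hs : s < κ - 1 / 2)
    (Ψ : RWM.SobolevSpace s → ℝ) (hΨ : RWM.PotentialBounds Ψ)
    (hℓ : 0 < ℓ)
    (π₀ : Measure H) (hπ₀ : RWM.IsCenteredGaussian π₀ C)
    {Ω : ℕ → Type*} [∀ N, MeasurableSpace (Ω N)]
    (P : ∀ N, Measure (Ω N)) [∀ N, IsProbabilityMeasure (P N)]
    (x ξ : ∀ N, ℕ → Ω N → H) (γ : ∀ N, ℕ → Ω N → ℝ)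
    (hchain : ∀ N, RWM.IsRWMChain (P N) φ lam Ψ π₀ ℓ N (x N) (ξ N) (γ N)) :
    (∀ N, Integrable (fun ω => x N 1 ω - x N 0 ω) (P N)) ∧
    (∀ N, Integrable (fun ω => InnerProductSpace.rankOne ℝ (x N 1 ω - x N 0 ω)
      (x N 1 ω - x N 0 ω)) (P N)) ∧
    ∃ (r : ∀ N, Ω N → H) (E : ∀ N, Ω N → H →L[ℝ] H),
      (∀ N : ℕ, ∀ᵐ ω ∂(P N),
        (N : ℝ) • condExp (RWM.history (x N) (ξ N) (γ N) 0) (P N)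
            (fun ω' => x N 1 ω' - x N 0 ω') ω =
          -(ℓ ^ 2 * RWM.beta ℓ) •
            (RWM.PN φ N (x N 0 ω) + RWM.CN φ C N (RWM.gradPsiN φ Ψ N (x N 0 ω))) + r N ω) ∧
      (∀ N : ℕ, ∀ᵐ ω ∂(P N),
        (N : ℝ) • condExp (RWM.history (x N) (ξ N) (γ N) 0) (P N)
            (fun ω' => InnerProductSpace.rankOne ℝ (x N 1 ω' - x N 0 ω')
              (x N 1 ω' - x N 0 ω')) ω =
          (2 * ℓ ^ 2 * RWM.beta ℓ) • RWM.CN φ C N + E N ω) ∧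
      Tendsto (fun N => ∫⁻ ω, RWM.sobNormSq φ s (r N ω) ∂(P N)) atTop (𝓝 0) ∧
      Tendsto (fun N => ∫⁻ ω, ∑ i ∈ Finset.range N,
        ‖RWM.sobInner φ s (φ i) (E N ω (φ i))‖ₑ ∂(P N)) atTop (𝓝 0) ∧
      ∀ i j : ℕ, Tendsto (fun N => ∫⁻ ω,
        ‖RWM.sobInner φ s (φ i) (E N ω (φ j))‖ₑ ∂(P N)) atTop (𝓝 0) :=
  proposition2p1_general φ lam C hC s ℓ (fun j => (hlam.pos j).ne') (hlam.summable hs) Ψ hΨ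
    hℓ π₀ hπ₀ P x ξ γ hchain
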